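/- Let $\Phi$ be a homogeneous Poisson point process in $\mathbb{R}^2$ of intensity $\lambda>0$. For $x\in\Phi$ let $C(x)=\{y\in\mathbb{R}^2:\|y-x\|\le\|y-z\|\text{ for all }z\in\Phi\}$ be its Voronoi cell and let $R(x)=\sup_{y\in C(x)}\|y-x\|\in[0,\infty]$ be the circumradius of the cell, that is, the radius of the smallest disk centred at the nucleus $x$ that contains the cell. Let $R_C$ be the circumradius of the typical cell: its law is given, for any Borel set $B\subseteq\mathbb{R}^2$ with $0<|B|<\infty$, by $$\mathbb{P}(R_C\in A)=\frac{\mathbb{E}\,\#\{x\in\Phi\cap B: R(x)\in A\}}{\mathbb{E}\,\#(\Phi\cap B)},\qquad A\subseteq[0,\infty]\text{ Borel}.$$ Put $F(t)=\sin^2(\pi t)\,\mathbf{1}(0\le t\le\tfrac12)+\mathbf{1}(t>\tfrac12)$ and, for $k\ge1$ and $r>0$, $$\zeta_k(r)=\int_{\Delta_k}\Big[\prod_{i=1}^kF(u_i)\Big]\exp\Big(4\pi\lambda r^2\sum_{i=1}^k\int_0^{u_i}F(t)\,dt\Big)\,d\sigma_k(u),\qquad \psi_k(r)=\frac{d\zeta_k(r)}{dr},$$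 where $\sigma_k$ is the uniform probability distribution on the simplex $\Delta_k=\{u\in[0,1]^k:u_1+\dots+u_k=1\}$. Then these integrals, these derivatives and the series below exist (the series converges) for all $r>0$, and $R_C$ is almost surely in $(0,\infty)$ and has there the (nonnegative, measurable) probability density function $$f_{R_C}(r)=8\pi\lambda r\,e^{-4\pi\lambda r^2}\Big[1+\sum_{k\ge1}\Big\{\frac{(-4\pi\lambda r^2)^k}{k!}\Big(\frac{\psi_k(r)}{8\pi\lambda r}-\zeta_k(r)\Big)-\frac{(-4\pi\lambda r^2)^{k-1}\,\zeta_k(r)}{(k-1)!}\Big\}\Big],\qquad r>0.$$ -/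

import Mathlib

open MeasureTheory ProbabilityTheory
open scoped ENNReal

noncomputable section

namespace PoissonVoronoi

/-- The Euclidean plane. -/
abbrev Plane : Type := EuclideanSpace ℝ (Fin 2)

/-- `Φ` is a homogeneous Poisson point process of intensity `lam` in the plane: a random locally
finite set whose number of points in a Borel set `B` of finite area is Poisson distributed with
mean `lam * area B`, the numbers of points in disjoint Borel sets being independent. -/
structure IsPoissonProcess {Ω : Type*} [MeasurableSpace Ω] (μ : Measure Ω) (lam : ℝ)
    (Φ : Ω → Set Plane) : Prop where
  locallyFinite : ∀ ω, ∀ K : Set Plane, Bornology.IsBounded K → (Φ ω ∩ K).Finite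
  measurable_count : ∀ B : Set Plane, MeasurableSet B → Measurable fun ω => (Φ ω ∩ B).encard
  count_law : ∀ B : Set Plane, MeasurableSet B → volume B ≠ ∞ → ∀ n : ℕ,
    μ {ω | (Φ ω ∩ B).encard = n} =
      ENNReal.ofReal (Real.exp (-(lam * (volume B).toReal)) *
        (lam * (volume B).toReal) ^ n / (n.factorial : ℝ))
  indep_count : ∀ (n : ℕ) (B : Fin n → Set Plane), (∀ i, MeasurableSet (B i)) →
    Pairwise (fun i j => Disjoint (B i) (B j)) →
    iIndepFun (fun i ω => (Φ ω ∩ B i).encard) μ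

/-- The Voronoi cell with nucleus `x` with respect to the set of points `S`. -/
def voronoiCell (S : Set Plane) (x : Plane) : Set Plane :=
  {y | ∀ z ∈ S, dist y x ≤ dist y z}

/-- The circumradius of the Voronoi cell with nucleus `x`: the distance from the nucleus to the
farthest point of the cell, that is, the radius of the smallest disk centred at the nucleus that
contains the cell (`∞` if the cell is unbounded). -/
def circumradius (S : Set Plane) (x : Plane) : ℝ≥0∞ :=
  ⨆ y ∈ voronoiCell S x, edist x y

/-- The probability that the circumradius of the typical cell of the Voronoi tessellation of the
point process `Φ` lies in `A`, in the sense of Palm: the expected number of nuclei in the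
window `B` whose cell has its circumradius in `A`, divided by the expected number of nuclei
in `B`. -/
def typicalCircumradiusProb {Ω : Type*} [MeasurableSpace Ω] (μ : Measure Ω)
    (Φ : Ω → Set Plane) (B : Set Plane) (A : Set ℝ≥0∞) : ℝ≥0∞ :=
  (∫⁻ ω, (({x ∈ Φ ω ∩ B | circumradius (Φ ω) x ∈ A}.encard : ℕ∞) : ℝ≥0∞) ∂μ) /
    (∫⁻ ω, (((Φ ω ∩ B).encard : ℕ∞) : ℝ≥0∞) ∂μ)

/-- The uniform probability distribution on the simplex of all `u` in `ℝ^k` with nonnegative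
coordinates of sum `1` (for `k ≥ 1`): the image of the uniform distribution on the set of all
`v` in `ℝ^(k-1)` with nonnegative coordinates of sum at most `1` under the affine bijection
which sends `v` to the point with first coordinate `1 - ∑ i, v i` and remaining coordinates `v`. -/
def simplexUniform : (k : ℕ) → Measure (Fin k → ℝ)
  | 0 => 0
  | n + 1 => (cond (volume : Measure (Fin n → ℝ)) {v | (∀ i, 0 ≤ v i) ∧ ∑ i, v i ≤ 1}).map
      (fun v => (Fin.cons (1 - ∑ i, v i) v : Fin (n + 1) → ℝ))

/-- `F(t) = sin²(π t)` for `0 ≤ t ≤ 1/2`, `F(t) = 1` for `t > 1/2`, and `0` otherwise. -/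
def F (t : ℝ) : ℝ :=
  Set.indicator (Set.Icc 0 (1 / 2)) (fun t => Real.sin (Real.pi * t) ^ 2) t +
    Set.indicator (Set.Ioi (1 / 2)) (fun _ => 1) t

/-- The integrand of `ζ_k(r)`. -/
def zetaIntegrand (lam : ℝ) (k : ℕ) (r : ℝ) (u : Fin k → ℝ) : ℝ :=
  (∏ i, F (u i)) *
    Real.exp (4 * Real.pi * lam * r ^ 2 * ∑ i, ∫ t in (0 : ℝ)..(u i), F t)

/-- `ζ_k(r)`. -/
def zeta (lam : ℝ) (k : ℕ) (r : ℝ) : ℝ :=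
  ∫ u, zetaIntegrand lam k r u ∂(simplexUniform k)

/-- `ψ_k(r)`, the derivative of `ζ_k` at `r`. -/
def psi (lam : ℝ) (k : ℕ) (r : ℝ) : ℝ :=
  deriv (zeta lam k) r

/-- The `k`-th term, `k ≥ 1`, of the series in the density. -/
def densityTerm (lam : ℝ) (r : ℝ) (k : ℕ) : ℝ :=
  (-(4 * Real.pi * lam * r ^ 2)) ^ k / (k.factorial : ℝ) *
      (psi lam k r / (8 * Real.pi * lam * r) - zeta lam k r) -
    (-(4 * Real.pi * lam * r ^ 2)) ^ (k - 1) * zeta lam k r / ((k - 1).factorial : ℝ)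

/-- The density of the circumradius at `r > 0`; the series runs over `k = n + 1 ≥ 1`. -/
def density (lam : ℝ) (r : ℝ) : ℝ :=
  8 * Real.pi * lam * r * Real.exp (-(4 * Real.pi * lam * r ^ 2)) *
    (1 + ∑' n : ℕ, densityTerm lam r (n + 1))

end PoissonVoronoi

end

noncomputable section

namespace PoissonVoronoi

/-! Fix r > 0 and a nucleus x, and call a point of the circle of radius r about x covered if it is
nearer to another point of Φ than to x. The cell reaches beyond radius r exactly when, for some s >
r, the circle of radius s is not wholly covered (`lt_circumradius_iff`), so the Palm probability of
an uncovered point is needed. A point z with 0 < ‖z - x‖ < 2r covers an open arc, at most half of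
the circle; other points cover nothing. The circle is not wholly covered exactly when there is no
arc at all or the starting point of some arc is uncovered (`uncovered_iff`). If N is the number of
uncovered starts, then 1(N > 0) = ∑_{k≥1} (-1)^{k-1} N(N-1)⋯(N-k+1)/k!, and the falling factorials
count k-tuples of points (`tupleCount_gap_eq_sum`).

The mean tuple counts come from a multivariate Mecke formula (`lintegral_tupleCount_void`): a start
is uncovered when the disk of radius r about it contains no point of Φ. The computation rests on one
change of variables (`map_arc_diskMeasure`): in terms of the start and the length of the arc,
Lebesgue measure on the disk of radius 2r is the uniform distribution times a measure which gives
mass 4πr²F(d) to the lengths at most d (`arcLenLaw_Iic`). It is used twice. Arcs leave each other's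
starts uncovered when each is no longer than the gap to the next start, which gives the factors
4πr²F(gap) (`setLIntegral_uncoveredStarts`). The union of the disks about the starts has area 4πr²(1
- ∑ ∫₀^gap F), since a point lies in it when its arc covers some start (`volume_iUnion_ball`). The
gaps between k uniform points of the circle are uniform on the simplex (`lintegral_gapWeight`), and
ζ_k appears.

With c = 4πλr² the survival function of R_C is therefore e^{-c}(1 - ∑_{k≥1} (-c)^k ζ_k/k!)
(`integral_encard_uncovered`). The bounds 0 ≤ ζ_k ≤ e^c allow termwise differentiation, and the
derivative in r is minus the asserted density (`hasDerivAt_survival`). The density is nonnegative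
because expected counts of uncovered nuclei decrease in r. The survival function is 1 at r = 0 and
tends to 0 by the first Bonferroni bound and ∫₀¹ F < 1 (`tendsto_survival`). Hence the density has
mass 1, and agreement on the rays determines the law. -/

/-! ### Counting measures of tuples of distinct points -/

/-- The ordered `k`-tuples of distinct points of `S`. -/
def tupleSet (S : Set Plane) (k : ℕ) : Set (Fin k → Plane) :=
  {x | Function.Injective x ∧ ∀ i, x i ∈ S}

/-- The counting measure of the ordered `k`-tuples of distinct points of `S`. -/
def tupleCount (S : Set Plane) (k : ℕ) : Measure (Fin k → Plane) :=
  Measure.count.restrict (tupleSet S k)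

lemma countable_of_locallyFinite {S : Set Plane}
    (hS : ∀ K : Set Plane, Bornology.IsBounded K → (S ∩ K).Finite) : S.Countable := by
  have : S = ⋃ n : ℕ, S ∩ Metric.ball 0 n := by
    rw [← Set.inter_iUnion, Metric.iUnion_ball_nat, Set.inter_univ]
  rw [this]
  exact Set.countable_iUnion fun n => (hS _ Metric.isBounded_ball).countable

lemma tupleSet_countable {S : Set Plane} (hS : S.Countable) (k : ℕ) :
    (tupleSet S k).Countable := by
  refine Set.Countable.mono ?_ (Set.countable_univ_pi fun _ : Fin k => hS)
  intro x hx
  simpa using hx.2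

lemma tupleCount_apply {S : Set Plane} (hS : S.Countable) {k : ℕ} (C : Set (Fin k → Plane)) :
    tupleCount S k C = ((C ∩ tupleSet S k).encard : ℝ≥0∞) := by
  rw [tupleCount, Measure.restrict_apply' (tupleSet_countable hS k).measurableSet,
    Measure.count_apply ((tupleSet_countable hS k).mono Set.inter_subset_right).measurableSet]

/-- Disjointness of the `B i` makes every choice of one point from each `S ∩ B i` injective, so the
tuples form a full finite product. -/
lemma tupleCount_pi {S : Set Plane} (hS : S.Countable) {k : ℕ} {B : Fin k → Set Plane}
    (hd : Pairwise fun i j => Disjoint (B i) (B j)) (hf : ∀ i, (S ∩ B i).Finite) :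
    tupleCount S k (Set.univ.pi B) = ∏ i, ((S ∩ B i).encard : ℝ≥0∞) := by
  have h1 : Set.univ.pi B ∩ tupleSet S k = Set.univ.pi fun i => S ∩ B i := by
    ext x
    simp only [Set.mem_inter_iff, Set.mem_univ_pi, tupleSet, Set.mem_ofPred_eq]
    refine ⟨fun h i => ⟨h.2.2 i, h.1 i⟩, fun h => ⟨fun i => (h i).2, ?_, fun i => (h i).1⟩⟩
    intro i j hij
    by_contra hne
    exact Set.disjoint_left.1 (hd hne) (h i).2 (hij ▸ (h j).2)
  rw [tupleCount_apply hS, h1]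
  have h2 : (Set.univ.pi fun i => S ∩ B i) =
      (Fintype.piFinset fun i => (hf i).toFinset : Finset (Fin k → Plane)) := by
    simp
  rw [h2, Set.encard_coe_eq_coe_finsetCard, Fintype.card_piFinset]
  have h3 (i : Fin k) : ((S ∩ B i).encard : ℝ≥0∞) = ((hf i).toFinset.card : ℝ≥0∞) := by
    rw [(hf i).encard_eq_coe_toFinset_card]
    simp
  simp_rw [h3]
  rw [← Nat.cast_prod]
  exact ENat.toENNReal_coe _

/-! ### A countable cover of the injective tuples by products of disjoint balls -/

/-- The centre of the `m`-th ball of a countable basis of the plane. -/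
def basisCenter (m : ℕ) : Plane := TopologicalSpace.denseSeq Plane m.unpair.1

/-- The radius of the `m`-th ball of a countable basis of the plane. -/
def basisRadius (m : ℕ) : ℝ := 1 / ((m.unpair.2 : ℝ) + 1)

/-- The `m`-th ball of a countable basis of the plane. -/
def basisBall (m : ℕ) : Set Plane := Metric.ball (basisCenter m) (basisRadius m)

lemma exists_basisBall (p : Plane) {ε : ℝ} (hε : 0 < ε) :
    ∃ m, p ∈ basisBall m ∧ basisRadius m < ε := by
  obtain ⟨n, hn⟩ := exists_nat_one_div_lt hε
  have hpos : (0 : ℝ) < 1 / ((n : ℝ) + 1) := by positivity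
  obtain ⟨j, hj⟩ := (TopologicalSpace.denseRange_denseSeq Plane).exists_dist_lt p hpos
  refine ⟨Nat.pair j n, ?_, ?_⟩
  · simpa [basisBall, basisCenter, basisRadius] using hj
  · simpa [basisRadius] using hn

lemma measurableSet_basisBall (m : ℕ) : MeasurableSet (basisBall m) :=
  Metric.isOpen_ball.measurableSet

lemma isBounded_basisBall (m : ℕ) : Bornology.IsBounded (basisBall m) := Metric.isBounded_ball

lemma volume_basisBall_ne_top (m : ℕ) : volume (basisBall m) ≠ ∞ := measure_ball_lt_top.ne

/-- The index type of a countable cover of the injective tuples by products of disjoint balls. -/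
abbrev DisjIdx (k : ℕ) : Type :=
  {c : Fin k → ℕ // Pairwise fun i j => Disjoint (basisBall (c i)) (basisBall (c j))}

/-- A product of disjoint balls. -/
def disjProd {k : ℕ} (c : DisjIdx k) : Set (Fin k → Plane) :=
  Set.univ.pi fun i => basisBall (c.1 i)

lemma measurableSet_disjProd {k : ℕ} (c : DisjIdx k) : MeasurableSet (disjProd c) :=
  MeasurableSet.univ_pi fun _ => measurableSet_basisBall _

lemma injective_subset_iUnion_disjProd (k : ℕ) :
    {x : Fin k → Plane | Function.Injective x} ⊆ ⋃ c : DisjIdx k, disjProd c := by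
  intro x hx
  obtain ⟨δ, hδ, hsep⟩ : ∃ δ > 0, ∀ i j, i ≠ j → δ ≤ dist (x i) (x j) := by

    by_cases hne : ({p : Fin k × Fin k | p.1 ≠ p.2}).Nonempty
    · obtain ⟨p, hp, hmin⟩ := Set.exists_min_image _ (fun p : Fin k × Fin k => dist (x p.1) (x p.2))
        (Set.toFinite {p : Fin k × Fin k | p.1 ≠ p.2}) hne
      exact ⟨_, dist_pos.2 (fun h => hp (hx h)), fun i j hij => hmin (i, j) hij⟩
    · refine ⟨1, one_pos, fun i j hij => (hne ⟨(i, j), hij⟩).elim⟩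
  -- If two of the chosen balls met, the corresponding entries would be closer than two diameters,
  -- that is, than `4 * (δ / 4) = δ`.
  choose c hc hr using fun i => exists_basisBall (x i) (ε := δ / 4) (by positivity)
  have hd : Pairwise fun i j => Disjoint (basisBall (c i)) (basisBall (c j)) := by
    intro i j hij
    rw [Set.disjoint_left]
    intro p hp hq
    have h1 : dist p (basisCenter (c i)) < basisRadius (c i) := hp
    have h2 : dist p (basisCenter (c j)) < basisRadius (c j) := hq
    have h3 : dist (x i) (basisCenter (c i)) < basisRadius (c i) := hc i
    have h4 : dist (x j) (basisCenter (c j)) < basisRadius (c j) := hc j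
    have h5 := dist_triangle (x i) (basisCenter (c i)) p
    have h6 := dist_triangle p (basisCenter (c j)) (x j)
    have h7 := dist_triangle (x i) p (x j)
    rw [dist_comm (basisCenter (c i)) p] at h5
    rw [dist_comm (basisCenter (c j)) (x j)] at h6
    linarith [hsep i j hij, hr i, hr j]
  exact Set.mem_iUnion.2 ⟨⟨c, hd⟩, Set.mem_univ_pi.2 hc⟩

lemma tupleCount_restrict_iUnion (S : Set Plane) (k : ℕ) :
    (tupleCount S k).restrict (⋃ c : DisjIdx k, disjProd c) = tupleCount S k := by
  rw [tupleCount, Measure.restrict_restrict (MeasurableSet.iUnion measurableSet_disjProd),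
    Set.inter_eq_right.2]
  exact fun x hx => injective_subset_iUnion_disjProd k hx.1

/-! ### Measurability and means of Poisson counts -/

section

variable {Ω : Type*} [MeasurableSpace Ω] {μ : Measure Ω} {lam : ℝ} {Φ : Ω → Set Plane}

lemma IsPoissonProcess.countable (hΦ : IsPoissonProcess μ lam Φ) (ω : Ω) : (Φ ω).Countable :=
  countable_of_locallyFinite (hΦ.locallyFinite ω)

lemma IsPoissonProcess.measurable_encard (hΦ : IsPoissonProcess μ lam Φ) {B : Set Plane}
    (hB : MeasurableSet B) : Measurable fun ω => ((Φ ω ∩ B).encard : ℝ≥0∞) :=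
  Measurable.of_discrete.comp (hΦ.measurable_count B hB)

lemma IsPoissonProcess.measurableSet_void (hΦ : IsPoissonProcess μ lam Φ) {B : Set Plane}
    (hB : MeasurableSet B) : MeasurableSet {ω | Φ ω ∩ B = ∅} := by
  have : {ω | Φ ω ∩ B = ∅} = (fun ω => (Φ ω ∩ B).encard) ⁻¹' {0} := by
    ext ω; simp
  rw [this]
  exact hΦ.measurable_count B hB (measurableSet_singleton _)

lemma tupleCount_disjProd_inter (hΦ : IsPoissonProcess μ lam Φ) {k : ℕ} (c : DisjIdx k)
    (B : Fin k → Set Plane) (ω : Ω) :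
    tupleCount (Φ ω) k (Set.univ.pi B ∩ disjProd c) =
      ∏ i, ((Φ ω ∩ (B i ∩ basisBall (c.1 i))).encard : ℝ≥0∞) := by
  rw [disjProd, ← Set.pi_inter_distrib, tupleCount_pi (hΦ.countable ω)]
  · intro i j hij
    exact (c.2 hij).mono Set.inter_subset_right Set.inter_subset_right
  · exact fun i => hΦ.locallyFinite ω _ ((isBounded_basisBall _).subset Set.inter_subset_right)

/-- On a product of disjoint bounded balls the measure is finite and its values on boxes are
products of counts; boxes form a generating π-system. -/
lemma measurable_tupleCount_restrict (hΦ : IsPoissonProcess μ lam Φ) {k : ℕ} (c : DisjIdx k) :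
    Measurable fun ω => (tupleCount (Φ ω) k).restrict (disjProd c) := by
  have hfin (ω : Ω) : IsFiniteMeasure ((tupleCount (Φ ω) k).restrict (disjProd c)) := by
    refine ⟨?_⟩
    rw [Measure.restrict_apply_univ]
    have := tupleCount_disjProd_inter hΦ c (fun _ => Set.univ) ω
    rw [Set.pi_univ, Set.univ_inter] at this
    rw [this]
    refine ENNReal.prod_lt_top fun i _ => ?_
    have h := hΦ.locallyFinite ω _ ((isBounded_basisBall (c.1 i)).subset
      (Set.inter_subset_right (s := Set.univ)))
    rw [h.encard_eq_coe_toFinset_card]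
    simp
  have key (B : Fin k → Set Plane) (hB : ∀ i, MeasurableSet (B i)) :
      Measurable fun ω => (tupleCount (Φ ω) k).restrict (disjProd c) (Set.univ.pi B) := by
    simp_rw [Measure.restrict_apply (MeasurableSet.univ_pi hB), tupleCount_disjProd_inter hΦ]
    exact Finset.measurable_prod _ fun i _ =>
      hΦ.measurable_encard ((hB i).inter (measurableSet_basisBall _))
  refine Measurable.measure_of_isPiSystem generateFrom_pi.symm isPiSystem_pi ?_ ?_
  · rintro _ ⟨B, hB, rfl⟩
    exact key B fun i => hB i (Set.mem_univ i)
  · simpa using key (fun _ => Set.univ) fun _ => MeasurableSet.univ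

/-- The products of disjoint balls overlap, so the cover is first made disjoint; the measure is then
a countable sum of measurable pieces. -/
lemma measurable_tupleCount (hΦ : IsPoissonProcess μ lam Φ) (k : ℕ) :
    Measurable fun ω => tupleCount (Φ ω) k := by
  refine Measure.measurable_of_measurable_coe _ fun C hC => ?_
  obtain ⟨e, he⟩ : ∃ e : ℕ → Set (Fin k → Plane), (∀ n, MeasurableSet (e n) ∧
      Measurable fun ω => (tupleCount (Φ ω) k).restrict (e n)) ∧
      ⋃ n, e n = ⋃ c : DisjIdx k, disjProd c := by
    rcases isEmpty_or_nonempty (DisjIdx k) with h | h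
    · refine ⟨fun _ => ∅, fun _ => ⟨MeasurableSet.empty, by simp⟩, by simp⟩
    · obtain ⟨f, hf⟩ := exists_surjective_nat (DisjIdx k)
      refine ⟨fun n => disjProd (f n), fun n => ⟨measurableSet_disjProd _,
        measurable_tupleCount_restrict hΦ _⟩, ?_⟩
      exact hf.iUnion_comp _
  have hdm (n : ℕ) : MeasurableSet (disjointed e n) :=
    MeasurableSet.disjointed (fun n => (he.1 n).1) n
  have : (fun ω => tupleCount (Φ ω) k C) = fun ω =>
      ∑' n, (tupleCount (Φ ω) k).restrict (e n) (C ∩ disjointed e n) := by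
    ext ω
    conv_lhs => rw [← tupleCount_restrict_iUnion (Φ ω) k, ← he.2, ← iUnion_disjointed,
      Measure.restrict_apply hC, Set.inter_iUnion]
    rw [measure_iUnion]
    · refine tsum_congr fun n => ?_
      rw [Measure.restrict_apply (hC.inter (hdm n)), Set.inter_assoc,
        Set.inter_eq_left.2 (disjointed_subset e n)]
    · exact fun i j hij => ((disjoint_disjointed e) hij).mono Set.inter_subset_right
        Set.inter_subset_right
    · exact fun n => hC.inter (hdm n)
  rw [this]
  exact Measurable.tsum fun n => (Measure.measurable_coe (hC.inter (hdm n))).comp (he.1 n).2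

lemma lintegral_encard [IsProbabilityMeasure μ] (hlam : 0 < lam) (hΦ : IsPoissonProcess μ lam Φ)
    {B : Set Plane} (hB : MeasurableSet B) (hv : volume B ≠ ∞) :
    ∫⁻ ω, ((Φ ω ∩ B).encard : ℝ≥0∞) ∂μ = ENNReal.ofReal lam * volume B := by
  set m := lam * (volume B).toReal with hm
  have hm0 : 0 ≤ m := by positivity
  have hmeas := hΦ.measurable_count B hB
  have hlaw (n : ℕ) : μ ((fun ω => (Φ ω ∩ B).encard) ⁻¹' {(n : ℕ∞)}) =
      ENNReal.ofReal (Real.exp (-m) * m ^ n / n.factorial) := hΦ.count_law B hB hv n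
  have hpart : (⋃ n : ℕ, (fun ω => (Φ ω ∩ B).encard) ⁻¹' {(n : ℕ∞)}) =
      ((fun ω => (Φ ω ∩ B).encard) ⁻¹' {⊤})ᶜ := by
    ext ω
    simp only [Set.mem_iUnion, Set.mem_preimage, Set.mem_singleton_iff, Set.mem_compl_iff]
    constructor
    · rintro ⟨n, hn⟩ h
      rw [hn] at h
      exact ENat.natCast_ne_top n h
    · intro h
      obtain ⟨n, hn⟩ := ENat.ne_top_iff_exists.1 h
      exact ⟨n, hn.symm⟩
  have hdisj : Pairwise (Function.onFun Disjoint
      fun n : ℕ => (fun ω => (Φ ω ∩ B).encard) ⁻¹' {(n : ℕ∞)}) := by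
    intro i j hij
    refine Disjoint.preimage _ (Set.disjoint_singleton.2 ?_)
    exact_mod_cast hij
  have hms (n : ℕ) : MeasurableSet ((fun ω => (Φ ω ∩ B).encard) ⁻¹' {(n : ℕ∞)}) :=
    hmeas (measurableSet_singleton _)
  have hexp (x : ℝ) : HasSum (fun n : ℕ => x ^ n / n.factorial) (Real.exp x) := by
    rw [Real.exp_eq_exp_ℝ]; exact NormedSpace.expSeries_div_hasSum_exp x
  -- The Poisson weights sum to 1, so the count is almost surely finite.
  have hone : μ ((fun ω => (Φ ω ∩ B).encard) ⁻¹' {⊤}) = 0 := by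
    have : μ ((fun ω => (Φ ω ∩ B).encard) ⁻¹' {⊤})ᶜ = 1 := by
      rw [← hpart, measure_iUnion hdisj hms]
      simp_rw [hlaw]
      rw [← ENNReal.ofReal_tsum_of_nonneg (fun n => by positivity)]
      · simp_rw [mul_div_assoc]
        rw [tsum_mul_left, (hexp m).tsum_eq, ← Real.exp_add]
        simp
      · simp_rw [mul_div_assoc]
        exact (hexp m).summable.mul_left _
    rwa [prob_compl_eq_one_iff (hmeas (measurableSet_singleton _))] at this
  rw [← lintegral_add_compl _ (hmeas (measurableSet_singleton ⊤)),
    setLIntegral_measure_zero _ _ hone, zero_add, ← hpart, lintegral_iUnion hms hdisj]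
  have h1 (n : ℕ) : ∫⁻ ω in (fun ω => (Φ ω ∩ B).encard) ⁻¹' {(n : ℕ∞)},
      ((Φ ω ∩ B).encard : ℝ≥0∞) ∂μ = ENNReal.ofReal (n * (Real.exp (-m) * m ^ n / n.factorial)) := by
    rw [setLIntegral_congr_fun (g := fun _ => (n : ℝ≥0∞)) (hms n), setLIntegral_const, hlaw,
      ENNReal.ofReal_mul (by positivity), ENNReal.ofReal_natCast]
    intro ω hω
    have : (Φ ω ∩ B).encard = n := hω
    simp [this]
  simp_rw [h1]
  have h2 : HasSum (fun n : ℕ => (n : ℝ) * (Real.exp (-m) * m ^ n / n.factorial)) m := by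
    rw [← hasSum_nat_add_iff' 1]
    simp only [Finset.range_one, Finset.sum_singleton, Nat.cast_zero, zero_mul, sub_zero]
    have : ∀ n : ℕ, ((n + 1 : ℕ) : ℝ) * (Real.exp (-m) * m ^ (n + 1) / (n + 1).factorial) =
        (Real.exp (-m) * m) * (m ^ n / n.factorial) := by
      intro n
      rw [Nat.factorial_succ]
      push_cast
      field_simp
      ring
    simp_rw [this]
    have h3 := (hexp m).mul_left (Real.exp (-m) * m)
    rwa [mul_right_comm, ← Real.exp_add, neg_add_cancel, Real.exp_zero, one_mul] at h3
  rw [← ENNReal.ofReal_tsum_of_nonneg (fun n => by positivity) h2.summable, h2.tsum_eq, hm,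
    ENNReal.ofReal_mul hlam.le, ENNReal.ofReal_toReal hv]

lemma prob_void (hΦ : IsPoissonProcess μ lam Φ) {K : Set Plane} (hK : MeasurableSet K)
    (hv : volume K ≠ ∞) :
    μ {ω | Φ ω ∩ K = ∅} = ENNReal.ofReal (Real.exp (-(lam * (volume K).toReal))) := by
  have := hΦ.count_law K hK hv 0
  simpa using this

/-! ### The Mecke formula with a fixed empty region -/

/-- When `K` contains no point, the points in each factor are those outside `K`. These `k` pieces
and `K` itself are disjoint, so independence of the counts gives a product. -/
lemma setLIntegral_void_tupleCount_pi [IsProbabilityMeasure μ] (hlam : 0 < lam)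
    (hΦ : IsPoissonProcess μ lam Φ) {K : Set Plane} (hK : MeasurableSet K) (hv : volume K ≠ ∞)
    {k : ℕ} (c : DisjIdx k) {B : Fin k → Set Plane} (hB : ∀ i, MeasurableSet (B i)) :
    ∫⁻ ω in {ω | Φ ω ∩ K = ∅}, tupleCount (Φ ω) k (Set.univ.pi B ∩ disjProd c) ∂μ =
      ENNReal.ofReal (Real.exp (-(lam * (volume K).toReal))) *
        ∏ i, (ENNReal.ofReal lam * volume ((B i ∩ basisBall (c.1 i)) \ K)) := by
  set D : Fin (k + 1) → Set Plane := Fin.cons K fun i => (B i ∩ basisBall (c.1 i)) \ K with hD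
  have hDm (i : Fin (k + 1)) : MeasurableSet (D i) := by
    refine Fin.cases hK (fun j => ?_) i
    exact ((hB j).inter (measurableSet_basisBall _)).diff hK
  have hDd : Pairwise fun i j => Disjoint (D i) (D j) := by
    intro i j hij
    induction i using Fin.cases with
    | zero =>
      induction j using Fin.cases with
      | zero => exact (hij rfl).elim
      | succ j => exact Set.disjoint_sdiff_right
    | succ i =>
      induction j using Fin.cases with
      | zero => exact Set.disjoint_sdiff_left
      | succ j =>
        exact (c.2 (i := i) (j := j) fun h => hij (congrArg Fin.succ h)).mono (Set.sdiff_subset.trans Set.inter_subset_right)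
          (Set.sdiff_subset.trans Set.inter_subset_right)
  -- The count in `K` enters through the indicator of the value 0, the other counts through their
  -- values.
  set f : Fin (k + 1) → ℕ∞ → ℝ≥0∞ :=
    Fin.cons (fun n => if n = 0 then 1 else 0) fun _ n => (n : ℝ≥0∞) with hf
  have hind := (hΦ.indep_count (k + 1) D hDm hDd).comp f fun _ => Measurable.of_discrete
  have hXm (i : Fin (k + 1)) : Measurable (f i ∘ fun ω => (Φ ω ∩ D i).encard) :=
    Measurable.of_discrete.comp (hΦ.measurable_count _ (hDm i))
  have hprod := lintegral_prod_eq_prod_lintegral_of_indepFun Finset.univ _ hind hXm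
  have hvoid := hΦ.measurableSet_void hK
  have hind0 (ω : Ω) : (if (Φ ω ∩ K).encard = 0 then (1 : ℝ≥0∞) else 0) =
      Set.indicator {ω | Φ ω ∩ K = ∅} 1 ω := by
    by_cases h : Φ ω ∩ K = ∅ <;> simp [Set.indicator, h]
  rw [Fin.prod_univ_succ] at hprod
  simp only [Fin.prod_univ_succ, Function.comp_apply, hf, hD, Fin.cons_zero, Fin.cons_succ,
    hind0] at hprod
  rw [lintegral_indicator_one hvoid, prob_void hΦ hK hv] at hprod
  have hfin (i : Fin k) : volume ((B i ∩ basisBall (c.1 i)) \ K) ≠ ∞ :=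
    ne_top_of_le_ne_top (volume_basisBall_ne_top (c.1 i))
      (measure_mono (Set.sdiff_subset.trans Set.inter_subset_right))
  have hE (i : Fin k) := lintegral_encard hlam hΦ
    (((hB i).inter (measurableSet_basisBall (c.1 i))).diff hK) (hfin i)
  simp only [hE] at hprod
  rw [← hprod, ← lintegral_indicator hvoid]
  refine lintegral_congr fun ω => ?_
  by_cases h : Φ ω ∩ K = ∅
  · have hsub (i : Fin k) : Φ ω ∩ (B i ∩ basisBall (c.1 i)) =
        Φ ω ∩ ((B i ∩ basisBall (c.1 i)) \ K) := by
      ext p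
      have : p ∈ Φ ω → p ∉ K := fun hp hpK => by
        have : p ∈ Φ ω ∩ K := ⟨hp, hpK⟩
        simp [h] at this
      simp only [Set.mem_inter_iff, Set.mem_sdiff]
      tauto
    have hmem : ω ∈ {ω | Φ ω ∩ K = ∅} := h
    rw [Set.indicator_of_mem hmem, Set.indicator_of_mem hmem, tupleCount_disjProd_inter hΦ]
    simp [hsub]
  · have hmem : ω ∉ {ω | Φ ω ∩ K = ∅} := h
    rw [Set.indicator_of_notMem hmem, Set.indicator_of_notMem hmem, zero_mul]

/-- Both sides are measures in `V`. Inside each product of disjoint balls they are finite and agree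
on boxes, and these products cover all injective tuples. -/
lemma setLIntegral_void_tupleCount [IsProbabilityMeasure μ] (hlam : 0 < lam)
    (hΦ : IsPoissonProcess μ lam Φ) {K : Set Plane} (hK : MeasurableSet K) (hv : volume K ≠ ∞)
    {k : ℕ} {V : Set (Fin k → Plane)} (hV : MeasurableSet V)
    (hinj : ∀ x ∈ V, Function.Injective x) (hVK : ∀ x ∈ V, ∀ i, x i ∉ K) :
    ∫⁻ ω in {ω | Φ ω ∩ K = ∅}, tupleCount (Φ ω) k V ∂μ =
      ENNReal.ofReal (Real.exp (-(lam * (volume K).toReal))) *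
        (ENNReal.ofReal lam ^ k * volume V) := by
  set e := ENNReal.ofReal (Real.exp (-(lam * (volume K).toReal))) with he
  set m₁ := (μ.restrict {ω | Φ ω ∩ K = ∅}).bind (fun ω => tupleCount (Φ ω) k) with hm₁
  -- The restriction to `Kᶜ` is what makes the two measures agree on arbitrary boxes; it has no
  -- effect on `V`.
  set m₂ := (e * ENNReal.ofReal lam ^ k) •
    (volume : Measure (Fin k → Plane)).restrict (Set.univ.pi fun _ => Kᶜ) with hm₂
  have hae : AEMeasurable (fun ω => tupleCount (Φ ω) k) (μ.restrict {ω | Φ ω ∩ K = ∅}) :=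
    (measurable_tupleCount hΦ k).aemeasurable
  have hKm : MeasurableSet (Set.univ.pi fun _ : Fin k => Kᶜ) :=
    MeasurableSet.univ_pi fun _ => hK.compl
  have key (c : DisjIdx k) (B : Fin k → Set Plane) (hB : ∀ i, MeasurableSet (B i)) :
      m₁.restrict (disjProd c) (Set.univ.pi B) = m₂.restrict (disjProd c) (Set.univ.pi B) := by
    have hBm := MeasurableSet.univ_pi hB
    have hBc := hBm.inter (measurableSet_disjProd c)
    rw [Measure.restrict_apply hBm, Measure.restrict_apply hBm, hm₁, Measure.bind_apply hBc hae,
      setLIntegral_void_tupleCount_pi hlam hΦ hK hv c hB, hm₂, Measure.smul_apply,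
      Measure.restrict_apply hBc, disjProd, ← Set.pi_inter_distrib, ← Set.pi_inter_distrib,
      volume_pi, Measure.pi_pi, Finset.prod_mul_distrib, Finset.prod_const, Finset.card_univ,
      Fintype.card_fin, smul_eq_mul, mul_assoc]
    rfl
  have hfin (c : DisjIdx k) : IsFiniteMeasure (m₁.restrict (disjProd c)) := by
    refine ⟨?_⟩
    have := key c (fun _ => Set.univ) fun _ => MeasurableSet.univ
    rw [Set.pi_univ] at this
    rw [this, hm₂, Measure.restrict_apply_univ, Measure.smul_apply, smul_eq_mul]
    refine ENNReal.mul_lt_top (ENNReal.mul_lt_top ENNReal.ofReal_lt_top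
      (ENNReal.pow_lt_top ENNReal.ofReal_lt_top)) ?_
    refine (Measure.restrict_apply_le _ _).trans_lt ?_
    rw [disjProd, volume_pi, Measure.pi_pi]
    exact ENNReal.prod_lt_top fun i _ => (volume_basisBall_ne_top _).lt_top
  have heq (c : DisjIdx k) : m₁.restrict (disjProd c) = m₂.restrict (disjProd c) := by
    refine ext_of_generate_finite _ generateFrom_pi.symm isPiSystem_pi ?_ ?_
    · rintro _ ⟨B, hB, rfl⟩
      exact key c B fun i => hB i (Set.mem_univ i)
    · simpa using key c (fun _ => Set.univ) fun _ => MeasurableSet.univ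
  have hU := Measure.restrict_iUnion_congr.2 heq
  have hVU : V ⊆ ⋃ c : DisjIdx k, disjProd c := fun x hx =>
    injective_subset_iUnion_disjProd k (hinj x hx)
  have h1 : m₁ V = m₂ V := by
    have := congrArg (fun m => m V) hU
    simpa only [Measure.restrict_apply hV, Set.inter_eq_left.2 hVU] using this
  rw [hm₁, Measure.bind_apply hV hae, hm₂, Measure.smul_apply, Measure.restrict_apply hV,
    Set.inter_eq_left.2 (fun x hx => Set.mem_univ_pi.2 (hVK x hx)), smul_eq_mul, mul_assoc] at h1
  exact h1

end

/-! ### The Mecke formula with an empty region depending on the tuple -/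

/-- The section at `x` of the union of the rectangles `A m ×ˢ b m`. -/
def rectSection {X : Type*} (A : ℕ → Set X) (b : ℕ → Set Plane) (x : X) : Set Plane :=
  {p | ∃ m, x ∈ A m ∧ p ∈ b m}

/-- The section at `x` of the union of the rectangles `A m ×ˢ b m` for `m < n`. -/
def rectSectionLT {X : Type*} (A : ℕ → Set X) (b : ℕ → Set Plane) (n : ℕ) (x : X) : Set Plane :=
  {p | ∃ m < n, x ∈ A m ∧ p ∈ b m}

section rectSection

variable {X : Type*} {A : ℕ → Set X} {b : ℕ → Set Plane}

open Classical in
/-- The indices `m < n` of the rectangles `A m ×ˢ b m` which meet the fibre over `x`. -/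
def rectPattern (A : ℕ → Set X) (n : ℕ) (x : X) : Finset ℕ := (Finset.range n).filter (x ∈ A ·)

/-- The union of the sets `b m` with `m ∈ P`. -/
def patternUnion (b : ℕ → Set Plane) (P : Finset ℕ) : Set Plane := ⋃ m ∈ P, b m

lemma rectPattern_subset (n : ℕ) (x : X) : rectPattern A n x ⊆ Finset.range n := by
  intro m hm
  simp only [rectPattern, Finset.mem_filter] at hm
  exact hm.1

/-- The truncated section depends on `x` only through a finite pattern and so takes finitely many
values. This reduces a region that varies with the tuple to fixed regions. -/
lemma rectSectionLT_eq (n : ℕ) (x : X) :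
    rectSectionLT A b n x = patternUnion b (rectPattern A n x) := by
  ext p
  simp [rectSectionLT, patternUnion, rectPattern, and_assoc]

lemma measurableSet_patternUnion (hb : ∀ m, MeasurableSet (b m)) (P : Finset ℕ) :
    MeasurableSet (patternUnion b P) := P.measurableSet_biUnion fun m _ => hb m

lemma volume_patternUnion_ne_top (hb : ∀ m, volume (b m) ≠ ∞) (P : Finset ℕ) :
    volume (patternUnion b P) ≠ ∞ :=
  ((measure_biUnion_finset_le P b).trans_lt (ENNReal.sum_lt_top.2 fun m _ => (hb m).lt_top)).ne

lemma measurableSet_rectPattern [MeasurableSpace X] (hA : ∀ m, MeasurableSet (A m)) (n : ℕ)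
    (P : Finset ℕ) : MeasurableSet {x | rectPattern A n x = P} := by
  have : {x | rectPattern A n x = P} =
      ⋂ m, {x | m ∈ rectPattern A n x ↔ m ∈ P} := by
    ext x
    simp [Finset.ext_iff]
  rw [this]
  refine MeasurableSet.iInter fun m => ?_
  simp only [rectPattern, Finset.mem_filter]
  by_cases h1 : m ∈ Finset.range n <;> by_cases h2 : m ∈ P <;>
    simp only [h1, h2, true_and, false_and, iff_true, iff_false]
  exacts [hA m, (hA m).compl, MeasurableSet.const _, MeasurableSet.const _]

lemma rectSectionLT_subset (n : ℕ) (x : X) : rectSectionLT A b n x ⊆ rectSection A b x :=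
  fun _ ⟨m, _, h⟩ => ⟨m, h⟩

lemma rectSectionLT_mono (x : X) : Monotone fun n => rectSectionLT A b n x :=
  fun _ _ hij _ ⟨m, hm, h⟩ => ⟨m, hm.trans_le hij, h⟩

lemma iUnion_rectSectionLT (x : X) : ⋃ n, rectSectionLT A b n x = rectSection A b x := by
  ext p
  simp only [Set.mem_iUnion, rectSectionLT, rectSection, Set.mem_ofPred_eq]
  exact ⟨fun ⟨_, m, _, h⟩ => ⟨m, h⟩, fun ⟨m, h⟩ => ⟨m + 1, m, m.lt_succ_self, h⟩⟩

end rectSection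

section

variable {Ω : Type*} [MeasurableSpace Ω] {μ : Measure Ω} {lam : ℝ} {Φ : Ω → Set Plane}
  {k : ℕ} {V : Set (Fin k → Plane)} {A : ℕ → Set (Fin k → Plane)} {b : ℕ → Set Plane}

lemma measurableSet_voidLT (hV : MeasurableSet V) (hA : ∀ m, MeasurableSet (A m)) (S : Set Plane)
    (n : ℕ) : MeasurableSet {x ∈ V | S ∩ rectSectionLT A b n x = ∅} := by
  have : {x ∈ V | S ∩ rectSectionLT A b n x = ∅} =
      V ∩ ⋃ P ∈ {P : Finset ℕ | S ∩ patternUnion b P = ∅}, {x | rectPattern A n x = P} := by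
    ext x
    simp [rectSectionLT_eq]
  rw [this]
  exact hV.inter (MeasurableSet.biUnion (Set.to_countable _)
    fun P _ => measurableSet_rectPattern hA n P)

lemma iInter_voidLT (S : Set Plane) :
    ⋂ n, {x ∈ V | S ∩ rectSectionLT A b n x = ∅} = {x ∈ V | S ∩ rectSection A b x = ∅} := by
  ext x
  simp only [Set.mem_iInter, Set.mem_ofPred_eq, ← iUnion_rectSectionLT, Set.inter_iUnion,
    Set.iUnion_eq_empty]
  exact ⟨fun h => ⟨(h 0).1, fun n => (h n).2⟩, fun h n => ⟨h.1, h.2 n⟩⟩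

lemma tupleCount_voidLT (hV : MeasurableSet V) (hA : ∀ m, MeasurableSet (A m)) {Ω : Type*} {Φ : Ω → Set Plane} (n : ℕ)
    (ω : Ω) : tupleCount (Φ ω) k {x ∈ V | Φ ω ∩ rectSectionLT A b n x = ∅} =
      ∑ P ∈ (Finset.range n).powerset, Set.indicator {ω | Φ ω ∩ patternUnion b P = ∅}
        (fun ω => tupleCount (Φ ω) k (V ∩ {x | rectPattern A n x = P})) ω := by
  have h1 : {x ∈ V | Φ ω ∩ rectSectionLT A b n x = ∅} =
      ⋃ P ∈ (Finset.range n).powerset, {x | x ∈ V ∧ rectPattern A n x = P ∧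
        Φ ω ∩ patternUnion b P = ∅} := by
    ext x
    simp only [rectSectionLT_eq, Set.mem_ofPred_eq, Set.mem_iUnion, Finset.mem_powerset,
      exists_prop]
    constructor
    · rintro ⟨hx, h⟩
      exact ⟨_, rectPattern_subset n x, hx, rfl, h⟩
    · rintro ⟨P, -, hx, rfl, h⟩
      exact ⟨hx, h⟩
  have h2 (P : Finset ℕ) : MeasurableSet {x | x ∈ V ∧ rectPattern A n x = P ∧
        Φ ω ∩ patternUnion b P = ∅} :=
    hV.inter ((measurableSet_rectPattern hA n P).inter (MeasurableSet.const _))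
  rw [h1, measure_biUnion_finset _ fun P _ => h2 P]
  · refine Finset.sum_congr rfl fun P _ => ?_
    by_cases h : Φ ω ∩ patternUnion b P = ∅
    · have hmem : ω ∈ {ω | Φ ω ∩ patternUnion b P = ∅} := h
      rw [Set.indicator_of_mem hmem]
      simp only [h, and_true]
      rfl
    · have hmem : ω ∉ {ω | Φ ω ∩ patternUnion b P = ∅} := h
      rw [Set.indicator_of_notMem hmem]
      simp [h]
  · intro P _ Q _ hPQ
    refine Set.disjoint_left.2 ?_
    rintro x ⟨_, rfl, _⟩ ⟨_, h, _⟩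
    exact hPQ h

lemma measurable_tupleCount_voidLT (hΦ : IsPoissonProcess μ lam Φ) (hV : MeasurableSet V)
    (hA : ∀ m, MeasurableSet (A m)) (hb : ∀ m, MeasurableSet (b m)) (n : ℕ) :
    Measurable fun ω => tupleCount (Φ ω) k {x ∈ V | Φ ω ∩ rectSectionLT A b n x = ∅} := by
  simp_rw [tupleCount_voidLT hV hA n]
  refine Finset.measurable_fun_sum _ fun P _ => Measurable.indicator ?_
    (hΦ.measurableSet_void (measurableSet_patternUnion hb P))
  exact (Measure.measurable_coe (hV.inter (measurableSet_rectPattern hA n P))).comp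
    (measurable_tupleCount hΦ k)

lemma lintegral_tupleCount_voidLT [IsProbabilityMeasure μ] (hlam : 0 < lam)
    (hΦ : IsPoissonProcess μ lam Φ) (hV : MeasurableSet V)
    (hA : ∀ m, MeasurableSet (A m)) (hb : ∀ m, MeasurableSet (b m)) (hbv : ∀ m, volume (b m) ≠ ∞)
    (hinj : ∀ x ∈ V, Function.Injective x) (hU : ∀ x ∈ V, ∀ i, x i ∉ rectSection A b x) (n : ℕ) :
    ∫⁻ ω, tupleCount (Φ ω) k {x ∈ V | Φ ω ∩ rectSectionLT A b n x = ∅} ∂μ =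
      ENNReal.ofReal lam ^ k * ∫⁻ x in V,
        ENNReal.ofReal (Real.exp (-(lam * (volume (rectSectionLT A b n x)).toReal))) := by
  have hVm (P : Finset ℕ) : MeasurableSet (V ∩ {x | rectPattern A n x = P}) :=
    hV.inter (measurableSet_rectPattern hA n P)
  have hV' : V = ⋃ P ∈ (Finset.range n).powerset, V ∩ {x | rectPattern A n x = P} := by
    ext x
    simp [rectPattern_subset]
  simp_rw [tupleCount_voidLT hV hA n]
  have hm (P : Finset ℕ) : Measurable (Set.indicator {ω | Φ ω ∩ patternUnion b P = ∅}
      fun ω => tupleCount (Φ ω) k (V ∩ {x | rectPattern A n x = P})) :=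
    Measurable.indicator ((Measure.measurable_coe (hVm P)).comp (measurable_tupleCount hΦ k))
      (hΦ.measurableSet_void (measurableSet_patternUnion hb P))
  rw [lintegral_finsetSum _ fun P _ => hm P]
  conv_rhs => rw [hV']
  rw [lintegral_biUnion_finset _ (fun P _ => hVm P), Finset.mul_sum]
  · refine Finset.sum_congr rfl fun P _ => ?_
    rw [lintegral_indicator (hΦ.measurableSet_void (measurableSet_patternUnion hb P)),
      setLIntegral_void_tupleCount hlam hΦ (measurableSet_patternUnion hb P)
        (volume_patternUnion_ne_top hbv P) (hVm P) (fun x hx => hinj x hx.1),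
      setLIntegral_congr_fun (g := fun _ => ENNReal.ofReal (Real.exp
        (-(lam * (volume (patternUnion b P)).toReal)))) (hVm P), setLIntegral_const]
    · ring
    · rintro x ⟨_, hx⟩
      simp only [rectSectionLT_eq]
      rw [hx]
    · rintro x ⟨hxV, hx⟩ i hi
      have hx' : rectPattern A n x = P := hx
      rw [← hx', ← rectSectionLT_eq] at hi
      exact hU x hxV i (rectSectionLT_subset n x hi)
  · intro P _ Q _ hPQ
    refine Set.disjoint_left.2 ?_
    rintro x ⟨_, hP⟩ ⟨_, hQ⟩
    exact hPQ (hP.symm.trans hQ)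

lemma tupleCount_lt_top {S : Set Plane}
    (hS : ∀ K : Set Plane, Bornology.IsBounded K → (S ∩ K).Finite) {W : Set Plane}
    (hW : Bornology.IsBounded W) (hVW : V ⊆ Set.univ.pi fun _ => W) : tupleCount S k V < ∞ := by
  rw [tupleCount_apply (countable_of_locallyFinite hS)]
  have : (V ∩ tupleSet S k).Finite := by
    refine (Set.Finite.pi' (t := fun _ : Fin k => S ∩ W) fun _ => hS W hW).subset ?_
    rintro x ⟨hx, hxS⟩ i
    exact ⟨hxS.2 i, hVW hx i (Set.mem_univ i)⟩
  simpa using this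

/-- Continuity from above needs a finite count, which boundedness of `V` provides through local
finiteness. -/
lemma tendsto_tupleCount_voidLT (hΦ : IsPoissonProcess μ lam Φ) (hV : MeasurableSet V)
    (hA : ∀ m, MeasurableSet (A m)) {W : Set Plane}
    (hW : Bornology.IsBounded W) (hVW : V ⊆ Set.univ.pi fun _ => W) (ω : Ω) :
    Filter.Tendsto (fun n => tupleCount (Φ ω) k {x ∈ V | Φ ω ∩ rectSectionLT A b n x = ∅})
      Filter.atTop (nhds (tupleCount (Φ ω) k {x ∈ V | Φ ω ∩ rectSection A b x = ∅})) := by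
  rw [← iInter_voidLT]
  refine tendsto_measure_iInter_atTop (fun n => (measurableSet_voidLT hV hA _ n).nullMeasurableSet)
    ?_ ⟨0, ?_⟩
  · rintro i j hij x ⟨hx, h⟩
    refine ⟨hx, Set.subset_empty_iff.1 (h ▸ ?_)⟩
    exact Set.inter_subset_inter_right _ (rectSectionLT_mono x hij)
  · exact ((measure_mono fun x hx => hx.1).trans_lt
      (tupleCount_lt_top (hΦ.locallyFinite ω) hW hVW)).ne

lemma measurable_tupleCount_void (hΦ : IsPoissonProcess μ lam Φ) (hV : MeasurableSet V)
    (hA : ∀ m, MeasurableSet (A m)) (hb : ∀ m, MeasurableSet (b m)) {W : Set Plane}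
    (hW : Bornology.IsBounded W) (hVW : V ⊆ Set.univ.pi fun _ => W) :
    Measurable fun ω => tupleCount (Φ ω) k {x ∈ V | Φ ω ∩ rectSection A b x = ∅} :=
  measurable_of_tendsto_metrizable (fun n => measurable_tupleCount_voidLT hΦ hV hA hb n)
    (tendsto_pi_nhds.2 fun ω => tendsto_tupleCount_voidLT hΦ hV hA hW hVW ω)

/-- The multivariate Mecke formula for the number of tuples of distinct points of a Poisson
process which lie in `V` and for which a region depending on the tuple contains no point. -/
theorem lintegral_tupleCount_void [IsProbabilityMeasure μ] (hlam : 0 < lam)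
    (hΦ : IsPoissonProcess μ lam Φ) (hV : MeasurableSet V)
    (hA : ∀ m, MeasurableSet (A m)) (hb : ∀ m, MeasurableSet (b m)) (hbv : ∀ m, volume (b m) ≠ ∞)
    (hinj : ∀ x ∈ V, Function.Injective x) (hU : ∀ x ∈ V, ∀ i, x i ∉ rectSection A b x)
    (hUv : ∀ x ∈ V, volume (rectSection A b x) ≠ ∞) {W : Set Plane}
    (hW : Bornology.IsBounded W) (hVW : V ⊆ Set.univ.pi fun _ => W) :
    ∫⁻ ω, tupleCount (Φ ω) k {x ∈ V | Φ ω ∩ rectSection A b x = ∅} ∂μ =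
      ENNReal.ofReal lam ^ k * ∫⁻ x in V,
        ENNReal.ofReal (Real.exp (-(lam * (volume (rectSection A b x)).toReal))) := by
  have hVfin : volume V ≠ ∞ := by
    refine ((measure_mono hVW).trans_lt ?_).ne
    rw [volume_pi, Measure.pi_pi]
    exact ENNReal.prod_lt_top fun i _ => hW.measure_lt_top
  -- The truncation is lifted by dominated convergence on both sides: the bounds are the number of
  -- all tuples in `V` and the constant 1 on `V`.
  have h1 := tendsto_lintegral_of_dominated_convergence (μ := μ)
    (F := fun n ω => tupleCount (Φ ω) k {x ∈ V | Φ ω ∩ rectSectionLT A b n x = ∅})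
    (f := fun ω => tupleCount (Φ ω) k {x ∈ V | Φ ω ∩ rectSection A b x = ∅})
    (fun ω => tupleCount (Φ ω) k V) (measurable_tupleCount_voidLT hΦ hV hA hb)
    (fun n => Filter.Eventually.of_forall fun ω => measure_mono fun x hx => hx.1) ?_
    (Filter.Eventually.of_forall fun ω => tendsto_tupleCount_voidLT hΦ hV hA hW hVW ω)
  · refine tendsto_nhds_unique h1 ?_
    simp_rw [lintegral_tupleCount_voidLT hlam hΦ hV hA hb hbv hinj hU]
    refine ENNReal.Tendsto.const_mul ?_ (Or.inr (ENNReal.pow_ne_top ENNReal.ofReal_ne_top))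
    refine tendsto_lintegral_of_dominated_convergence' (fun _ => 1) ?_ ?_ ?_ ?_
    · intro n
      have : (fun x => ENNReal.ofReal (Real.exp (-(lam * (volume
          (rectSectionLT A b n x)).toReal)))) = (fun P => ENNReal.ofReal (Real.exp (-(lam * (volume
          (patternUnion b P)).toReal)))) ∘ rectPattern A n := by
        ext x
        simp [rectSectionLT_eq]
      rw [this]
      -- The integrand factors through the pattern, which lives in a countable set.
      let _ : MeasurableSpace (Finset ℕ) := ⊤
      refine (Measurable.comp measurable_from_top ?_).aemeasurable
      refine measurable_to_countable' fun P => measurableSet_rectPattern hA n P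
    · refine fun n => Filter.Eventually.of_forall fun x => ?_
      simp only [ENNReal.ofReal_le_one, Real.exp_le_one_iff, Left.neg_nonpos_iff]
      positivity
    · simpa using hVfin
    · refine (ae_restrict_iff' hV).2 (Filter.Eventually.of_forall fun x hx => ?_)
      have h2 : Filter.Tendsto (fun n => volume (rectSectionLT A b n x)) Filter.atTop
          (nhds (volume (rectSection A b x))) := by
        rw [← iUnion_rectSectionLT]
        exact tendsto_measure_iUnion_atTop (rectSectionLT_mono x)
      have h3 := (ENNReal.tendsto_toReal (hUv x hx)).comp h2
      exact ENNReal.tendsto_ofReal ((Real.continuous_exp.tendsto _).comp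
        ((h3.const_mul lam).neg))
  -- The dominating count has a finite mean: this is the case `K = ∅`.
  · have := setLIntegral_void_tupleCount hlam hΦ MeasurableSet.empty (by simp) hV hinj (by simp)
    simp only [Set.inter_empty] at this
    have huniv : {ω : Ω | True} = Set.univ := rfl
    simp only [measure_empty, ENNReal.toReal_zero, mul_zero, neg_zero, Real.exp_zero,
      ENNReal.ofReal_one, one_mul] at this
    rw [huniv, setLIntegral_univ] at this
    rw [this]
    exact ENNReal.mul_ne_top (ENNReal.pow_ne_top ENNReal.ofReal_ne_top) hVfin

end

/-! ### Arcs of a circle -/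

/-- The representative in `(0, 1]` of a point of the circle `ℝ / ℤ`. -/
def fwd (x : UnitAddCircle) : ℝ := AddCircle.equivIoc 1 0 x

lemma fwd_pos (x : UnitAddCircle) : 0 < fwd x := (AddCircle.equivIoc (1 : ℝ) 0 x).2.1

lemma fwd_le_one (x : UnitAddCircle) : fwd x ≤ 1 :=
  (AddCircle.equivIoc (1 : ℝ) 0 x).2.2.trans (zero_add _).le

lemma coe_fwd (x : UnitAddCircle) : ((fwd x : ℝ) : UnitAddCircle) = x := AddCircle.coe_equivIoc

lemma fwd_coe {t : ℝ} (h0 : 0 < t) (h1 : t ≤ 1) : fwd (t : UnitAddCircle) = t :=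
  AddCircle.equivIoc_coe_of_mem (p := (1 : ℝ)) (a := 0) ⟨h0, by simpa using h1⟩

lemma measurable_fwd : Measurable fwd :=
  measurable_subtype_coe.comp (AddCircle.measurableEquivIoc 1 0).measurable

/-- If `s'` is at least as far behind `t` as `s` is, then going forward from `s` one meets `t` no
later than `s'`. Values in `(0, 1]` put a point at distance 1 from itself, which is what the cases
`s' = s` and `s = t` require. -/
lemma fwd_le_fwd_of_le {t s s' : UnitAddCircle} (h : fwd (t - s) ≤ fwd (t - s')) :
    fwd (t - s) ≤ fwd (s' - s) := by
  have h1 : s' - s = ((fwd (t - s) - fwd (t - s') + 1 : ℝ) : UnitAddCircle) := by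
    rw [AddCircle.coe_add, AddCircle.coe_sub, coe_fwd, coe_fwd, AddCircle.coe_period]
    abel
  have h2 := fwd_pos (t - s)
  have h3 := fwd_le_one (t - s')
  rw [h1, fwd_coe (by linarith) (by linarith)]
  linarith

/-- The length (as a fraction of the perimeter) of the arc of the circle of radius `r` centred at
the origin which is nearer to `w` than to the origin. -/
def arcLen (r : ℝ) (w : ℂ) : ℝ := Real.arccos (‖w‖ / (2 * r)) / Real.pi

/-- The starting point (in counterclockwise order) of the arc of the circle of radius `r` centred
at the origin which is nearer to `w` than to the origin. -/
def arcStart (r : ℝ) (w : ℂ) : UnitAddCircle :=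
  ((w.arg / (2 * Real.pi) - arcLen r w / 2 : ℝ) : UnitAddCircle)

lemma arcLen_nonneg (r : ℝ) (w : ℂ) : 0 ≤ arcLen r w :=
  div_nonneg (Real.arccos_nonneg _) Real.pi_pos.le

lemma arcLen_le_half {r : ℝ} (hr : 0 < r) (w : ℂ) : arcLen r w ≤ 1 / 2 := by
  rw [arcLen, div_le_iff₀ Real.pi_pos]
  have := Real.arccos_le_pi_div_two.2 (show 0 ≤ ‖w‖ / (2 * r) by positivity)
  linarith

lemma measurable_arcLen (r : ℝ) : Measurable (arcLen r) := by
  unfold arcLen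
  exact (Real.continuous_arccos.measurable.comp (measurable_norm.div_const _)).div_const _

lemma measurable_arcStart (r : ℝ) : Measurable (arcStart r) := by
  unfold arcStart
  refine (AddCircle.measurable_mk').comp ?_
  exact (Complex.measurable_arg.div_const _).sub ((measurable_arcLen r).div_const _)

lemma cos_lt_cos_iff_lt {x v : ℝ} (hx0 : 0 ≤ x) (hxpi : x ≤ Real.pi) (h1 : -x < v)
    (h2 : v ≤ 2 * Real.pi - x) : Real.cos x < Real.cos v ↔ v < x := by
  constructor
  · intro h
    by_contra hv
    push Not at hv
    have h3 : |v - Real.pi| ≤ Real.pi - x := abs_le.2 ⟨by linarith, by linarith⟩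
    have h4 := Real.cos_le_cos_of_nonneg_of_le_pi (abs_nonneg _) (by linarith) h3
    rw [Real.cos_abs, Real.cos_pi_sub, Real.cos_sub_pi] at h4
    linarith
  · intro h
    rw [← Real.cos_abs v]
    exact Real.cos_lt_cos_of_nonneg_of_le_pi (abs_nonneg _) hxpi (abs_lt.2 ⟨h1, h⟩)

/-- If `v` is the angle from `w` to the circle point, the squared distance is `‖w‖² + r² - 2r‖w‖ cos
v`. It is less than `r²` exactly when `cos v > ‖w‖ / (2r) = cos (πL)`, that is, on an arc of
half-width `πL`. Measured from its start, `v = 2πe - πL` stays in `(-πL, 2π - πL]`. The start itself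
has `e = 1` and is not in its own arc. -/
lemma norm_sub_toCircle_lt_iff {r : ℝ} (hr : 0 < r) {w : ℂ} (hw : w ≠ 0) (hw' : ‖w‖ < 2 * r)
    (t : UnitAddCircle) :
    ‖w - r * (AddCircle.toCircle t : ℂ)‖ < r ↔ fwd (t - arcStart r w) < arcLen r w := by
  set e := fwd (t - arcStart r w) with he
  set L := arcLen r w with hL
  have hpi := Real.pi_pos
  have hwn : 0 < ‖w‖ := norm_pos_iff.2 hw
  have ht : t = ((e + (w.arg / (2 * Real.pi) - L / 2) : ℝ) : UnitAddCircle) := by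
    rw [AddCircle.coe_add, he, coe_fwd, hL]
    simp [arcStart]
  set v := 2 * Real.pi * e - Real.pi * L with hv
  have hc : (AddCircle.toCircle t : ℂ) =
      Complex.exp (w.arg * Complex.I) * Complex.exp (v * Complex.I) := by
    rw [ht, AddCircle.toCircle_apply_mk, Circle.coe_exp, ← Complex.exp_add]
    congr 1
    have : (2 * Real.pi / 1 * (e + (w.arg / (2 * Real.pi) - L / 2)) : ℝ) = w.arg + v := by
      rw [hv]; field_simp; ring
    rw [this]
    push_cast
    ring
  have hcosL : Real.cos (Real.pi * L) = ‖w‖ / (2 * r) := by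
    rw [hL, arcLen, mul_div_cancel₀ _ hpi.ne', Real.cos_arccos]
    · have : 0 ≤ ‖w‖ / (2 * r) := by positivity
      linarith
    · rw [div_le_one (by positivity)]; exact hw'.le
  have hnorm : ‖w - r * (AddCircle.toCircle t : ℂ)‖ ^ 2 =
      ‖w‖ ^ 2 + r ^ 2 - 2 * r * ‖w‖ * Real.cos v := by
    have h1 : w - r * (AddCircle.toCircle t : ℂ) =
        Complex.exp (w.arg * Complex.I) * (‖w‖ - r * Complex.exp (v * Complex.I)) := by
      rw [hc]
      linear_combination -Complex.norm_mul_exp_arg_mul_I w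
    rw [h1, norm_mul, Complex.norm_exp_ofReal_mul_I, one_mul, Complex.sq_norm,
      Complex.normSq_apply]
    simp only [Complex.sub_re, Complex.ofReal_re, Complex.mul_re, Complex.ofReal_im, zero_mul,
      sub_zero, Complex.sub_im, Complex.mul_im, add_zero, zero_sub, Complex.exp_ofReal_mul_I_re,
      Complex.exp_ofReal_mul_I_im]
    linear_combination r ^ 2 * Real.sin_sq_add_cos_sq v
  have hLn : 0 ≤ L := arcLen_nonneg r w
  have hL1 : L ≤ 1 / 2 := arcLen_le_half hr w
  have he0 : 0 < e := fwd_pos _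
  have he1 : e ≤ 1 := fwd_le_one _
  have hcmp := cos_lt_cos_iff_lt (x := Real.pi * L) (v := v) (by positivity) (by nlinarith)
    (by rw [hv]; nlinarith) (by rw [hv]; nlinarith)
  rw [← sq_lt_sq₀ (norm_nonneg _) hr.le, hnorm]
  have h3 : v < Real.pi * L ↔ e < L := by
    rw [hv]
    constructor
    · intro h
      by_contra h'
      push Not at h'
      nlinarith
    · intro h
      nlinarith
  rw [← h3, ← hcmp, hcosL, div_lt_iff₀ (by positivity)]
  constructor
  · intro h
    by_contra h'
    push Not at h'
    nlinarith
  · intro h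
    nlinarith

/-! ### Circles in the plane and the covering criterion -/

/-- The identification of `ℂ` with the Euclidean plane. -/
def toPlane : ℂ ≃ₗᵢ[ℝ] Plane := Complex.orthonormalBasisOneI.repr

/-- The point of the circle of radius `r` about `x` at the angle `2πt`. -/
def circlePoint (r : ℝ) (x : Plane) (t : UnitAddCircle) : Plane :=
  x + toPlane (r * (AddCircle.toCircle t : ℂ))

/-- The centre of the circle of radius `r` through `x` and `z` that is to the right of the ray from
`x` to `z`. -/
def touchCenter (r : ℝ) (x z : Plane) : Plane :=
  circlePoint r x (arcStart r (toPlane.symm (z - x)))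

/-- The points at a positive distance less than `2r` of `x`. -/
def punctured (r : ℝ) (x : Plane) : Set Plane := {z | 0 < dist z x ∧ dist z x < 2 * r}

lemma dist_circlePoint {r : ℝ} (hr : 0 ≤ r) (x : Plane) (t : UnitAddCircle) :
    dist (circlePoint r x t) x = r := by
  rw [circlePoint, dist_eq_norm, add_sub_cancel_left, LinearIsometryEquiv.norm_map, norm_mul,
    Circle.norm_coe, mul_one, Complex.norm_real, Real.norm_of_nonneg hr]

lemma exists_circlePoint {r : ℝ} {x y : Plane} (h : dist y x = r) :
    ∃ t, circlePoint r x t = y := by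
  set w := toPlane.symm (y - x) with hw
  have hwn : ‖w‖ = r := by rw [hw, LinearIsometryEquiv.norm_map, ← dist_eq_norm, h]
  refine ⟨((w.arg / (2 * Real.pi) : ℝ) : UnitAddCircle), ?_⟩
  have : (r * (AddCircle.toCircle ((w.arg / (2 * Real.pi) : ℝ) : UnitAddCircle) : ℂ)) = w := by
    rw [AddCircle.toCircle_apply_mk, Circle.coe_exp]
    have h2 : 2 * Real.pi / 1 * (w.arg / (2 * Real.pi)) = w.arg := by
      have := Real.pi_pos
      field_simp
    rw [h2, ← hwn, Complex.norm_mul_exp_arg_mul_I]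
  rw [circlePoint, this, hw]
  simp

lemma dist_circlePoint_lt_iff {r : ℝ} (hr : 0 < r) {x z : Plane} (hz : z ∈ punctured r x)
    (t : UnitAddCircle) : dist z (circlePoint r x t) < r ↔
      fwd (t - arcStart r (toPlane.symm (z - x))) < arcLen r (toPlane.symm (z - x)) := by
  rw [← norm_sub_toCircle_lt_iff hr]
  · rw [← LinearIsometryEquiv.norm_map toPlane, map_sub, LinearIsometryEquiv.apply_symm_apply,
      dist_eq_norm, circlePoint, sub_add_eq_sub_sub]
  · rw [Ne, LinearIsometryEquiv.map_eq_zero_iff, sub_eq_zero]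
    exact dist_pos.1 hz.1
  · rw [LinearIsometryEquiv.norm_map, ← dist_eq_norm]
    exact hz.2

/-- Some point at distance `r` of `x` has no point of `S` at a distance less than `r`. -/
def Uncovered (S : Set Plane) (x : Plane) (r : ℝ) : Prop :=
  ∃ y, dist y x = r ∧ ∀ z ∈ S, r ≤ dist z y

/-- The points `z` of `S` for which the disk with centre `touchCenter r x z` and radius `r` contains
no point of `S`. -/
def gapPoints (S : Set Plane) (r : ℝ) (x : Plane) : Set Plane :=
  {z ∈ S | z ∈ punctured r x ∧ S ∩ Metric.ball (touchCenter r x z) r = ∅}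

/-- Moving `y` towards `x` until its distance is `r` gives a disk of radius `r` contained in the
disk of radius `s` about `y`. -/
lemma Uncovered.anti {S : Set Plane} {x : Plane} {r s : ℝ} (hr : 0 < r) (hrs : r ≤ s)
    (h : Uncovered S x s) : Uncovered S x r := by
  obtain ⟨y, hy, hS⟩ := h
  have hs : 0 < s := hr.trans_le hrs
  refine ⟨x + (r / s) • (y - x), ?_, fun z hz => ?_⟩
  · rw [dist_eq_norm, add_sub_cancel_left, norm_smul, ← dist_eq_norm, hy, Real.norm_eq_abs,
      abs_of_pos (by positivity)]
    field_simp
  · have h1 : dist (x + (r / s) • (y - x)) y = s - r := by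
      have : x + (r / s) • (y - x) - y = (r / s - 1) • (y - x) := by
        rw [sub_smul, one_smul]; abel
      rw [dist_eq_norm, this, norm_smul, ← dist_eq_norm y x, hy, Real.norm_eq_abs,
        abs_of_nonpos (by rw [sub_nonpos, div_le_one hs]; exact hrs)]
      field_simp
      ring
    have h2 := dist_triangle z (x + (r / s) • (y - x)) y
    have h3 := hS z hz
    linarith

lemma lt_circumradius_iff {S : Set Plane} {x : Plane} {r : ℝ} (hr : 0 ≤ r) :
    ENNReal.ofReal r < circumradius S x ↔ ∃ s > r, Uncovered S x s := by
  rw [circumradius]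
  simp only [lt_iSup_iff]
  constructor
  · rintro ⟨y, hy, h⟩
    rw [edist_dist, ENNReal.ofReal_lt_ofReal_iff_of_nonneg hr] at h
    refine ⟨dist x y, h, y, dist_comm _ _, fun z hz => ?_⟩
    rw [dist_comm x y, dist_comm z y]
    exact hy z hz
  · rintro ⟨s, hs, y, hy, h⟩
    refine ⟨y, fun z hz => ?_, ?_⟩
    · rw [hy, dist_comm]; exact h z hz
    · rw [edist_dist, dist_comm, hy]
      exact (ENNReal.ofReal_lt_ofReal_iff_of_nonneg hr).2 hs

/-- A countable form, for measurability and monotone convergence. `Uncovered S x r` alone would only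
give a circumradius of at least `r`. -/
lemma lt_circumradius_iff_exists_nat {S : Set Plane} {x : Plane} {r : ℝ} (hr : 0 ≤ r) :
    ENNReal.ofReal r < circumradius S x ↔ ∃ n : ℕ, Uncovered S x (r + 1 / ((n : ℝ) + 1)) := by
  rw [lt_circumradius_iff hr]
  constructor
  · rintro ⟨s, hs, h⟩
    obtain ⟨n, hn⟩ := exists_nat_one_div_lt (sub_pos.2 hs)
    exact ⟨n, h.anti (by positivity) (by linarith)⟩
  · rintro ⟨n, h⟩
    exact ⟨_, by simp; positivity, h⟩

/-- Going forward from an uncovered point `t`, the first start that is met is uncovered: an arc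
covering it would have to begin before `t` and so cover `t`. -/
lemma uncovered_iff {S : Set Plane} (hS : ∀ K : Set Plane, Bornology.IsBounded K → (S ∩ K).Finite)
    {r : ℝ} (hr : 0 < r) (x : Plane) :
    Uncovered S x r ↔ S ∩ punctured r x = ∅ ∨ (gapPoints S r x).Nonempty := by
  have hfar {y z : Plane} (hy : dist y x = r) (hz : z ∉ punctured r x) : r ≤ dist z y := by
    simp only [punctured, Set.mem_ofPred_eq, not_and, not_lt] at hz
    rcases eq_or_lt_of_le (dist_nonneg (x := z) (y := x)) with h | h
    · rw [dist_eq_zero.1 h.symm, dist_comm, hy]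
    · have h1 := hz h
      have h2 := dist_triangle z y x
      linarith
  constructor
  · rintro ⟨y, hy, hyS⟩
    obtain ⟨t, rfl⟩ := exists_circlePoint hy
    by_cases hemp : S ∩ punctured r x = ∅
    · exact Or.inl hemp
    · right
      have hfin : (S ∩ punctured r x).Finite :=
        hS _ (Metric.isBounded_ball.subset fun z hz => Metric.mem_ball.2 hz.2)
      -- The start farthest behind `t` is the first one ahead of `t`.
      obtain ⟨z, hz, hmax⟩ := Set.exists_max_image _
        (fun z => fwd (t - arcStart r (toPlane.symm (z - x)))) hfin
        (Set.nonempty_iff_ne_empty.2 hemp)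
      refine ⟨z, hz.1, hz.2, Set.eq_empty_iff_forall_notMem.2 ?_⟩
      rintro w ⟨hwS, hw⟩
      by_cases hwp : w ∈ punctured r x
      · rw [Metric.mem_ball, touchCenter, dist_circlePoint_lt_iff hr hwp] at hw
        have h1 := hyS w hwS
        rw [← not_lt, dist_circlePoint_lt_iff hr hwp, not_lt] at h1
        exact absurd (hw.trans_le h1) (fwd_le_fwd_of_le (hmax w ⟨hwS, hwp⟩)).not_gt
      · exact absurd hw (hfar (dist_circlePoint hr.le _ _) hwp).not_gt
  · rintro (h | ⟨z, hz, hzp, h⟩)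
    · refine ⟨circlePoint r x 0, dist_circlePoint hr.le _ _, fun w hw => hfar
        (dist_circlePoint hr.le _ _) fun hwp => ?_⟩
      have : w ∈ S ∩ punctured r x := ⟨hw, hwp⟩
      simp [h] at this
    · refine ⟨touchCenter r x z, dist_circlePoint hr.le _ _, fun w hw => ?_⟩
      by_contra hlt
      have : w ∈ S ∩ Metric.ball (touchCenter r x z) r := ⟨hw, Metric.mem_ball.2 (not_le.1 hlt)⟩
      simp [h] at this

/-! ### The function `F` and the distribution of starts and lengths of arcs -/

lemma F_eq_sin_sq {d : ℝ} (hd : 0 ≤ d) : F d = Real.sin (Real.pi * min d (1 / 2)) ^ 2 := by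
  rcases le_or_gt d (1 / 2) with h | h
  · have h1 : d ∈ Set.Icc (0 : ℝ) (1 / 2) := ⟨hd, h⟩
    have h2 : d ∉ Set.Ioi (1 / 2 : ℝ) := not_lt.2 h
    rw [F, Set.indicator_of_mem h1, Set.indicator_of_notMem h2, add_zero, min_eq_left h]
  · have h1 : d ∉ Set.Icc (0 : ℝ) (1 / 2) := fun h' => h'.2.not_gt h
    have h2 : d ∈ Set.Ioi (1 / 2 : ℝ) := h
    rw [F, Set.indicator_of_notMem h1, Set.indicator_of_mem h2, zero_add, min_eq_right h.le,
      mul_one_div, Real.sin_pi_div_two, one_pow]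

lemma F_nonneg (t : ℝ) : 0 ≤ F t :=
  add_nonneg (Set.indicator_nonneg (fun _ _ => sq_nonneg _) _)
    (Set.indicator_nonneg (fun _ _ => zero_le_one) _)

lemma F_le_one (t : ℝ) : F t ≤ 1 := by
  rcases le_or_gt 0 t with h | h
  · rw [F_eq_sin_sq h]; exact Real.sin_sq_le_one _
  · have h1 : t ∉ Set.Icc (0 : ℝ) (1 / 2) := fun h' => h'.1.not_gt h
    have h2 : t ∉ Set.Ioi (1 / 2 : ℝ) := fun h' : 1 / 2 < t => by linarith
    rw [F, Set.indicator_of_notMem h1, Set.indicator_of_notMem h2]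
    norm_num

lemma F_one : F 1 = 1 := by
  rw [F_eq_sin_sq zero_le_one, min_eq_right (by norm_num), mul_one_div, Real.sin_pi_div_two,
    one_pow]

lemma measurable_F : Measurable F := by
  unfold F
  refine Measurable.add ?_ ?_
  · exact Measurable.indicator (by fun_prop) measurableSet_Icc
  · exact measurable_const.indicator measurableSet_Ioi

/-- Lebesgue measure on the punctured disk of radius `2r`. -/
def diskMeasure (r : ℝ) : Measure ℂ := volume.restrict {w | 0 < ‖w‖ ∧ ‖w‖ < 2 * r}

lemma measurableSet_punctured_disk (r : ℝ) : MeasurableSet {w : ℂ | 0 < ‖w‖ ∧ ‖w‖ < 2 * r} :=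
  (measurableSet_lt measurable_const measurable_norm).inter
    (measurableSet_lt measurable_norm measurable_const)

/-- The intensity measure of the lengths of the arcs. -/
def arcLenLaw (r : ℝ) : Measure ℝ :=
  ((volume.restrict (Set.Ioo 0 (2 * r))).withDensity
    fun ρ => ENNReal.ofReal (2 * Real.pi * ρ)).map fun ρ => Real.arccos (ρ / (2 * r)) / Real.pi

lemma measurable_arccos_div (r : ℝ) : Measurable fun ρ => Real.arccos (ρ / (2 * r)) / Real.pi :=
  (Real.continuous_arccos.measurable.comp (measurable_id.div_const _)).div_const _

instance isFiniteMeasure_arcLenLaw (r : ℝ) : IsFiniteMeasure (arcLenLaw r) := by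
  have : IsFiniteMeasure ((volume.restrict (Set.Ioo 0 (2 * r))).withDensity
      fun ρ => ENNReal.ofReal (2 * Real.pi * ρ)) := by
    refine isFiniteMeasure_withDensity (ne_of_lt ?_)
    refine (setLIntegral_mono (g := fun _ => ENNReal.ofReal (2 * Real.pi * (2 * r)))
      measurable_const fun ρ hρ => ENNReal.ofReal_le_ofReal ?_).trans_lt ?_
    · exact mul_le_mul_of_nonneg_left hρ.2.le Real.two_pi_pos.le
    · rw [setLIntegral_const]
      exact ENNReal.mul_lt_top ENNReal.ofReal_lt_top measure_Ioo_lt_top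
  unfold arcLenLaw
  infer_instance

instance isFiniteMeasure_diskMeasure (r : ℝ) : IsFiniteMeasure (diskMeasure r) := by
  refine ⟨?_⟩
  rw [diskMeasure, Measure.restrict_apply_univ]
  refine (measure_mono (t := Metric.ball (0 : ℂ) (2 * r)) fun w hw => ?_).trans_lt
    measure_ball_lt_top
  simpa using hw.2

lemma setLIntegral_angle {g : UnitAddCircle → ℝ≥0∞} (hg : Measurable g) (c : ℝ) :
    ∫⁻ θ in Set.Ioo (-Real.pi) Real.pi, g ((θ / (2 * Real.pi) - c : ℝ) : UnitAddCircle) =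
      ENNReal.ofReal (2 * Real.pi) * ∫⁻ s, g s := by
  have hpi := Real.two_pi_pos
  set H : ℝ → ℝ≥0∞ := Set.indicator (Set.Ioo (-(1 / 2)) (1 / 2))
    fun x => g ((x : UnitAddCircle) - c) with hH
  have hgm : Measurable fun x : ℝ => g ((x : UnitAddCircle) - c) :=
    hg.comp (AddCircle.measurable_mk'.sub_const _)
  have hHm : Measurable H := hgm.indicator measurableSet_Ioo
  have h1 : ∫⁻ θ in Set.Ioo (-Real.pi) Real.pi, g ((θ / (2 * Real.pi) - c : ℝ) : UnitAddCircle) =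
      ∫⁻ θ, H (θ * (2 * Real.pi)⁻¹) := by
    rw [← lintegral_indicator measurableSet_Ioo]
    refine lintegral_congr fun θ => ?_
    have : θ ∈ Set.Ioo (-Real.pi) Real.pi ↔
        θ * (2 * Real.pi)⁻¹ ∈ Set.Ioo (-(1 / 2) : ℝ) (1 / 2) := by
      rw [← div_eq_mul_inv, Set.mem_Ioo, Set.mem_Ioo, lt_div_iff₀ hpi, div_lt_iff₀ hpi]
      constructor <;> rintro ⟨h, h'⟩ <;> constructor <;> linarith
    by_cases h : θ ∈ Set.Ioo (-Real.pi) Real.pi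
    · rw [Set.indicator_of_mem h, hH, Set.indicator_of_mem (this.1 h), AddCircle.coe_sub,
        div_eq_mul_inv]
    · rw [Set.indicator_of_notMem h, hH, Set.indicator_of_notMem (mt this.2 h)]
  rw [h1, ← lintegral_map (g := fun x : ℝ => x * (2 * Real.pi)⁻¹) hHm
      (measurable_id.mul_const _), Real.map_volume_mul_right (inv_ne_zero hpi.ne'), lintegral_smul_measure, inv_inv,
    abs_of_pos hpi, smul_eq_mul, hH, lintegral_indicator measurableSet_Ioo,
    setLIntegral_congr Ioo_ae_eq_Ioc]
  have h2 := UnitAddCircle.lintegral_preimage (-(1 / 2)) fun s => g (s - c)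
  rw [show (-(1 / 2) + 1 : ℝ) = 1 / 2 by norm_num] at h2
  rw [h2, lintegral_sub_right_eq_self]

/-- In the coordinates given by the starting point and the length of the arc, Lebesgue measure on
the disk is a product measure. -/
theorem map_arc_diskMeasure (r : ℝ) :
    (diskMeasure r).map (fun w => (arcStart r w, arcLen r w)) =
      (volume : Measure UnitAddCircle).prod (arcLenLaw r) := by
  have hm : Measurable fun w => (arcStart r w, arcLen r w) :=
    (measurable_arcStart r).prodMk (measurable_arcLen r)
  refine Measure.ext_of_lintegral _ fun f hf => ?_
  have hℓ := measurable_arccos_div r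
  set ℓ : ℝ → ℝ := fun ρ => Real.arccos (ρ / (2 * r)) / Real.pi with hℓd
  have hfs (y : ℝ) : Measurable fun s => f (s, y) := hf.comp (measurable_id.prodMk measurable_const)
  have hin : Measurable fun y => ∫⁻ s, f (s, y) :=
    (hf.comp measurable_swap).lintegral_prod_right'
  rw [lintegral_prod_symm' _ hf, arcLenLaw, lintegral_map hin hℓ,
    lintegral_withDensity_eq_lintegral_mul _ (by fun_prop)
      (show Measurable fun a => ∫⁻ s, f (s, ℓ a) from hin.comp hℓ), lintegral_map hf hm,
    diskMeasure, ← lintegral_indicator (measurableSet_punctured_disk r),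
    ← Complex.lintegral_comp_polarCoord_symm]
  -- In polar coordinates the length depends on the radius only, and at a fixed radius the start is
  -- uniform, because the shift by half the length preserves Haar measure.
  have hrhs : ∫⁻ ρ in Set.Ioo 0 (2 * r), ((fun ρ => ENNReal.ofReal (2 * Real.pi * ρ)) *
      fun a => ∫⁻ s, f (s, ℓ a)) ρ = ∫⁻ ρ in Set.Ioi (0 : ℝ),
        ∫⁻ θ in Set.Ioo (-Real.pi) Real.pi, Set.indicator (Set.Ioo 0 (2 * r))
          (fun ρ => ENNReal.ofReal ρ *
            f (((θ / (2 * Real.pi) - ℓ ρ / 2 : ℝ) : UnitAddCircle), ℓ ρ)) ρ := by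
    rw [← lintegral_indicator measurableSet_Ioo, ← lintegral_indicator measurableSet_Ioi]
    refine lintegral_congr fun ρ => ?_
    by_cases h : ρ ∈ Set.Ioo 0 (2 * r)
    · have h' : ρ ∈ Set.Ioi (0 : ℝ) := h.1
      simp only [Set.indicator_of_mem h, Set.indicator_of_mem h', Pi.mul_apply]
      rw [lintegral_const_mul, setLIntegral_angle (hfs _), ← mul_assoc, mul_comm (2 * Real.pi) ρ,
        ENNReal.ofReal_mul h.1.le]
      exact (hfs (ℓ ρ)).comp (AddCircle.measurable_mk'.comp (by fun_prop))
    · by_cases h' : ρ ∈ Set.Ioi (0 : ℝ)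
      · simp only [Set.indicator_of_notMem h, Set.indicator_of_mem h', lintegral_zero]
      · rw [Set.indicator_of_notMem h, Set.indicator_of_notMem h']
  have hjoint : Measurable fun p : ℝ × ℝ => Set.indicator (Set.Ioo 0 (2 * r))
      (fun ρ => ENNReal.ofReal ρ *
        f (((p.2 / (2 * Real.pi) - ℓ ρ / 2 : ℝ) : UnitAddCircle), ℓ ρ)) p.1 := by
    have : (fun p : ℝ × ℝ => Set.indicator (Set.Ioo 0 (2 * r))
      (fun ρ => ENNReal.ofReal ρ *
        f (((p.2 / (2 * Real.pi) - ℓ ρ / 2 : ℝ) : UnitAddCircle), ℓ ρ)) p.1) =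
        Set.indicator (Prod.fst ⁻¹' Set.Ioo 0 (2 * r)) fun p : ℝ × ℝ => ENNReal.ofReal p.1 *
          f (((p.2 / (2 * Real.pi) - ℓ p.1 / 2 : ℝ) : UnitAddCircle), ℓ p.1) := by
      ext p
      simp only [Set.indicator, Set.mem_preimage]
    rw [this]
    refine Measurable.indicator ?_ (measurable_fst measurableSet_Ioo)
    refine (ENNReal.measurable_ofReal.comp measurable_fst).mul (hf.comp (Measurable.prodMk ?_ ?_))
    · refine AddCircle.measurable_mk'.comp ?_
      exact (measurable_snd.div_const _).sub ((hℓ.comp measurable_fst).div_const _)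
    · exact hℓ.comp measurable_fst
  rw [hrhs, ← setLIntegral_prod _ hjoint.aemeasurable, ← Measure.volume_eq_prod]
  refine setLIntegral_congr_fun (measurableSet_Ioi.prod measurableSet_Ioo) ?_
  rintro ⟨ρ, θ⟩ ⟨hρ : 0 < ρ, hθ⟩
  have hnorm : ‖Complex.polarCoord.symm (ρ, θ)‖ = ρ := by
    rw [Complex.norm_polarCoord_symm, abs_of_pos hρ]
  have harg : (Complex.polarCoord.symm (ρ, θ)).arg = θ := by
    rw [Complex.polarCoord_symm_apply]
    have := Complex.arg_mul_cos_add_sin_mul_I hρ (Set.Ioo_subset_Ioc_self hθ)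
    push_cast
    exact this
  have hlen : arcLen r (Complex.polarCoord.symm (ρ, θ)) = ℓ ρ := by
    rw [arcLen, hnorm]
  by_cases h : ρ ∈ Set.Ioo 0 (2 * r)
  · have h' : Complex.polarCoord.symm (ρ, θ) ∈ {w : ℂ | 0 < ‖w‖ ∧ ‖w‖ < 2 * r} := by
      simpa only [Set.mem_ofPred_eq, hnorm, Set.mem_Ioo] using h
    simp only [Set.indicator_of_mem h, Set.indicator_of_mem h', arcStart, hlen, harg, smul_eq_mul]
  · have h' : Complex.polarCoord.symm (ρ, θ) ∉ {w : ℂ | 0 < ‖w‖ ∧ ‖w‖ < 2 * r} := by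
      simpa only [Set.mem_ofPred_eq, hnorm, Set.mem_Ioo] using h
    simp only [Set.indicator_of_notMem h, Set.indicator_of_notMem h', smul_zero]

/-- The arc is no longer than `d` exactly when the distance is at least `m = 2r cos(π min(d, 1/2))`.
The annulus between `m` and `2r` has area `π(4r² - m²)`, which is where `F` comes from. -/
theorem arcLenLaw_Iic {r : ℝ} (hr : 0 < r) {d : ℝ} (hd : 0 < d) :
    arcLenLaw r (Set.Iic d) = ENNReal.ofReal (4 * Real.pi * r ^ 2 * F d) := by
  have hpi := Real.pi_pos
  set e := min d (1 / 2) with he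
  have he0 : 0 < e := lt_min hd (by norm_num)
  have he1 : e ≤ 1 / 2 := min_le_right _ _
  set m := 2 * r * Real.cos (Real.pi * e) with hm
  have hcos0 : 0 ≤ Real.cos (Real.pi * e) :=
    Real.cos_nonneg_of_mem_Icc ⟨by nlinarith, by nlinarith⟩
  have hm0 : 0 ≤ m := by positivity
  have hm1 : m ≤ 2 * r := by
    have := Real.cos_le_one (Real.pi * e)
    nlinarith
  have hset : (fun ρ => Real.arccos (ρ / (2 * r)) / Real.pi) ⁻¹' Set.Iic d ∩ Set.Ioo 0 (2 * r) =
      Set.Ico m (2 * r) ∩ Set.Ioi 0 := by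
    ext ρ
    simp only [Set.mem_inter_iff, Set.mem_preimage, Set.mem_Iic, Set.mem_Ioo, Set.mem_Ico,
      Set.mem_Ioi]
    have key : 0 < ρ → ρ < 2 * r → (Real.arccos (ρ / (2 * r)) / Real.pi ≤ d ↔ m ≤ ρ) := by
      intro h0 h1
      have hx0 : 0 ≤ ρ / (2 * r) := by positivity
      have hx1 : ρ / (2 * r) ≤ 1 := by rw [div_le_one (by positivity)]; exact h1.le
      have hhalf : Real.arccos (ρ / (2 * r)) / Real.pi ≤ 1 / 2 := by
        rw [div_le_iff₀ hpi]
        linarith [Real.arccos_le_pi_div_two.2 hx0]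
      have h2 : Real.arccos (ρ / (2 * r)) / Real.pi ≤ d ↔
          Real.arccos (ρ / (2 * r)) / Real.pi ≤ e := by
        rw [he, le_min_iff, and_iff_left hhalf]
      rw [h2, div_le_iff₀ hpi, mul_comm e]
      have h3 : m ≤ ρ ↔ Real.cos (Real.pi * e) ≤ Real.cos (Real.arccos (ρ / (2 * r))) := by
        rw [Real.cos_arccos (by linarith) hx1, le_div_iff₀ (by positivity), hm, mul_comm]
      rw [h3]
      exact (Real.strictAntiOn_cos.le_iff_ge ⟨by positivity, by nlinarith⟩
        ⟨Real.arccos_nonneg _, Real.arccos_le_pi _⟩).symm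
    constructor
    · rintro ⟨h, h0, h1⟩
      exact ⟨⟨(key h0 h1).1 h, h1⟩, h0⟩
    · rintro ⟨⟨h, h1⟩, h0⟩
      exact ⟨(key h0 h1).2 h, h0, h1⟩
  rw [arcLenLaw, Measure.map_apply (measurable_arccos_div r) measurableSet_Iic,
    withDensity_apply _ (measurable_arccos_div r measurableSet_Iic),
    Measure.restrict_restrict (measurable_arccos_div r measurableSet_Iic), hset]
  have hae : (Set.Ico m (2 * r) ∩ Set.Ioi 0 : Set ℝ) =ᵐ[volume] Set.Ioc m (2 * r) := by
    have h1 : Set.Ioo m (2 * r) ⊆ Set.Ico m (2 * r) ∩ Set.Ioi 0 :=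
      fun x hx => ⟨⟨hx.1.le, hx.2⟩, hm0.trans_lt hx.1⟩
    have h2 : (Set.Ico m (2 * r) ∩ Set.Ioi 0 : Set ℝ) ⊆ Set.Icc m (2 * r) :=
      fun x hx => ⟨hx.1.1, hx.1.2.le⟩
    refine Filter.EventuallyLE.antisymm ?_ ?_
    · exact (LE.le.eventuallyLE h2).trans Ioc_ae_eq_Icc.symm.le
    · exact Ioo_ae_eq_Ioc.symm.le.trans (LE.le.eventuallyLE h1)
  rw [setLIntegral_congr hae, ← ofReal_integral_eq_lintegral_ofReal,
    ← intervalIntegral.integral_of_le hm1, intervalIntegral.integral_const_mul, integral_id,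
    F_eq_sin_sq hd.le, Real.sin_sq, ← he, hm]
  · congr 1
    ring
  · exact (Continuous.integrableOn_Icc (by fun_prop)).mono_set Set.Ioc_subset_Icc_self
  · refine (ae_restrict_iff' measurableSet_Ioc).2 (Filter.Eventually.of_forall fun x hx => ?_)
    have : 0 ≤ x := hm0.trans hx.1.le
    positivity

theorem lintegral_pi_diskMeasure (r : ℝ) {k : ℕ}
    {G : (Fin k → UnitAddCircle) × (Fin k → ℝ) → ℝ≥0∞} (hG : Measurable G) :
    ∫⁻ w, G (fun i => arcStart r (w i), fun i => arcLen r (w i))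
      ∂Measure.pi (fun _ : Fin k => diskMeasure r) =
      ∫⁻ σ, ∫⁻ l, G (σ, l) ∂Measure.pi (fun _ : Fin k => arcLenLaw r) := by
  have hm : Measurable fun w => (arcStart r w, arcLen r w) :=
    (measurable_arcStart r).prodMk (measurable_arcLen r)
  have h1 := Measure.pi_map_pi (μ := fun _ : Fin k => diskMeasure r)
    (f := fun _ w => (arcStart r w, arcLen r w)) (fun _ => hm.aemeasurable)
  simp_rw [map_arc_diskMeasure r] at h1
  have h2 := measurePreserving_arrowProdEquivProdArrow UnitAddCircle ℝ (Fin k)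
    (fun _ => volume) (fun _ => arcLenLaw r)
  have hm' : Measurable fun (w : Fin k → ℂ) i => (arcStart r (w i), arcLen r (w i)) :=
    measurable_pi_lambda _ fun i => hm.comp (measurable_pi_apply i)
  rw [volume_pi, ← lintegral_prod _ hG.aemeasurable, ← h2.lintegral_comp hG, ← h1,
    lintegral_map (f := fun p => G (MeasurableEquiv.arrowProdEquivProdArrow UnitAddCircle ℝ
      (Fin k) p)) (hG.comp h2.measurable) hm']
  rfl

/-! ### Order statistics and the simplex -/

/-- Each coincidence `x i = x j` is a proper linear subspace. The space is general because both the
line and the plane occur. -/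
lemma ae_injective_pi {E : Type*} [NormedAddCommGroup E] [NormedSpace ℝ E] [Nontrivial E]
    [FiniteDimensional ℝ E] [MeasureSpace E] [BorelSpace E]
    [(volume : Measure E).IsAddHaarMeasure] (n : ℕ) :
    ∀ᵐ x : Fin n → E, Function.Injective x := by
  have h (i j : Fin n) (hij : i ≠ j) : ∀ᵐ x : Fin n → E, x i ≠ x j := by
    set s : Submodule ℝ (Fin n → E) :=
      LinearMap.ker (LinearMap.proj (R := ℝ) (φ := fun _ : Fin n => E) i - LinearMap.proj j) with hs
    have hne : s ≠ ⊤ := by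
      intro htop
      obtain ⟨e, he⟩ := exists_ne (0 : E)
      have : Pi.single i e ∈ s := htop ▸ Submodule.mem_top
      rw [hs, LinearMap.mem_ker] at this
      simp [hij.symm] at this
      exact he this
    have h0 := Measure.addHaar_submodule volume s hne
    rw [ae_iff]
    refine measure_mono_null (fun x hx => ?_) h0
    have hx' : x i = x j := not_not.1 hx
    simp [hs, hx']
  have h' : ∀ᵐ x : Fin n → E, ∀ i j, i ≠ j → x i ≠ x j := by
    rw [ae_all_iff]; intro i
    rw [ae_all_iff]; intro j
    by_cases hij : i = j
    · simp [hij]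
    · filter_upwards [h i j hij] with x hx _ using hx
  filter_upwards [h'] with x hx i j hij
  by_contra hne
  exact hx i j hne hij

lemma measurableSet_strictMono (n : ℕ) : MeasurableSet {t : Fin n → ℝ | StrictMono t} := by
  have : {t : Fin n → ℝ | StrictMono t} = ⋂ i, ⋂ j, ⋂ (_ : i < j), {t | t i < t j} := by
    ext t
    simp [StrictMono]
  rw [this]
  exact MeasurableSet.iInter fun i => MeasurableSet.iInter fun j => MeasurableSet.iInter fun _ =>
    measurableSet_lt (measurable_pi_apply i) (measurable_pi_apply j)

lemma existsUnique_perm_strictMono {n : ℕ} {t : Fin n → ℝ} (ht : Function.Injective t) :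
    ∃! π : Equiv.Perm (Fin n), StrictMono (t ∘ π) := by
  refine ⟨Tuple.sort t, (Tuple.monotone_sort t).strictMono_of_injective
    (ht.comp (Tuple.sort t).injective), fun π hπ => ?_⟩
  have h1 : StrictMono (t ∘ Tuple.sort t) := (Tuple.monotone_sort t).strictMono_of_injective
    (ht.comp (Tuple.sort t).injective)
  have h2 := (hπ.range_inj h1).1 (by
    rw [π.surjective.range_comp, (Tuple.sort t).surjective.range_comp])
  ext i
  exact congrArg Fin.val (ht (congrFun h2 i))

/-- The integral of a symmetric function is `n!` times its integral over the increasing tuples. -/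
lemma lintegral_eq_factorial_mul {n : ℕ} {h : (Fin n → ℝ) → ℝ≥0∞} (hm : Measurable h)
    (hsymm : ∀ (π : Equiv.Perm (Fin n)) t, h (t ∘ π) = h t) :
    ∫⁻ t, h t = (n.factorial : ℝ≥0∞) * ∫⁻ t in {t | StrictMono t}, h t := by
  classical
  -- Almost every tuple is sorted by exactly one permutation, so the integral splits into `n!` equal
  -- parts.
  have h1 : ∀ᵐ t : Fin n → ℝ, h t = ∑ π : Equiv.Perm (Fin n),
      Set.indicator {t | StrictMono t} h (t ∘ π) := by
    filter_upwards [ae_injective_pi (E := ℝ) n] with t ht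
    obtain ⟨π, hπ, huniq⟩ := existsUnique_perm_strictMono ht
    rw [Finset.sum_eq_single π]
    · rw [Set.indicator_of_mem (show t ∘ π ∈ {t | StrictMono t} from hπ), hsymm]
    · intro π' _ hne
      exact Set.indicator_of_notMem (fun h' => hne (huniq π' h')) _
    · simp
  have hperm (π : Equiv.Perm (Fin n)) :
      MeasurePreserving (fun t : Fin n → ℝ => t ∘ π) volume volume := by
    have := volume_measurePreserving_piCongrLeft (fun _ : Fin n => ℝ) π.symm
    convert this using 1
    ext t i
    have h2 := Equiv.piCongrLeft_apply_apply (fun _ : Fin n => ℝ) π.symm t (π i)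
    simp only [Equiv.symm_apply_apply] at h2
    exact h2.symm
  have hind : Measurable (Set.indicator {t : Fin n → ℝ | StrictMono t} h) :=
    hm.indicator (measurableSet_strictMono n)
  have hind' (π : Equiv.Perm (Fin n)) :
      Measurable fun t => Set.indicator {t : Fin n → ℝ | StrictMono t} h (t ∘ π) :=
    hind.comp (hperm π).measurable
  rw [lintegral_congr_ae h1, lintegral_finsetSum _ fun π _ => hind' π]
  simp_rw [fun π => (hperm π).lintegral_comp hind, lintegral_indicator (measurableSet_strictMono n)]
  rw [Finset.sum_const, Finset.card_univ, Fintype.card_perm, Fintype.card_fin, nsmul_eq_mul]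

/-- The partial sums of a tuple. -/
def partialSum {n : ℕ} (v : Fin n → ℝ) (i : Fin n) : ℝ := ∑ j, if j ≤ i then v j else 0

/-- The matrix is triangular with ones on the diagonal. -/
lemma measurePreserving_partialSum (n : ℕ) :
    MeasurePreserving (partialSum (n := n)) volume volume := by
  set M : Matrix (Fin n) (Fin n) ℝ := Matrix.of fun i j => if j ≤ i then 1 else 0 with hM
  have hdet : M.det = 1 := by
    rw [Matrix.det_of_isLowerTriangular]
    · simp [hM]
    · intro i j hij
      have : i < j := hij
      simp [hM, this]
  have h := Real.map_matrix_volume_pi_eq_smul_volume_pi (M := M) (by rw [hdet]; exact one_ne_zero)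
  rw [hdet] at h
  have hfun : (partialSum (n := n)) = Matrix.toLin' M := by
    ext v i
    simp [partialSum, hM, Matrix.mulVec, dotProduct, ite_mul]
  refine ⟨?_, ?_⟩
  · unfold partialSum
    refine measurable_pi_lambda _ fun i => Finset.measurable_fun_sum _ fun j _ => ?_
    split_ifs
    · exact measurable_pi_apply j
    · exact measurable_const
  · rw [hfun, h]
    simp

/-- The interior of the simplex. -/
def openSimplex (n : ℕ) : Set (Fin n → ℝ) := {v | (∀ i, 0 < v i) ∧ ∑ i, v i < 1}

/-- The partial sums of `v`, continued by `1`. -/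
def breakPoint {n : ℕ} (v : Fin n → ℝ) (m : ℕ) : ℝ :=
  if m ≤ n then ∑ j : Fin n, if (j : ℕ) < m then v j else 0 else 1

section breakPoint

variable {n : ℕ} {v : Fin n → ℝ}

lemma breakPoint_zero : breakPoint v 0 = 0 := by simp [breakPoint]

lemma breakPoint_succ_last : breakPoint v (n + 1) = 1 := by simp [breakPoint]

lemma breakPoint_eq_partialSum (i : Fin n) : breakPoint v (i + 1) = partialSum v i := by
  have : (i : ℕ) + 1 ≤ n := i.2
  simp only [breakPoint, this, if_true, partialSum, Nat.lt_succ_iff]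
  rfl

lemma breakPoint_succ_sub (i : Fin n) : breakPoint v (i + 1) - breakPoint v i = v i := by
  have h1 : (i : ℕ) + 1 ≤ n := i.2
  have h2 : (i : ℕ) ≤ n := i.2.le
  simp only [breakPoint, h1, h2, if_true, ← Finset.sum_sub_distrib]
  rw [Finset.sum_eq_single i]
  · simp
  · intro j _ hj
    have : (j : ℕ) ≠ i := fun h => hj (Fin.ext h)
    have h3 : (j : ℕ) < i + 1 ↔ (j : ℕ) < i := by omega
    simp [h3]
  · simp

lemma breakPoint_last : breakPoint v n = ∑ i, v i := by
  simp [breakPoint]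

lemma breakPoint_lt_succ (hv : v ∈ openSimplex n) {m : ℕ} (hm : m ≤ n) :
    breakPoint v m < breakPoint v (m + 1) := by
  rcases hm.lt_or_eq with h | rfl
  · have := breakPoint_succ_sub (v := v) ⟨m, h⟩
    have h2 := hv.1 ⟨m, h⟩
    simp only at this
    linarith
  · rw [breakPoint_succ_last, breakPoint_last]
    exact hv.2

lemma breakPoint_le (hv : v ∈ openSimplex n) {i j : ℕ} (hij : i ≤ j) (hj : j ≤ n + 1) :
    breakPoint v i ≤ breakPoint v j := by
  induction j, hij using Nat.le_induction with
  | base => exact le_rfl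
  | succ m _ ih => exact (ih (by omega)).trans (breakPoint_lt_succ hv (by omega)).le

lemma breakPoint_lt (hv : v ∈ openSimplex n) {i j : ℕ} (hij : i < j) (hj : j ≤ n + 1) :
    breakPoint v i < breakPoint v j :=
  (breakPoint_lt_succ hv (by omega)).trans_le (breakPoint_le hv hij hj)

lemma mem_openSimplex_iff :
    v ∈ openSimplex n ↔ StrictMono (partialSum v) ∧ ∀ i, partialSum v i ∈ Set.Ioo (0 : ℝ) 1 := by
  constructor
  · intro hv
    refine ⟨fun i j hij => ?_, fun i => ?_⟩
    · rw [← breakPoint_eq_partialSum, ← breakPoint_eq_partialSum]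
      exact breakPoint_lt hv (Nat.succ_lt_succ hij) (by omega)
    · rw [← breakPoint_eq_partialSum]
      refine ⟨?_, ?_⟩
      · rw [← breakPoint_zero (v := v)]
        exact breakPoint_lt hv (Nat.succ_pos _) (by omega)
      · rw [← breakPoint_succ_last (v := v)]
        exact breakPoint_lt hv (by omega) le_rfl
  · rintro ⟨hmono, hI⟩
    refine ⟨fun i => ?_, ?_⟩
    · rw [← breakPoint_succ_sub (v := v), sub_pos, breakPoint_eq_partialSum]
      obtain ⟨m, hm⟩ := i
      cases m with
      | zero => simpa [breakPoint_zero] using (hI ⟨0, hm⟩).1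
      | succ m =>
        have := breakPoint_eq_partialSum (v := v) ⟨m, by omega⟩
        simp only at this ⊢
        rw [this]
        exact hmono (Fin.mk_lt_mk.2 m.lt_succ_self)
    · rw [← breakPoint_last]
      cases n with
      | zero => simp [breakPoint]
      | succ n =>
        have := breakPoint_eq_partialSum (v := v) (Fin.last n)
        simp only [Fin.val_last] at this
        rw [this]
        exact (hI _).2

end breakPoint

lemma measurableSet_openSimplex (n : ℕ) : MeasurableSet (openSimplex n) := by
  have : openSimplex n = (⋂ i, {v | 0 < v i}) ∩ {v | ∑ i, v i < 1} := by
    ext v; simp [openSimplex]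
  rw [this]
  refine (MeasurableSet.iInter fun i => measurableSet_lt measurable_const
    (measurable_pi_apply i)).inter (measurableSet_lt ?_ measurable_const)
  exact Finset.measurable_fun_sum _ fun i _ => measurable_pi_apply i

/-- The integral over the cube of a symmetric function is `n!` times the integral over the simplex
of the function of the partial sums. -/
lemma setLIntegral_cube {n : ℕ} {h : (Fin n → ℝ) → ℝ≥0∞} (hm : Measurable h)
    (hsymm : ∀ (π : Equiv.Perm (Fin n)) t, h (t ∘ π) = h t) :
    ∫⁻ t in Set.univ.pi fun _ => Set.Ioo 0 1, h t =
      (n.factorial : ℝ≥0∞) * ∫⁻ v in openSimplex n, h (partialSum v) := by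
  have hcube : MeasurableSet (Set.univ.pi fun _ : Fin n => Set.Ioo (0 : ℝ) 1) :=
    MeasurableSet.univ_pi fun _ => measurableSet_Ioo
  have hmem (π : Equiv.Perm (Fin n)) (t : Fin n → ℝ) :
      t ∘ π ∈ (Set.univ.pi fun _ : Fin n => Set.Ioo (0 : ℝ) 1) ↔
        t ∈ (Set.univ.pi fun _ : Fin n => Set.Ioo (0 : ℝ) 1) := by
    simp only [Set.mem_univ_pi, Function.comp_apply]
    exact ⟨fun h i => by simpa using h (π.symm i), fun h i => h _⟩
  rw [← lintegral_indicator hcube, lintegral_eq_factorial_mul (hm.indicator hcube),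
    ← lintegral_indicator (measurableSet_strictMono n),
    ← (measurePreserving_partialSum n).lintegral_comp
      ((hm.indicator hcube).indicator (measurableSet_strictMono n)),
    ← lintegral_indicator (measurableSet_openSimplex n)]
  · congr 1
    refine lintegral_congr fun v => ?_
    by_cases hv : v ∈ openSimplex n
    · have h1 := mem_openSimplex_iff.1 hv
      rw [Set.indicator_of_mem hv, Set.indicator_of_mem h1.1,
        Set.indicator_of_mem (Set.mem_univ_pi.2 h1.2)]
    · rw [Set.indicator_of_notMem hv]
      by_cases h1 : partialSum v ∈ {t | StrictMono t}
      · rw [Set.indicator_of_mem h1, Set.indicator_of_notMem]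
        exact fun h2 => hv (mem_openSimplex_iff.2 ⟨h1, Set.mem_univ_pi.1 h2⟩)
      · rw [Set.indicator_of_notMem h1]
  · intro π t
    by_cases h1 : t ∈ (Set.univ.pi fun _ : Fin n => Set.Ioo (0 : ℝ) 1)
    · rw [Set.indicator_of_mem h1, Set.indicator_of_mem ((hmem π t).2 h1), hsymm]
    · rw [Set.indicator_of_notMem h1, Set.indicator_of_notMem (mt (hmem π t).1 h1)]

lemma factorial_mul_volume_openSimplex (n : ℕ) :
    (n.factorial : ℝ≥0∞) * volume (openSimplex n) = 1 := by
  have h := setLIntegral_cube (n := n) (h := fun _ => 1) measurable_const fun _ _ => rfl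
  have hc : volume (Set.univ.pi fun _ : Fin n => Set.Ioo (0 : ℝ) 1) = 1 := by
    rw [volume_pi, Measure.pi_pi]
    simp
  rw [setLIntegral_one, setLIntegral_one, hc] at h
  exact h.symm

lemma openSimplex_ae_eq (n : ℕ) : (openSimplex n : Set (Fin n → ℝ)) =ᵐ[volume]
    {v | (∀ i, 0 ≤ v i) ∧ ∑ i, v i ≤ 1} := by
  have h1 : ∀ᵐ v : Fin n → ℝ, ∀ i, v i ≠ 0 := by
    rw [ae_all_iff]
    intro i
    rw [ae_iff]
    simp only [ne_eq, not_not]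
    exact Measure.pi_hyperplane (fun _ => volume) i 0
  have h2 : ∀ᵐ v : Fin n → ℝ, ∑ i, v i ≠ 1 := by
    cases n with
    | zero => simp
    | succ n =>
      -- Partial sums preserve volume and carry the hyperplane `∑ v = 1` to a coordinate hyperplane.
      have h3 : ∀ᵐ t : Fin (n + 1) → ℝ, t (Fin.last n) ≠ 1 := by
        rw [ae_iff]
        simp only [ne_eq, not_not]
        exact Measure.pi_hyperplane (fun _ => volume) _ 1
      filter_upwards [(measurePreserving_partialSum (n + 1)).quasiMeasurePreserving.ae h3] with v hv
      simpa [partialSum, Fin.le_last] using hv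
  filter_upwards [h1, h2] with v hv1 hv2
  refine propext ⟨fun h => ⟨fun i => (h.1 i).le, h.2.le⟩, fun h => ⟨fun i => ?_, ?_⟩⟩
  · exact lt_of_le_of_ne (h.1 i) (hv1 i).symm
  · exact lt_of_le_of_ne h.2 hv2

lemma measurable_cons_one_sub (n : ℕ) :
    Measurable fun v : Fin n → ℝ => (Fin.cons (1 - ∑ i, v i) v : Fin (n + 1) → ℝ) := by
  refine measurable_pi_lambda _ fun i => ?_
  refine Fin.cases ?_ (fun j => ?_) i
  · simp only [Fin.cons_zero]
    exact measurable_const.sub (Finset.measurable_fun_sum _ fun i _ => measurable_pi_apply i)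
  · simp only [Fin.cons_succ]
    exact measurable_pi_apply j

lemma simplexUniform_succ (n : ℕ) : simplexUniform (n + 1) =
    ((n.factorial : ℝ≥0∞) • (volume.restrict (openSimplex n))).map
      (fun v => (Fin.cons (1 - ∑ i, v i) v : Fin (n + 1) → ℝ)) := by
  have hfac : (n.factorial : ℝ≥0∞) ≠ 0 := Nat.cast_ne_zero.2 n.factorial_ne_zero
  rw [simplexUniform, ProbabilityTheory.cond, ← measure_congr (openSimplex_ae_eq n),
    ← Measure.restrict_congr_set (openSimplex_ae_eq n),
    ENNReal.eq_inv_of_mul_eq_one_left (factorial_mul_volume_openSimplex n)]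

lemma lintegral_simplexUniform (n : ℕ) {f : (Fin (n + 1) → ℝ) → ℝ≥0∞} (hf : Measurable f) :
    ∫⁻ u, f u ∂simplexUniform (n + 1) = (n.factorial : ℝ≥0∞) *
      ∫⁻ v in openSimplex n, f (Fin.cons (1 - ∑ i, v i) v) := by
  rw [simplexUniform_succ, lintegral_map hf (measurable_cons_one_sub n), lintegral_smul_measure,
    smul_eq_mul]

/-! ### Spacings of uniform points of the circle -/

/-- The distance from `s` to the next of the points `σ j` in counterclockwise order. -/
def nextDist {n : ℕ} (σ : Fin (n + 1) → UnitAddCircle) (s : UnitAddCircle) : ℝ :=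
  ⨅ j, fwd (σ j - s)

section nextDist

variable {n : ℕ} {σ : Fin (n + 1) → UnitAddCircle} {s : UnitAddCircle}

lemma le_nextDist_iff {c : ℝ} : c ≤ nextDist σ s ↔ ∀ j, c ≤ fwd (σ j - s) :=
  le_ciInf_iff (Finite.bddBelow_range _)

lemma nextDist_le (j : Fin (n + 1)) : nextDist σ s ≤ fwd (σ j - s) :=
  ciInf_le (Finite.bddBelow_range _) j

lemma nextDist_pos : 0 < nextDist σ s := by
  obtain ⟨j, hj⟩ := exists_eq_ciInf_of_finite (f := fun j => fwd (σ j - s))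
  rw [nextDist, ← hj]
  exact fwd_pos _

lemma nextDist_add (a : UnitAddCircle) : nextDist (fun i => σ i + a) (s + a) = nextDist σ s := by
  simp [nextDist]

lemma nextDist_perm (π : Equiv.Perm (Fin (n + 1))) : nextDist (σ ∘ π) s = nextDist σ s :=
  π.iInf_comp (g := fun j => fwd (σ j - s))

end nextDist

lemma _root_.Measurable.nextDist {X : Type*} [MeasurableSpace X] {n : ℕ}
    {f : X → Fin (n + 1) → UnitAddCircle} {g : X → UnitAddCircle} (hf : Measurable f)
    (hg : Measurable g) : Measurable fun x => nextDist (f x) (g x) :=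
  Measurable.iInf fun j => measurable_fwd.comp (((measurable_pi_apply j).comp hf).sub hg)

instance : IsProbabilityMeasure (volume : Measure UnitAddCircle) := ⟨UnitAddCircle.measure_univ⟩

/-- The mean of `F` at the distance to the next of the points `σ j`. -/
def meanF {n : ℕ} (σ : Fin (n + 1) → UnitAddCircle) : ℝ := ∫ s, F (nextDist σ s)

lemma integrable_F_comp {X : Type*} [MeasurableSpace X] {μ : Measure X} [IsFiniteMeasure μ]
    {f : X → ℝ} (hf : Measurable f) : Integrable (fun x => F (f x)) μ :=
  Integrable.of_bound (measurable_F.comp hf).aestronglyMeasurable 1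
    (Filter.Eventually.of_forall fun x => by
      rw [Real.norm_of_nonneg (F_nonneg _)]; exact F_le_one _)

lemma measurable_meanF (n : ℕ) : Measurable (meanF (n := n)) := by
  have h : Measurable fun p : (Fin (n + 1) → UnitAddCircle) × UnitAddCircle =>
      F (nextDist p.1 p.2) := measurable_F.comp (measurable_fst.nextDist measurable_snd)
  exact h.stronglyMeasurable.integral_prod_right.measurable

lemma meanF_add {n : ℕ} (σ : Fin (n + 1) → UnitAddCircle) (a : UnitAddCircle) :
    meanF (fun i => σ i + a) = meanF σ := by
  rw [meanF, ← integral_add_right_eq_self _ a]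
  simp_rw [nextDist_add]
  rfl

lemma meanF_perm {n : ℕ} (σ : Fin (n + 1) → UnitAddCircle) (π : Equiv.Perm (Fin (n + 1))) :
    meanF (σ ∘ π) = meanF σ := by
  simp only [meanF, nextDist_perm]

/-- The density, up to a constant, of the starting points of arcs which are not covered by any of
the arcs of a Poisson process. -/
def gapWeight (c : ℝ) {n : ℕ} (σ : Fin (n + 1) → UnitAddCircle) : ℝ≥0∞ :=
  (∏ i, ENNReal.ofReal (F (nextDist σ (σ i)))) * ENNReal.ofReal (Real.exp (c * meanF σ))

lemma measurable_gapWeight (c : ℝ) (n : ℕ) : Measurable (gapWeight c (n := n)) := by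
  refine Measurable.mul (Finset.measurable_fun_prod _ fun i _ => ?_) ?_
  · exact (measurable_F.comp (measurable_id.nextDist (measurable_pi_apply i))).ennreal_ofReal
  · exact (Real.measurable_exp.comp ((measurable_meanF n).const_mul c)).ennreal_ofReal

lemma gapWeight_add (c : ℝ) {n : ℕ} (σ : Fin (n + 1) → UnitAddCircle) (a : UnitAddCircle) :
    gapWeight c (fun i => σ i + a) = gapWeight c σ := by
  simp only [gapWeight, meanF_add, nextDist_add]

lemma gapWeight_perm (c : ℝ) {n : ℕ} (σ : Fin (n + 1) → UnitAddCircle)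
    (π : Equiv.Perm (Fin (n + 1))) : gapWeight c (σ ∘ π) = gapWeight c σ := by
  simp only [gapWeight, meanF_perm, nextDist_perm, Function.comp_apply]
  rw [Equiv.prod_comp π (fun i => ENNReal.ofReal (F (nextDist σ (σ i))))]

lemma gapWeight_cons_perm (c : ℝ) {n : ℕ} (τ : Fin n → UnitAddCircle) (π : Equiv.Perm (Fin n)) :
    gapWeight c (Fin.cons 0 (τ ∘ π) : Fin (n + 1) → UnitAddCircle) =
      gapWeight c (Fin.cons 0 τ : Fin (n + 1) → UnitAddCircle) := by
  -- `decomposeFin.symm (0, π)` extends `π` by fixing the first index.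
  rw [← gapWeight_perm c (Fin.cons 0 τ) (Equiv.Perm.decomposeFin.symm (0, π))]
  congr 1
  ext i
  refine Fin.cases ?_ (fun j => ?_) i
  · simp
  · simp

lemma measurable_cons_zero (n : ℕ) :
    Measurable fun τ : Fin n → UnitAddCircle => (Fin.cons 0 τ : Fin (n + 1) → UnitAddCircle) := by
  refine measurable_pi_lambda _ fun i => ?_
  refine Fin.cases ?_ (fun j => ?_) i
  · simp only [Fin.cons_zero]
    exact measurable_const
  · simp only [Fin.cons_succ]
    exact measurable_pi_apply j

/-- Rotation invariance moves the first point to 0, and its own integral has mass 1. -/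
lemma lintegral_gapWeight_eq_cons (c : ℝ) (n : ℕ) :
    ∫⁻ σ : Fin (n + 1) → UnitAddCircle, gapWeight c σ =
      ∫⁻ τ : Fin n → UnitAddCircle, gapWeight c (Fin.cons 0 τ : Fin (n + 1) → UnitAddCircle) := by
  have h := (volume_preserving_piFinSuccAbove (fun _ : Fin (n + 1) => UnitAddCircle) 0).symm
  have hm : Measurable fun z : UnitAddCircle × (Fin n → UnitAddCircle) => gapWeight c
      ((MeasurableEquiv.piFinSuccAbove (fun _ : Fin (n + 1) => UnitAddCircle) 0).symm z) :=
    (measurable_gapWeight c n).comp h.measurable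
  rw [← h.lintegral_comp (measurable_gapWeight c n), Measure.volume_eq_prod,
    lintegral_prod _ hm.aemeasurable]
  have h1 (a : UnitAddCircle) : ∫⁻ τ : Fin n → UnitAddCircle, gapWeight c
      ((MeasurableEquiv.piFinSuccAbove (fun _ : Fin (n + 1) => UnitAddCircle) 0).symm (a, τ)) =
      ∫⁻ τ : Fin n → UnitAddCircle, gapWeight c (Fin.cons 0 τ : Fin (n + 1) → UnitAddCircle) := by
    rw [← lintegral_add_right_eq_self _ (fun _ => a)]
    refine lintegral_congr fun τ => ?_
    rw [← gapWeight_add c (Fin.cons 0 τ) a]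
    congr 1
    ext i
    refine Fin.cases ?_ (fun j => ?_) i
    · simp [MeasurableEquiv.piFinSuccAbove, Fin.insertNthEquiv]
    · simp [MeasurableEquiv.piFinSuccAbove, Fin.insertNthEquiv]
  simp_rw [h1]
  simp

lemma measurePreserving_coe_cube (n : ℕ) :
    MeasurePreserving (fun (t : Fin n → ℝ) i => (t i : UnitAddCircle))
      (volume.restrict (Set.univ.pi fun _ => Set.Ioo (0 : ℝ) 1)) volume := by
  have h := UnitAddCircle.measurePreserving_mk 0
  rw [zero_add, ← Measure.restrict_congr_set Ioo_ae_eq_Ioc] at h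
  have := measurePreserving_pi (ι := Fin n) (fun _ => volume.restrict (Set.Ioo (0 : ℝ) 1))
    (fun _ => (volume : Measure UnitAddCircle)) fun _ => h
  rwa [volume_pi, Measure.restrict_pi_pi]

section

variable {n : ℕ} {v : Fin n → ℝ}

/-- The points of the circle at the break points of `v`. -/
lemma cons_partialSum_eq (i : Fin (n + 1)) :
    (Fin.cons 0 (fun i => (partialSum v i : UnitAddCircle)) : Fin (n + 1) → UnitAddCircle) i =
      (breakPoint v i : UnitAddCircle) := by
  refine Fin.cases ?_ (fun j => ?_) i
  · simp [breakPoint_zero]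
  · simp only [Fin.cons_succ, Fin.val_succ, breakPoint_eq_partialSum]

/-- The last gap closes at the break point 1, which is the point 0 of the circle. At `s = breakPoint
v m` the point `s` itself is at distance 1 and does not interfere. -/
lemma nextDist_breakPoint (hv : v ∈ openSimplex n) {m : ℕ} (hm : m ≤ n) {s : ℝ}
    (h1 : breakPoint v m ≤ s) (h2 : s < breakPoint v (m + 1)) :
    nextDist (Fin.cons 0 (fun i => (partialSum v i : UnitAddCircle))) (s : UnitAddCircle) =
      breakPoint v (m + 1) - s := by
  have hs0 : 0 ≤ s := by
    have := breakPoint_le hv (Nat.zero_le m) (by omega)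
    rw [breakPoint_zero] at this
    linarith
  have hP1 : breakPoint v (m + 1) ≤ 1 := by
    have := breakPoint_le hv (i := m + 1) (j := n + 1) (by omega) le_rfl
    rwa [breakPoint_succ_last] at this
  refine le_antisymm ?_ ?_
  · rcases hm.lt_or_eq with h | rfl
    · refine (nextDist_le ⟨m + 1, by omega⟩).trans_eq ?_
      rw [cons_partialSum_eq, ← AddCircle.coe_sub, fwd_coe (by simpa using h2)]
      simp only
      linarith
    · refine (nextDist_le 0).trans_eq ?_
      rw [breakPoint_succ_last] at h2 ⊢
      have : ((Fin.cons 0 (fun i => (partialSum v i : UnitAddCircle)) :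
          Fin (m + 1) → UnitAddCircle) 0) - (s : UnitAddCircle) = ((1 - s : ℝ) : UnitAddCircle) := by
        rw [AddCircle.coe_sub, AddCircle.coe_period]
        rfl
      rw [this, fwd_coe (by linarith) (by linarith)]
  · rw [le_nextDist_iff]
    intro j
    rw [cons_partialSum_eq]
    have hj : (j : ℕ) ≤ n := by omega
    have hj1 : breakPoint v j ≤ 1 := by
      have := breakPoint_le hv (i := j) (j := n + 1) (by omega) le_rfl
      rwa [breakPoint_succ_last] at this
    have hj0 : 0 ≤ breakPoint v j := by
      have := breakPoint_le hv (Nat.zero_le j) (by omega)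
      rwa [breakPoint_zero] at this
    rcases le_or_gt (m + 1) j with h | h
    · have := breakPoint_le hv h (by omega)
      rw [← AddCircle.coe_sub, fwd_coe (by linarith) (by linarith)]
      linarith
    · have := breakPoint_le hv (i := j) (j := m) (by omega) (by omega)
      have h3 : (breakPoint v j : UnitAddCircle) - (s : UnitAddCircle) =
          ((breakPoint v j - s + 1 : ℝ) : UnitAddCircle) := by
        rw [AddCircle.coe_add, AddCircle.coe_period, add_zero, AddCircle.coe_sub]
      rw [h3, fwd_coe (by linarith) (by linarith)]
      linarith

lemma intervalIntegrable_F (a b : ℝ) : IntervalIntegrable F volume a b :=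
  ⟨integrable_F_comp measurable_id, integrable_F_comp measurable_id⟩

lemma integrableOn_F_nextDist (σ : Fin (n + 1) → UnitAddCircle) (a b : ℝ) :
    IntegrableOn (fun s : ℝ => F (nextDist σ (s : UnitAddCircle))) (Set.Ioc a b) volume := by
  have hmeas' : Measurable fun s : UnitAddCircle => nextDist σ s :=
    measurable_const.nextDist measurable_id
  have hmeas : Measurable fun s : ℝ => nextDist σ (s : UnitAddCircle) :=
    hmeas'.comp AddCircle.measurable_mk'
  exact integrable_F_comp (X := ℝ) hmeas

lemma meanF_eq_sum (σ : Fin (n + 1) → UnitAddCircle) (a : ℕ → ℝ) (m : ℕ) (h0 : a 0 = 0)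
    (h1 : a m = 1) : meanF σ =
      ∑ k ∈ Finset.range m, ∫ s in (a k)..(a (k + 1)), F (nextDist σ (s : UnitAddCircle)) := by
  rw [intervalIntegral.sum_integral_adjacent_intervals fun k _ =>
    ⟨integrableOn_F_nextDist σ _ _, integrableOn_F_nextDist σ _ _⟩, h0, h1]
  have h := UnitAddCircle.intervalIntegral_preimage 0 fun s => F (nextDist σ s)
  rw [zero_add] at h
  exact h.symm

/-- On each gap the distance to the next point decreases linearly to 0, so reflecting the gap turns
it into the variable of integration. -/
lemma meanF_partialSum (hv : v ∈ openSimplex n) :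
    meanF (Fin.cons 0 fun i => (partialSum v i : UnitAddCircle)) =
      ∑ m ∈ Finset.range (n + 1), ∫ t in (0 : ℝ)..(breakPoint v (m + 1) - breakPoint v m), F t := by
  rw [meanF_eq_sum _ (breakPoint v) (n + 1) breakPoint_zero breakPoint_succ_last]
  refine Finset.sum_congr rfl fun m hm => ?_
  have hm' : m ≤ n := Nat.lt_succ_iff.1 (Finset.mem_range.1 hm)
  have h2 := intervalIntegral.integral_comp_sub_left (a := breakPoint v m)
    (b := breakPoint v (m + 1)) F (breakPoint v (m + 1))
  rw [sub_self] at h2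
  rw [← h2]
  refine intervalIntegral.integral_congr_ae ?_
  have hne : ∀ᵐ s : ℝ, s ≠ breakPoint v (m + 1) := Measure.ae_ne volume _
  filter_upwards [hne] with s hs hmem
  rw [Set.uIoc_of_le (breakPoint_lt_succ hv hm').le] at hmem
  exact congrArg F (nextDist_breakPoint hv hm' hmem.1.le (lt_of_le_of_ne hmem.2 hs))

/-- The integrand of `ζ_{n+1}` as a function of the parameter `c` in the exponent. -/
def spacingWeight (c : ℝ) {n : ℕ} (u : Fin (n + 1) → ℝ) : ℝ :=
  (∏ i, F (u i)) * Real.exp (c * ∑ i, ∫ t in (0 : ℝ)..(u i), F t)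

lemma gapWeight_partialSum (c : ℝ) (hv : v ∈ openSimplex n) :
    gapWeight c (Fin.cons 0 fun i => (partialSum v i : UnitAddCircle)) =
      ENNReal.ofReal (spacingWeight c (Fin.cons (1 - ∑ i, v i) v : Fin (n + 1) → ℝ)) := by
  have hlast : breakPoint v (n + 1) - breakPoint v n = 1 - ∑ i, v i := by
    rw [breakPoint_succ_last, breakPoint_last]
  have hnext (i : Fin (n + 1)) :
      nextDist (Fin.cons 0 fun i => (partialSum v i : UnitAddCircle))
        ((Fin.cons 0 (fun i => (partialSum v i : UnitAddCircle)) : Fin (n + 1) → UnitAddCircle) i) =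
      breakPoint v (i + 1) - breakPoint v i := by
    rw [cons_partialSum_eq i]
    exact nextDist_breakPoint hv (by omega) le_rfl (breakPoint_lt_succ hv (by omega))
  rw [gapWeight, meanF_partialSum hv, spacingWeight,
    ENNReal.ofReal_mul (Finset.prod_nonneg fun i _ => F_nonneg _),
    ENNReal.ofReal_prod_of_nonneg fun i _ => F_nonneg _]
  simp_rw [hnext]
  congr 1
  -- The closing gap `1 - ∑ v` comes last on the circle and first in `simplexUniform`; the product,
  -- and the sum below, do not depend on the order.
  · rw [Fin.prod_univ_castSucc, Fin.prod_univ_succ, mul_comm]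
    simp only [Fin.val_castSucc, Fin.val_last, Fin.cons_zero, Fin.cons_succ, hlast,
      breakPoint_succ_sub]
  · congr 3
    rw [← Fin.sum_univ_eq_sum_range
      (fun m => ∫ t in (0 : ℝ)..(breakPoint v (m + 1) - breakPoint v m), F t),
      Fin.sum_univ_castSucc, Fin.sum_univ_succ, add_comm]
    simp only [Fin.val_castSucc, Fin.val_last, Fin.cons_zero, Fin.cons_succ, hlast,
      breakPoint_succ_sub]

end

lemma continuous_integral_F : Continuous fun u : ℝ => ∫ t in (0 : ℝ)..u, F t :=
  intervalIntegral.continuous_primitive intervalIntegrable_F 0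

lemma measurable_spacingWeight (c : ℝ) (n : ℕ) : Measurable (spacingWeight c (n := n)) := by
  refine Measurable.mul (Finset.measurable_fun_prod _ fun i _ =>
    measurable_F.comp (measurable_pi_apply i)) (Real.measurable_exp.comp ?_)
  exact (Finset.measurable_fun_sum _ fun i _ =>
    continuous_integral_F.measurable.comp (measurable_pi_apply i)).const_mul c

/-- The gaps between `n + 1` uniform random points of the circle are uniformly distributed on the
simplex. -/
theorem lintegral_gapWeight (c : ℝ) (n : ℕ) :
    ∫⁻ σ : Fin (n + 1) → UnitAddCircle, gapWeight c σ =
      ∫⁻ u, ENNReal.ofReal (spacingWeight c u) ∂simplexUniform (n + 1) := by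
  have hm : Measurable fun τ : Fin n → UnitAddCircle =>
      gapWeight c (Fin.cons 0 τ : Fin (n + 1) → UnitAddCircle) :=
    (measurable_gapWeight c n).comp (measurable_cons_zero n)
  have hm' : Measurable fun t : Fin n → ℝ =>
      gapWeight c (Fin.cons 0 (fun i => (t i : UnitAddCircle)) : Fin (n + 1) → UnitAddCircle) :=
    hm.comp (measurable_pi_lambda _ fun i => AddCircle.measurable_mk'.comp (measurable_pi_apply i))
  -- The `n!` orderings of the remaining points give the factor `n!` that normalizes the uniform
  -- distribution on the simplex.
  rw [lintegral_gapWeight_eq_cons, ← (measurePreserving_coe_cube n).lintegral_comp hm,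
    setLIntegral_cube hm' fun π t => gapWeight_cons_perm c (fun i => (t i : UnitAddCircle)) π,
    lintegral_simplexUniform n (measurable_spacingWeight c n).ennreal_ofReal]
  congr 1
  exact setLIntegral_congr_fun (measurableSet_openSimplex n) fun v hv => gapWeight_partialSum c hv

/-! ### The Mecke formula for nuclei with uncovered starts or without arcs -/

/-- This form separates the condition on the centre from the condition on the point: a moving disk
becomes the section of a countable union of rectangles, as `lintegral_tupleCount_void` requires. -/
lemma mem_ball_iff_exists_basisBall {c p : Plane} {r : ℝ} : p ∈ Metric.ball c r ↔
    ∃ m, dist (basisCenter m) c + basisRadius m ≤ r ∧ p ∈ basisBall m := by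
  constructor
  · intro hp
    rw [Metric.mem_ball] at hp
    obtain ⟨m, hm, hr⟩ := exists_basisBall p (ε := (r - dist p c) / 2) (by linarith)
    refine ⟨m, ?_, hm⟩
    have h1 : dist p (basisCenter m) < basisRadius m := hm
    have h2 := dist_triangle_left (basisCenter m) c p
    linarith
  · rintro ⟨m, hm, hp⟩
    have h1 : dist p (basisCenter m) < basisRadius m := hp
    have h2 := dist_triangle p (basisCenter m) c
    rw [Metric.mem_ball]
    linarith

lemma mem_punctured_iff_exists_basisBall {x p : Plane} {r : ℝ} : p ∈ punctured r x ↔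
    ∃ m, (dist (basisCenter m) x + basisRadius m ≤ 2 * r ∧ basisRadius m ≤ dist (basisCenter m) x) ∧
      p ∈ basisBall m := by
  constructor
  · rintro ⟨h0, h1⟩
    obtain ⟨m, hm, hr⟩ := exists_basisBall p (ε := min ((2 * r - dist p x) / 2) (dist p x / 2))
      (lt_min (by linarith) (by linarith))
    have h2 : dist p (basisCenter m) < basisRadius m := hm
    have h3 := dist_triangle_left (basisCenter m) x p
    have h4 := dist_triangle p (basisCenter m) x
    have h5 := hr.trans_le (min_le_left _ _)
    have h6 := hr.trans_le (min_le_right _ _)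
    exact ⟨m, ⟨by linarith, by linarith⟩, hm⟩
  · rintro ⟨m, ⟨h1, h2⟩, hp⟩
    have h3 : dist p (basisCenter m) < basisRadius m := hp
    have h4 := dist_triangle p (basisCenter m) x
    have h5 := dist_triangle_left (basisCenter m) x p
    exact ⟨by linarith, by linarith⟩

lemma measurable_toPlane_symm : Measurable toPlane.symm := toPlane.symm.continuous.measurable

lemma continuous_coe_circle : Continuous fun z : Circle => (z : ℂ) := continuous_subtype_val

lemma measurable_circlePoint (r : ℝ) :
    Measurable fun p : Plane × UnitAddCircle => circlePoint r p.1 p.2 := by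
  have h : Continuous fun t : UnitAddCircle => toPlane (r * (AddCircle.toCircle t : ℂ)) :=
    toPlane.continuous.comp (continuous_const.mul
      (continuous_coe_circle.comp AddCircle.continuous_toCircle))
  exact measurable_fst.add (h.measurable.comp measurable_snd)

lemma measurable_touchCenter (r : ℝ) :
    Measurable fun p : Plane × Plane => touchCenter r p.1 p.2 := by
  refine (measurable_circlePoint r).comp (measurable_fst.prodMk ?_)
  exact (measurable_arcStart r).comp
    (measurable_toPlane_symm.comp (measurable_snd.sub measurable_fst))

lemma measurePreserving_toPlane : MeasurePreserving toPlane volume volume :=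
  Complex.orthonormalBasisOneI.measurePreserving_repr

/-- The coordinates of a tuple of points relative to its first point. -/
def relCoord {k : ℕ} (X : Fin (k + 1) → Plane) (i : Fin k) : ℂ := toPlane.symm (X i.succ - X 0)

lemma measurable_relCoord (k : ℕ) : Measurable (relCoord (k := k)) :=
  measurable_pi_lambda _ fun _ => measurable_toPlane_symm.comp
    ((measurable_pi_apply _).sub (measurable_pi_apply _))

lemma lintegral_relCoord {k : ℕ} {B : Set Plane} (hB : MeasurableSet B)
    {Q : (Fin k → ℂ) → ℝ≥0∞} (hQ : Measurable Q) :
    ∫⁻ X in {X : Fin (k + 1) → Plane | X 0 ∈ B}, Q (relCoord X) = volume B * ∫⁻ w, Q w := by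
  have hS : MeasurableSet {X : Fin (k + 1) → Plane | X 0 ∈ B} := measurable_pi_apply 0 hB
  have h := (volume_preserving_piFinSuccAbove (fun _ : Fin (k + 1) => Plane) 0).symm
  have hm : Measurable (Set.indicator {X : Fin (k + 1) → Plane | X 0 ∈ B}
      fun X => Q (relCoord X)) := (hQ.comp (measurable_relCoord k)).indicator hS
  have hm' : Measurable fun z : Plane × (Fin k → Plane) =>
      Set.indicator {X : Fin (k + 1) → Plane | X 0 ∈ B} (fun X => Q (relCoord X))
      ((MeasurableEquiv.piFinSuccAbove (fun _ : Fin (k + 1) => Plane) 0).symm z) :=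
    hm.comp h.measurable
  rw [← lintegral_indicator hS, ← h.lintegral_comp hm, Measure.volume_eq_prod,
    lintegral_prod _ hm'.aemeasurable]
  have hin (x : Plane) : ∫⁻ z : Fin k → Plane,
      Set.indicator {X : Fin (k + 1) → Plane | X 0 ∈ B} (fun X => Q (relCoord X))
      ((MeasurableEquiv.piFinSuccAbove (fun _ : Fin (k + 1) => Plane) 0).symm (x, z)) =
      Set.indicator B (fun _ => ∫⁻ w, Q w) x := by
    have h0 (z : Fin k → Plane) :
        (MeasurableEquiv.piFinSuccAbove (fun _ : Fin (k + 1) => Plane) 0).symm (x, z) =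
        Fin.cons x z := by
      simp [MeasurableEquiv.piFinSuccAbove, Fin.insertNthEquiv]
    simp_rw [h0]
    by_cases hx : x ∈ B
    · rw [Set.indicator_of_mem hx]
      have h1 (z : Fin k → Plane) :
          (Fin.cons x z : Fin (k + 1) → Plane) ∈ {X : Fin (k + 1) → Plane | X 0 ∈ B} := hx
      simp_rw [fun z => Set.indicator_of_mem (h1 z) (fun X => Q (relCoord X))]
      have h2 : MeasurePreserving (fun (w : Fin k → ℂ) i => x + toPlane (w i)) volume volume :=
        volume_preserving_pi fun _ =>
          (measurePreserving_add_left volume x).comp measurePreserving_toPlane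
      have h3 : Measurable fun z : Fin k → Plane =>
          Q (relCoord (Fin.cons x z : Fin (k + 1) → Plane)) := by
        refine hQ.comp (measurable_pi_lambda _ fun i => ?_)
        simp only [relCoord, Fin.cons_succ, Fin.cons_zero]
        exact measurable_toPlane_symm.comp ((measurable_pi_apply i).sub measurable_const)
      rw [← h2.lintegral_comp h3]
      refine lintegral_congr fun w => ?_
      congr 1
      ext i
      simp [relCoord]
    · rw [Set.indicator_of_notMem hx]
      have h1 (z : Fin k → Plane) :
          (Fin.cons x z : Fin (k + 1) → Plane) ∉ {X : Fin (k + 1) → Plane | X 0 ∈ B} := hx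
      simp_rw [fun z => Set.indicator_of_notMem (h1 z) (fun X => Q (relCoord X))]
      simp
  simp_rw [hin]
  rw [lintegral_indicator hB, setLIntegral_const, mul_comm]

lemma arcLenLaw_Ioi {r : ℝ} (hr : 0 < r) {d : ℝ} (hd : 0 < d) :
    arcLenLaw r (Set.Ioi d) = ENNReal.ofReal (4 * Real.pi * r ^ 2 * (1 - F d)) := by
  have h1 : arcLenLaw r (Set.Ioi 1) = 0 := by
    rw [arcLenLaw, Measure.map_apply (measurable_arccos_div r) measurableSet_Ioi]
    have : (fun ρ => Real.arccos (ρ / (2 * r)) / Real.pi) ⁻¹' Set.Ioi 1 = ∅ := by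
      refine Set.eq_empty_iff_forall_notMem.2 fun ρ hρ => ?_
      have h : 1 < Real.arccos (ρ / (2 * r)) / Real.pi := hρ
      rw [lt_div_iff₀ Real.pi_pos, one_mul] at h
      exact h.not_ge (Real.arccos_le_pi _)
    rw [this, measure_empty]
  have huniv : arcLenLaw r Set.univ = ENNReal.ofReal (4 * Real.pi * r ^ 2) := by
    rw [← measure_add_measure_compl (measurableSet_Iic (a := (1 : ℝ))), Set.compl_Iic, h1,
      add_zero, arcLenLaw_Iic hr one_pos, F_one, mul_one]
  have hF := F_nonneg d
  rw [← Set.compl_Iic, measure_compl measurableSet_Iic (measure_ne_top _ _), huniv,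
    arcLenLaw_Iic hr hd, ← ENNReal.ofReal_sub _ (by positivity)]
  ring_nf

/-- The area of a union of disks of radius `r` through a common point. -/
lemma volume_iUnion_ball {r : ℝ} (hr : 0 < r) (x : Plane) {n : ℕ}
    (σ : Fin (n + 1) → UnitAddCircle) :
    volume (⋃ j, Metric.ball (circlePoint r x (σ j)) r) =
      ENNReal.ofReal (4 * Real.pi * r ^ 2 * (1 - meanF σ)) := by
  have hmp : MeasurePreserving (fun w : ℂ => x + toPlane w) volume volume :=
    (measurePreserving_add_left volume x).comp measurePreserving_toPlane
  have hopen : IsOpen (⋃ j, Metric.ball (circlePoint r x (σ j)) r) :=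
    isOpen_iUnion fun _ => Metric.isOpen_ball
  have hnd : Measurable fun s => nextDist σ s :=
    measurable_const.nextDist measurable_id
  have hset : MeasurableSet {p : UnitAddCircle × ℝ | nextDist σ p.1 < p.2} :=
    measurableSet_lt (hnd.comp measurable_fst) measurable_snd
  -- A point lies in the disk about `σ j` when its arc covers `σ j`. So it lies in the union when
  -- its arc is longer than the distance from its start to the next of the `σ j`.
  have hpre : (fun w : ℂ => x + toPlane w) ⁻¹' (⋃ j, Metric.ball (circlePoint r x (σ j)) r) =
      (fun w => (arcStart r w, arcLen r w)) ⁻¹' {p : UnitAddCircle × ℝ | nextDist σ p.1 < p.2} ∩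
        {w | 0 < ‖w‖ ∧ ‖w‖ < 2 * r} := by
    ext w
    have hdist (j : Fin (n + 1)) : dist (x + toPlane w) (circlePoint r x (σ j)) =
        ‖w - r * (AddCircle.toCircle (σ j) : ℂ)‖ := by
      rw [circlePoint, dist_add_left, LinearIsometryEquiv.dist_map, dist_eq_norm]
    have hnorm (j : Fin (n + 1)) : ‖(r : ℂ) * (AddCircle.toCircle (σ j) : ℂ)‖ = r := by
      rw [norm_mul, Circle.norm_coe, mul_one, Complex.norm_real, Real.norm_of_nonneg hr.le]
    have hmem (j : Fin (n + 1)) (h : ‖w - r * (AddCircle.toCircle (σ j) : ℂ)‖ < r) :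
        0 < ‖w‖ ∧ ‖w‖ < 2 * r := by
      have h1 := norm_sub_norm_le w (r * (AddCircle.toCircle (σ j) : ℂ))
      have h2 := norm_sub_norm_le (r * (AddCircle.toCircle (σ j) : ℂ)) w
      rw [norm_sub_rev] at h2
      rw [hnorm] at h1 h2
      exact ⟨by linarith, by linarith⟩
    simp only [Set.mem_preimage, Set.mem_iUnion, Metric.mem_ball, hdist, Set.mem_inter_iff,
      Set.mem_ofPred_eq]
    constructor
    · rintro ⟨j, hj⟩
      have hw := hmem j hj
      rw [norm_sub_toCircle_lt_iff hr (norm_pos_iff.1 hw.1) hw.2] at hj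
      exact ⟨(nextDist_le j).trans_lt hj, hw⟩
    · rintro ⟨h, hw⟩
      rw [← not_le, le_nextDist_iff] at h
      push Not at h
      obtain ⟨j, hj⟩ := h
      exact ⟨j, (norm_sub_toCircle_lt_iff hr (norm_pos_iff.1 hw.1) hw.2 _).2 hj⟩
  have hm : Measurable fun w => (arcStart r w, arcLen r w) :=
    (measurable_arcStart r).prodMk (measurable_arcLen r)
  have hint : Integrable (fun s => F (nextDist σ s)) := integrable_F_comp hnd
  rw [← hmp.measure_preimage hopen.measurableSet.nullMeasurableSet, hpre,
    ← Measure.restrict_apply (hm hset), ← diskMeasure, ← Measure.map_apply hm hset,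
    map_arc_diskMeasure, Measure.prod_apply hset]
  have hsec (s : UnitAddCircle) : arcLenLaw r
      (Prod.mk s ⁻¹' {p : UnitAddCircle × ℝ | nextDist σ p.1 < p.2}) =
      ENNReal.ofReal (4 * Real.pi * r ^ 2 * (1 - F (nextDist σ s))) :=
    arcLenLaw_Ioi hr nextDist_pos
  simp_rw [hsec]
  rw [← ofReal_integral_eq_lintegral_ofReal, integral_const_mul,
    integral_sub (integrable_const _) hint, integral_const, meanF]
  · simp
  · exact ((integrable_const _).sub hint).const_mul _
  · refine Filter.Eventually.of_forall fun s => ?_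
    have := F_le_one (nextDist σ s)
    have h' : 0 ≤ 1 - F (nextDist σ s) := by linarith
    simp only [Pi.zero_apply]
    positivity

/-- The relative coordinates of the tuples of points such that the start of each arc is not covered
by any of the other arcs. -/
def uncoveredStarts (r : ℝ) (k : ℕ) : Set (Fin k → ℂ) :=
  {w | (∀ i, 0 < ‖w i‖ ∧ ‖w i‖ < 2 * r) ∧
    ∀ i j, r ≤ ‖w i - r * (AddCircle.toCircle (arcStart r (w j)) : ℂ)‖}

lemma measurableSet_uncoveredStarts (r : ℝ) (k : ℕ) : MeasurableSet (uncoveredStarts r k) := by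
  have : uncoveredStarts r k = (⋂ i, {w | 0 < ‖w i‖ ∧ ‖w i‖ < 2 * r}) ∩
      ⋂ i, ⋂ j, {w | r ≤ ‖w i - r * (AddCircle.toCircle (arcStart r (w j)) : ℂ)‖} := by
    ext w
    simp [uncoveredStarts]
  rw [this]
  refine (MeasurableSet.iInter fun i => ?_).inter
    (MeasurableSet.iInter fun i => MeasurableSet.iInter fun j => ?_)
  · exact (measurable_pi_apply (X := fun _ : Fin k => ℂ) i) (measurableSet_punctured_disk r)
  · refine measurableSet_le measurable_const (Measurable.norm ?_)
    refine (measurable_pi_apply i).sub (measurable_const.mul ?_)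
    exact (continuous_coe_circle.comp AddCircle.continuous_toCircle).measurable.comp
      ((measurable_arcStart r).comp (measurable_pi_apply j))

/-- No start is covered exactly when each arc is at most as long as the distance from its start to
the next one. Given the starts, the integral over the lengths is a product. The case `i = j` imposes
nothing, a start being at distance exactly `r` from its own point. -/
lemma setLIntegral_uncoveredStarts {r : ℝ} (hr : 0 < r) (n : ℕ)
    {H : (Fin (n + 1) → UnitAddCircle) → ℝ≥0∞} (hH : Measurable H) :
    ∫⁻ w in uncoveredStarts r (n + 1), H (fun i => arcStart r (w i)) =
      ∫⁻ σ, (∏ i, ENNReal.ofReal (4 * Real.pi * r ^ 2 * F (nextDist σ (σ i)))) * H σ := by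
  set E : Set ((Fin (n + 1) → UnitAddCircle) × (Fin (n + 1) → ℝ)) :=
    {p | ∀ i, p.2 i ≤ nextDist p.1 (p.1 i)} with hE
  have hEm : MeasurableSet E := by
    have : E = ⋂ i, {p | p.2 i ≤ nextDist p.1 (p.1 i)} := by ext p; simp [hE]
    rw [this]
    exact MeasurableSet.iInter fun i => measurableSet_le
      ((measurable_pi_apply i).comp measurable_snd)
      (measurable_fst.nextDist ((measurable_pi_apply i).comp measurable_fst))
  have hG : Measurable (E.indicator fun p => H p.1) := (hH.comp measurable_fst).indicator hEm
  have h := lintegral_pi_diskMeasure r hG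
  have hpi : Measure.pi (fun _ : Fin (n + 1) => diskMeasure r) =
      volume.restrict (Set.univ.pi fun _ => {w : ℂ | 0 < ‖w‖ ∧ ‖w‖ < 2 * r}) := by
    rw [volume_pi, Measure.restrict_pi_pi]
    rfl
  have hD : MeasurableSet (Set.univ.pi fun _ : Fin (n + 1) => {w : ℂ | 0 < ‖w‖ ∧ ‖w‖ < 2 * r}) :=
    MeasurableSet.univ_pi fun _ => measurableSet_punctured_disk r
  rw [hpi, ← lintegral_indicator hD] at h
  rw [← lintegral_indicator (measurableSet_uncoveredStarts r _)]
  refine Eq.trans (lintegral_congr fun w => ?_) (h.trans (lintegral_congr fun σ => ?_))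
  · by_cases hw : w ∈ Set.univ.pi fun _ : Fin (n + 1) => {w : ℂ | 0 < ‖w‖ ∧ ‖w‖ < 2 * r}
    · have hw' : ∀ i, 0 < ‖w i‖ ∧ ‖w i‖ < 2 * r := Set.mem_univ_pi.1 hw
      rw [Set.indicator_of_mem hw]
      have hiff : w ∈ uncoveredStarts r (n + 1) ↔
          ((fun i => arcStart r (w i), fun i => arcLen r (w i)) :
            (Fin (n + 1) → UnitAddCircle) × (Fin (n + 1) → ℝ)) ∈ E := by
        simp only [uncoveredStarts, hE, Set.mem_ofPred_eq, le_nextDist_iff]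
        rw [and_iff_right hw']
        refine forall_congr' fun i => forall_congr' fun j => ?_
        rw [← not_lt, norm_sub_toCircle_lt_iff hr (norm_pos_iff.1 (hw' i).1) (hw' i).2, not_lt]
      by_cases h1 : w ∈ uncoveredStarts r (n + 1)
      · rw [Set.indicator_of_mem h1, Set.indicator_of_mem (hiff.1 h1)]
      · rw [Set.indicator_of_notMem h1, Set.indicator_of_notMem (mt hiff.2 h1)]
    · rw [Set.indicator_of_notMem hw, Set.indicator_of_notMem]
      exact fun h1 => hw (Set.mem_univ_pi.2 h1.1)
  · have h1 : ∀ l, E.indicator (fun p => H p.1) (σ, l) =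
        (Set.univ.pi fun i => Set.Iic (nextDist σ (σ i))).indicator (fun _ => H σ) l := by
      intro l
      have hiff : (σ, l) ∈ E ↔ l ∈ Set.univ.pi fun i => Set.Iic (nextDist σ (σ i)) := by
        simp only [hE, Set.mem_ofPred_eq, Set.mem_univ_pi, Set.mem_Iic]
      by_cases h2 : (σ, l) ∈ E
      · rw [Set.indicator_of_mem h2, Set.indicator_of_mem (hiff.1 h2)]
      · rw [Set.indicator_of_notMem h2, Set.indicator_of_notMem (mt hiff.2 h2)]
    simp_rw [h1]
    rw [lintegral_indicator (MeasurableSet.univ_pi fun _ => measurableSet_Iic), setLIntegral_const,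
      Measure.pi_pi, mul_comm]
    simp_rw [arcLenLaw_Iic hr nextDist_pos]

/-- The tuples of distinct points, the first one in `B`, such that the starts of the arcs of the
others about the first point are not covered by the arcs of the tuple. -/
def gapTuples (B : Set Plane) (r : ℝ) (n : ℕ) : Set (Fin (n + 2) → Plane) :=
  {X | X 0 ∈ B ∧ relCoord X ∈ uncoveredStarts r (n + 1)} ∩ {X | Function.Injective X}

/-- The union of the disks which have to be empty if the starts of the arcs are not covered. -/
def gapDisks {k : ℕ} (r : ℝ) (X : Fin (k + 1) → Plane) : Set Plane :=
  ⋃ j : Fin k, Metric.ball (touchCenter r (X 0) (X j.succ)) r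

/-- The tuples such that the `m`-th basic ball is well inside one of the disks. -/
def gapDiskIdx {k : ℕ} (r : ℝ) (m : ℕ) : Set (Fin (k + 1) → Plane) :=
  {X | ∃ j : Fin k, dist (basisCenter m) (touchCenter r (X 0) (X j.succ)) + basisRadius m ≤ r}

lemma gapDisks_eq_rectSection {k : ℕ} (r : ℝ) (X : Fin (k + 1) → Plane) :
    rectSection (gapDiskIdx r) basisBall X = gapDisks r X := by
  ext p
  simp only [rectSection, gapDisks, gapDiskIdx, Set.mem_iUnion, mem_ball_iff_exists_basisBall,
    Set.mem_ofPred_eq]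
  exact ⟨fun ⟨m, ⟨j, hj⟩, hp⟩ => ⟨j, m, hj, hp⟩, fun ⟨j, m, hj, hp⟩ => ⟨m, ⟨j, hj⟩, hp⟩⟩

lemma measurableSet_gapDiskIdx {k : ℕ} (r : ℝ) (m : ℕ) :
    MeasurableSet (gapDiskIdx (k := k) r m) := by
  have : gapDiskIdx (k := k) r m = ⋃ j : Fin k, {X | dist (basisCenter m)
      (touchCenter r (X 0) (X j.succ)) + basisRadius m ≤ r} := by
    ext X
    simp [gapDiskIdx]
  rw [this]
  refine MeasurableSet.iUnion fun j => measurableSet_le (Measurable.add_const ?_ _) measurable_const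
  have h : Measurable fun X : Fin (k + 1) → Plane => (X 0, X j.succ) :=
    (measurable_pi_apply 0).prodMk (measurable_pi_apply j.succ)
  exact measurable_const.dist ((measurable_touchCenter r).comp h)

lemma measurableSet_injective (k : ℕ) :
    MeasurableSet {X : Fin k → Plane | Function.Injective X} := by
  have : {X : Fin k → Plane | Function.Injective X} =
      ⋂ i, ⋂ j, ⋂ (_ : i ≠ j), {X | X i = X j}ᶜ := by
    ext X
    simp only [Set.mem_iInter, Set.mem_compl_iff, Set.mem_ofPred_eq, Function.Injective]
    exact ⟨fun h i j hij he => hij (h he), fun h i j he => by_contra fun hij => h i j hij he⟩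
  rw [this]
  exact MeasurableSet.iInter fun i => MeasurableSet.iInter fun j => MeasurableSet.iInter fun _ =>
    (measurableSet_eq_fun (measurable_pi_apply i) (measurable_pi_apply j)).compl

lemma measurableSet_gapTuples {B : Set Plane} (hB : MeasurableSet B) (r : ℝ) (n : ℕ) :
    MeasurableSet (gapTuples B r n) :=
  ((measurable_pi_apply 0 hB).inter (measurable_relCoord _
    (measurableSet_uncoveredStarts r _))).inter (measurableSet_injective _)

lemma dist_touchCenter {k : ℕ} (r : ℝ) (X : Fin (k + 1) → Plane) (i j : Fin k) :
    dist (X i.succ) (touchCenter r (X 0) (X j.succ)) =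
      ‖relCoord X i - r * (AddCircle.toCircle (arcStart r (relCoord X j)) : ℂ)‖ := by
  rw [← LinearIsometryEquiv.norm_map toPlane, map_sub, relCoord,
    LinearIsometryEquiv.apply_symm_apply, dist_eq_norm, touchCenter, circlePoint,
    sub_add_eq_sub_sub]
  rfl

lemma dist_eq_norm_relCoord {k : ℕ} (X : Fin (k + 1) → Plane) (i : Fin k) :
    dist (X i.succ) (X 0) = ‖relCoord X i‖ := by
  rw [relCoord, LinearIsometryEquiv.norm_map, dist_eq_norm]

/-- The Mecke formula needs the tuple outside the region that is to be empty; the first point lies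
on the boundary of every disk. -/
lemma notMem_gapDisks {B : Set Plane} {r : ℝ} (hr : 0 < r) {n : ℕ} {X : Fin (n + 2) → Plane}
    (hX : X ∈ gapTuples B r n) (i : Fin (n + 2)) : X i ∉ gapDisks r X := by
  simp only [gapDisks, Set.mem_iUnion, Metric.mem_ball, not_exists, not_lt]
  intro j
  refine Fin.cases ?_ (fun i => ?_) i
  · rw [dist_comm, touchCenter, dist_circlePoint hr.le]
  · rw [dist_touchCenter]
    exact hX.1.2.2 i j

lemma volume_gapDisks {r : ℝ} (hr : 0 < r) {n : ℕ} (X : Fin (n + 2) → Plane) :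
    volume (gapDisks r X) = ENNReal.ofReal (4 * Real.pi * r ^ 2 *
      (1 - meanF fun i => arcStart r (relCoord X i))) :=
  volume_iUnion_ball hr (X 0) fun i => arcStart r (relCoord X i)

lemma meanF_le_one {n : ℕ} (σ : Fin (n + 1) → UnitAddCircle) : meanF σ ≤ 1 := by
  have h1 : Measurable fun s => nextDist σ s := measurable_const.nextDist measurable_id
  have := integral_mono (μ := (volume : Measure UnitAddCircle)) (integrable_F_comp h1)
    (integrable_const 1) fun s => F_le_one (nextDist σ s)
  simpa [meanF] using this

lemma exists_bounded_of_gapTuples {B : Set Plane} (hB : Bornology.IsBounded B) (r : ℝ) (n : ℕ) :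
    ∃ W : Set Plane, Bornology.IsBounded W ∧ gapTuples B r n ⊆ Set.univ.pi fun _ => W := by
  refine ⟨Metric.thickening (2 * r) B ∪ B, hB.thickening.union hB, fun X hX => ?_⟩
  rw [Set.mem_univ_pi]
  intro i
  refine Fin.cases (Or.inr hX.1.1) (fun j => Or.inl ?_) i
  refine Metric.mem_thickening_iff.2 ⟨X 0, hX.1.1, ?_⟩
  rw [dist_eq_norm_relCoord]
  exact (hX.1.2.1 j).2

section

variable {Ω : Type*} [MeasurableSpace Ω] {μ : Measure Ω} {lam : ℝ} {Φ : Ω → Set Plane}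

lemma measurable_tupleCount_gap (hΦ : IsPoissonProcess μ lam Φ) {B : Set Plane}
    (hB : MeasurableSet B) (hBb : Bornology.IsBounded B) (r : ℝ) (n : ℕ) :
    Measurable fun ω => tupleCount (Φ ω) (n + 2)
      {X ∈ gapTuples B r n | Φ ω ∩ gapDisks r X = ∅} := by
  obtain ⟨W, hW, hVW⟩ := exists_bounded_of_gapTuples hBb r n
  have := measurable_tupleCount_void (b := basisBall) hΦ (measurableSet_gapTuples hB r n)
    (measurableSet_gapDiskIdx r) measurableSet_basisBall hW hVW
  simpa only [gapDisks_eq_rectSection] using this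

theorem lintegral_tupleCount_gap [IsProbabilityMeasure μ] (hlam : 0 < lam)
    (hΦ : IsPoissonProcess μ lam Φ) {B : Set Plane} (hB : MeasurableSet B)
    (hBb : Bornology.IsBounded B) {r : ℝ} (hr : 0 < r) (n : ℕ) :
    ∫⁻ ω, tupleCount (Φ ω) (n + 2) {X ∈ gapTuples B r n | Φ ω ∩ gapDisks r X = ∅} ∂μ =
      ENNReal.ofReal lam * volume B *
        (ENNReal.ofReal ((4 * Real.pi * lam * r ^ 2) ^ (n + 1) *
          Real.exp (-(4 * Real.pi * lam * r ^ 2))) *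
        ∫⁻ σ : Fin (n + 1) → UnitAddCircle, gapWeight (4 * Real.pi * lam * r ^ 2) σ) := by
  obtain ⟨W, hW, hVW⟩ := exists_bounded_of_gapTuples hBb r n
  have h := lintegral_tupleCount_void (b := basisBall) hlam hΦ (measurableSet_gapTuples hB r n)
    (measurableSet_gapDiskIdx r) measurableSet_basisBall volume_basisBall_ne_top
    (fun X hX => hX.2) (fun X hX i => by
      rw [gapDisks_eq_rectSection]; exact notMem_gapDisks hr hX i)
    (fun X hX => by
      rw [gapDisks_eq_rectSection, volume_gapDisks hr]; exact ENNReal.ofReal_ne_top) hW hVW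
  simp only [gapDisks_eq_rectSection, volume_gapDisks hr] at h
  rw [h]
  set a := 4 * Real.pi * lam * r ^ 2 with ha
  have hpi := Real.pi_pos
  set H : (Fin (n + 1) → UnitAddCircle) → ℝ≥0∞ := fun σ =>
    ENNReal.ofReal (Real.exp (-a)) * ENNReal.ofReal (Real.exp (a * meanF σ)) with hH
  have hHm : Measurable H := ((Real.measurable_exp.comp
    ((measurable_meanF n).const_mul a)).ennreal_ofReal).const_mul _
  have hexp (σ : Fin (n + 1) → UnitAddCircle) : ENNReal.ofReal (Real.exp (-(lam *
      (ENNReal.ofReal (4 * Real.pi * r ^ 2 * (1 - meanF σ))).toReal))) = H σ := by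
    have h1 : 0 ≤ 1 - meanF σ := by linarith [meanF_le_one σ]
    rw [ENNReal.toReal_ofReal (by positivity), hH]
    simp only
    rw [← ENNReal.ofReal_mul (Real.exp_pos _).le, ← Real.exp_add]
    congr 2
    rw [ha]
    ring
  simp_rw [hexp]
  -- Injectivity costs only a null set; without it the region is a product over the first point and
  -- the relative coordinates.
  have hae : (gapTuples B r n : Set _) =ᵐ[volume]
      ({X | X 0 ∈ B} ∩ relCoord ⁻¹' uncoveredStarts r (n + 1) : Set (Fin (n + 2) → Plane)) := by
    filter_upwards [ae_injective_pi (E := Plane) (n + 2)] with X hX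
    exact propext ⟨fun h => h.1, fun h => ⟨h, hX⟩⟩
  have hrel := measurable_relCoord (n + 1) (measurableSet_uncoveredStarts r (n + 1))
  have hQ : Measurable ((uncoveredStarts r (n + 1)).indicator
      fun w => H fun i => arcStart r (w i)) :=
    (hHm.comp (measurable_pi_lambda _ fun i =>
      (measurable_arcStart r).comp (measurable_pi_apply i))).indicator
      (measurableSet_uncoveredStarts r _)
  have hsplit : ∫⁻ X in gapTuples B r n, H (fun i => arcStart r (relCoord X i)) =
      volume B * ∫⁻ w in uncoveredStarts r (n + 1), H fun i => arcStart r (w i) := by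
    rw [setLIntegral_congr hae, ← lintegral_indicator (measurableSet_uncoveredStarts r _),
      ← lintegral_relCoord hB hQ, Set.inter_comm, ← setLIntegral_indicator hrel]
    rfl
  rw [hsplit, setLIntegral_uncoveredStarts hr n hHm]
  have hgap (σ : Fin (n + 1) → UnitAddCircle) :
      (∏ i, ENNReal.ofReal (4 * Real.pi * r ^ 2 * F (nextDist σ (σ i)))) * H σ =
        ENNReal.ofReal ((4 * Real.pi * r ^ 2) ^ (n + 1) * Real.exp (-a)) * gapWeight a σ := by
    have h4 : 0 ≤ 4 * Real.pi * r ^ 2 := by positivity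
    have h6 (i : Fin (n + 1)) : ENNReal.ofReal (4 * Real.pi * r ^ 2 * F (nextDist σ (σ i))) =
        ENNReal.ofReal (4 * Real.pi * r ^ 2) * ENNReal.ofReal (F (nextDist σ (σ i))) :=
      ENNReal.ofReal_mul h4
    simp_rw [h6]
    rw [Finset.prod_mul_distrib, Finset.prod_const, Finset.card_univ, Fintype.card_fin,
      ENNReal.ofReal_mul (pow_nonneg h4 _), ENNReal.ofReal_pow h4, gapWeight, hH]
    ring
  simp_rw [hgap]
  rw [lintegral_const_mul _ (measurable_gapWeight a n), ← mul_assoc (volume B),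
    ← mul_assoc (ENNReal.ofReal lam ^ (n + 2)), ← mul_assoc (ENNReal.ofReal lam * volume B)]
  congr 1
  -- One of the `n + 2` factors `lam` belongs to the nucleus; the others turn `4πr²` into `a`.
  have h5 : a ^ (n + 1) * Real.exp (-a) =
      lam ^ (n + 1) * ((4 * Real.pi * r ^ 2) ^ (n + 1) * Real.exp (-a)) := by
    rw [ha]; ring
  rw [h5, ENNReal.ofReal_mul (pow_nonneg hlam.le _), ENNReal.ofReal_pow hlam.le]
  ring

/-- The tuples such that the `m`-th basic ball is well inside the punctured disk. -/
def puncturedIdx (r : ℝ) (m : ℕ) : Set (Fin 1 → Plane) :=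
  {X | dist (basisCenter m) (X 0) + basisRadius m ≤ 2 * r ∧
    basisRadius m ≤ dist (basisCenter m) (X 0)}

lemma punctured_eq_rectSection (r : ℝ) (X : Fin 1 → Plane) :
    rectSection (puncturedIdx r) basisBall X = punctured r (X 0) := by
  ext p
  rw [mem_punctured_iff_exists_basisBall]
  rfl

lemma measurableSet_puncturedIdx (r : ℝ) (m : ℕ) : MeasurableSet (puncturedIdx r m) := by
  have h : Measurable fun X : Fin 1 → Plane => dist (basisCenter m) (X 0) :=
    measurable_const.dist (measurable_pi_apply 0)
  exact (measurableSet_le (h.add_const _) measurable_const).inter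
    (measurableSet_le measurable_const h)

lemma volume_punctured {r : ℝ} (hr : 0 < r) (x : Plane) :
    volume (punctured r x) = ENNReal.ofReal (4 * Real.pi * r ^ 2) := by
  have h1 : punctured r x = Metric.ball x (2 * r) \ {x} := by
    ext p
    simp only [punctured, Set.mem_ofPred_eq, dist_pos, Set.mem_sdiff, Metric.mem_ball,
      Set.mem_singleton_iff]
    tauto
  rw [h1, measure_sdiff_null (measure_singleton x), EuclideanSpace.volume_ball_fin_two,
    ← ENNReal.ofReal_pow (by positivity),
    ← ENNReal.ofReal_mul (by positivity)]
  congr 1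
  ring

lemma measurableSet_firstIn {B : Set Plane} (hB : MeasurableSet B) :
    MeasurableSet {X : Fin 1 → Plane | X 0 ∈ B} := measurable_pi_apply 0 hB

lemma measurable_tupleCount_isolated (hΦ : IsPoissonProcess μ lam Φ) {B : Set Plane}
    (hB : MeasurableSet B) (hBb : Bornology.IsBounded B) (r : ℝ) :
    Measurable fun ω => tupleCount (Φ ω) 1
      {X ∈ {X | X 0 ∈ B} | Φ ω ∩ punctured r (X 0) = ∅} := by
  have := measurable_tupleCount_void (b := basisBall) hΦ (measurableSet_firstIn hB)
    (measurableSet_puncturedIdx r) measurableSet_basisBall hBb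
    (fun X hX => Set.mem_univ_pi.2 fun i => by rw [Subsingleton.elim i 0]; exact hX)
  simpa only [punctured_eq_rectSection] using this

/-- The nuclei without arcs. The disk is punctured because the nucleus must not lie in the region
that is to be empty. -/
theorem lintegral_tupleCount_isolated [IsProbabilityMeasure μ] (hlam : 0 < lam)
    (hΦ : IsPoissonProcess μ lam Φ) {B : Set Plane} (hB : MeasurableSet B)
    (hBb : Bornology.IsBounded B) {r : ℝ} (hr : 0 < r) :
    ∫⁻ ω, tupleCount (Φ ω) 1 {X ∈ {X | X 0 ∈ B} | Φ ω ∩ punctured r (X 0) = ∅} ∂μ =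
      ENNReal.ofReal lam * volume B *
        ENNReal.ofReal (Real.exp (-(4 * Real.pi * lam * r ^ 2))) := by
  have h := lintegral_tupleCount_void (b := basisBall) hlam hΦ (measurableSet_firstIn hB)
    (measurableSet_puncturedIdx r) measurableSet_basisBall volume_basisBall_ne_top
    (fun X _ => Function.injective_of_subsingleton X)
    (fun X _ i => by
      rw [punctured_eq_rectSection, Subsingleton.elim i 0]
      exact fun h => by simp [punctured] at h)
    (fun X _ => by
      rw [punctured_eq_rectSection, volume_punctured hr]; exact ENNReal.ofReal_ne_top) hBb
    (fun X hX => Set.mem_univ_pi.2 fun i => by rw [Subsingleton.elim i 0]; exact hX)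
  simp only [punctured_eq_rectSection, volume_punctured hr] at h
  have hpi := Real.pi_pos
  have hvol : volume {X : Fin 1 → Plane | X 0 ∈ B} = volume B :=
    (volume_preserving_funUnique (Fin 1) Plane).measure_preimage hB.nullMeasurableSet
  rw [h, setLIntegral_const, hvol, pow_one, ENNReal.toReal_ofReal (by positivity)]
  have : lam * (4 * Real.pi * r ^ 2) = 4 * Real.pi * lam * r ^ 2 := by ring
  rw [this]
  ring

end

/-! ### Inclusion–exclusion for the uncovered starts -/

lemma encard_injective_tuples {E : Type*} {G : Set E} (hG : G.Finite) (k : ℕ) :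
    {z : Fin k → E | Function.Injective z ∧ ∀ i, z i ∈ G}.encard = (G.ncard.descFactorial k : ℕ) := by
  classical
  have := hG.fintype
  have h1 : {z : Fin k → E | Function.Injective z ∧ ∀ i, z i ∈ G} =
      (fun (e : Fin k ↪ G) i => (e i : E)) '' Set.univ := by
    ext z
    simp only [Set.mem_ofPred_eq, Set.image_univ, Set.mem_range]
    constructor
    · rintro ⟨hz, hzG⟩
      exact ⟨⟨fun i => ⟨z i, hzG i⟩, fun i j hij => hz (congrArg Subtype.val hij)⟩, rfl⟩
    · rintro ⟨e, rfl⟩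
      exact ⟨fun i j hij => e.injective (Subtype.ext hij), fun i => (e i).2⟩
  have hinj : Function.Injective fun (e : Fin k ↪ G) i => (e i : E) := by
    intro e e' h
    ext i
    exact congrFun h i
  rw [h1, hinj.encard_image, Set.encard_univ, ENat.card_eq_coe_fintype_card,
    Fintype.card_embedding_eq, Fintype.card_fin, ← Nat.card_eq_fintype_card, Nat.card_coe_set_eq]

section counts

variable {S : Set Plane} (hS : ∀ K : Set Plane, Bornology.IsBounded K → (S ∩ K).Finite)
include hS

lemma finite_gapPoints (r : ℝ) (x : Plane) : (gapPoints S r x).Finite :=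
  (hS (Metric.ball x (2 * r)) Metric.isBounded_ball).subset fun _ hz => ⟨hz.1, hz.2.1.2⟩

/-- A counted tuple is a nucleus followed by distinct gap points. Conversely, gap points leave each
other's starts uncovered, since each of them is a point of `S` and so lies outside the empty disks.
-/
lemma tupleCount_gap_eq_sum {B : Set Plane} (hB : Bornology.IsBounded B) (r : ℝ)
    (n : ℕ) : tupleCount S (n + 2) {X ∈ gapTuples B r n | S ∩ gapDisks r X = ∅} =
      ∑ x ∈ (hS B hB).toFinset, (((gapPoints S r x).ncard.descFactorial (n + 1) : ℕ) : ℝ≥0∞) := by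
  have hSc := countable_of_locallyFinite hS
  set fib : Plane → Set (Fin (n + 2) → Plane) := fun x => (fun z : Fin (n + 1) → Plane =>
    (Fin.cons x z : Fin (n + 2) → Plane)) '' {z | Function.Injective z ∧ ∀ i, z i ∈ gapPoints S r x}
    with hfib
  have hcons (x : Plane) : Function.Injective fun z : Fin (n + 1) → Plane =>
      (Fin.cons x z : Fin (n + 2) → Plane) := Fin.cons_right_injective (α := fun _ => Plane) x
  have hfin (x : Plane) : (fib x).Finite := by
    refine Set.Finite.image _ (Set.finite_of_encard_eq_coe
      (encard_injective_tuples (finite_gapPoints hS r x) (n + 1)))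
  have hset : {X ∈ gapTuples B r n | S ∩ gapDisks r X = ∅} ∩ tupleSet S (n + 2) =
      ⋃ x ∈ (hS B hB).toFinset, fib x := by
    ext X
    simp only [Set.mem_iUnion, Set.Finite.mem_toFinset, exists_prop, hfib, Set.mem_image,
      Set.mem_ofPred_eq, Set.mem_inter_iff]
    constructor
    · rintro ⟨⟨hX, hvoid⟩, hinj, hXS⟩
      refine ⟨X 0, ⟨hXS 0, hX.1.1⟩, Fin.tail X, ⟨hinj.comp (Fin.succ_injective _), fun i => ?_⟩,
        Fin.cons_self_tail X⟩
      have hp := hX.1.2.1 i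
      rw [← dist_eq_norm_relCoord] at hp
      refine ⟨hXS _, hp, Set.subset_empty_iff.1 (hvoid ▸ Set.inter_subset_inter_right S ?_)⟩
      exact Set.subset_iUnion (fun j : Fin (n + 1) => Metric.ball (touchCenter r (X 0) (X j.succ)) r)
        i
    · rintro ⟨x, ⟨hxS, hxB⟩, z, ⟨hz, hzG⟩, rfl⟩
      have hXinj : Function.Injective (Fin.cons x z : Fin (n + 2) → Plane) := by
        rw [Fin.cons_injective_iff]
        refine ⟨?_, hz⟩
        rintro ⟨i, hi⟩
        have := (hzG i).2.1.1
        rw [hi, dist_self] at this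
        exact this.false
      have hXS : ∀ i, (Fin.cons x z : Fin (n + 2) → Plane) i ∈ S :=
        fun i => Fin.cases hxS (fun i => (hzG i).1) i
      refine ⟨⟨⟨⟨hxB, fun i => ?_, fun i j => ?_⟩, hXinj⟩, ?_⟩, hXinj, hXS⟩
      · rw [← dist_eq_norm_relCoord]
        exact (hzG i).2.1
      · rw [← dist_touchCenter, ← not_lt]
        intro hlt
        have h1 : (Fin.cons x z : Fin (n + 2) → Plane) i.succ ∈
            S ∩ Metric.ball (touchCenter r x (z j)) r := ⟨hXS _, hlt⟩
        rw [(hzG j).2.2] at h1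
        exact h1
      · rw [gapDisks, Set.inter_iUnion, Set.iUnion_eq_empty]
        exact fun j => (hzG j).2.2
  rw [tupleCount_apply hSc, hset, ← Measure.count_apply, measure_biUnion_finset]
  · refine Finset.sum_congr rfl fun x _ => ?_
    rw [Measure.count_apply (hfin x).measurableSet, (hcons x).encard_image,
      encard_injective_tuples (finite_gapPoints hS r x)]
    simp
  · intro x _ y _ hxy
    refine Set.disjoint_left.2 ?_
    rintro _ ⟨z, _, rfl⟩ ⟨w, _, hw⟩
    have := congrFun hw 0
    simp only [Fin.cons_zero] at this
    exact hxy this.symm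
  · exact fun x _ => (hfin x).measurableSet
  · exact Finset.measurableSet_biUnion _ fun x _ => (hfin x).measurableSet

lemma tupleCount_isolated_eq {B : Set Plane} {r : ℝ} :
    tupleCount S 1 {X ∈ {X | X 0 ∈ B} | S ∩ punctured r (X 0) = ∅} =
      ({x ∈ S ∩ B | S ∩ punctured r x = ∅}.encard : ℝ≥0∞) := by
  rw [tupleCount_apply (countable_of_locallyFinite hS)]
  have hset : {X ∈ {X : Fin 1 → Plane | X 0 ∈ B} | S ∩ punctured r (X 0) = ∅} ∩ tupleSet S 1 =
      (Equiv.funUnique (Fin 1) Plane).symm '' {x ∈ S ∩ B | S ∩ punctured r x = ∅} := by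
    ext X
    rw [Equiv.image_symm_eq_preimage]
    simp only [tupleSet, Set.mem_inter_iff, Set.mem_ofPred_eq, Set.mem_preimage,
      Equiv.funUnique_apply, Fin.forall_fin_one]
    have h : Function.Injective X := Function.injective_of_subsingleton X
    exact ⟨fun ⟨⟨h1, h2⟩, _, h3⟩ => ⟨⟨h3, h1⟩, h2⟩, fun ⟨⟨h3, h1⟩, h2⟩ => ⟨⟨h1, h2⟩, h, h3⟩⟩
  rw [hset, (Equiv.injective _).encard_image]

end counts

/-- The quotients are binomial coefficients, so this is the expansion of `1 - (1 - 1)^N`; the terms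
vanish from `n = N` on. -/
lemma hasSum_inclusion_exclusion (N : ℕ) :
    HasSum (fun n : ℕ => (-1 : ℝ) ^ n / (n + 1).factorial * (N.descFactorial (n + 1) : ℕ))
      (if N = 0 then 0 else 1) := by
  have h1 (n : ℕ) : (-1 : ℝ) ^ n / (n + 1).factorial * (N.descFactorial (n + 1) : ℕ) =
      (-1) ^ n * (N.choose (n + 1) : ℕ) := by
    rw [Nat.descFactorial_eq_factorial_mul_choose, Nat.cast_mul]
    have : ((n + 1).factorial : ℝ) ≠ 0 := Nat.cast_ne_zero.2 (Nat.factorial_ne_zero _)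
    field_simp
  simp_rw [h1]
  have h2 : ∑ n ∈ Finset.range N, (-1 : ℝ) ^ n * (N.choose (n + 1) : ℕ) =
      if N = 0 then 0 else 1 := by
    have h3 := Int.alternating_sum_range_choose (n := N)
    rw [Finset.sum_range_succ'] at h3
    have h4 : (∑ n ∈ Finset.range N, (-1 : ℝ) ^ (n + 1) * (N.choose (n + 1) : ℕ)) + 1 =
        if N = 0 then 1 else 0 := by
      have := congrArg (Int.cast (R := ℝ)) h3
      push_cast at this
      simpa using this
    have h5 : ∑ n ∈ Finset.range N, (-1 : ℝ) ^ n * (N.choose (n + 1) : ℕ) =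
        -∑ n ∈ Finset.range N, (-1 : ℝ) ^ (n + 1) * (N.choose (n + 1) : ℕ) := by
      rw [← Finset.sum_neg_distrib]
      exact Finset.sum_congr rfl fun n _ => by rw [pow_succ]; ring
    rw [h5]
    split_ifs at h4 ⊢ <;> linarith
  rw [← h2]
  refine hasSum_sum_of_ne_finset_zero fun n hn => ?_
  rw [Finset.mem_range, not_lt] at hn
  rw [Nat.choose_eq_zero_of_lt (by omega)]
  simp

section counts

variable {S : Set Plane} (hS : ∀ K : Set Plane, Bornology.IsBounded K → (S ∩ K).Finite)
include hS

lemma encard_uncovered_eq {B : Set Plane} (hB : Bornology.IsBounded B) {r : ℝ} (hr : 0 < r) :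
    ({x ∈ S ∩ B | Uncovered S x r}.encard : ℝ≥0∞) =
      ({x ∈ S ∩ B | S ∩ punctured r x = ∅}.encard : ℝ≥0∞) +
      ∑ x ∈ (hS B hB).toFinset, if (gapPoints S r x).ncard = 0 then (0 : ℝ≥0∞) else 1 := by
  classical
  have hdisj : Disjoint {x ∈ S ∩ B | S ∩ punctured r x = ∅}
      {x ∈ S ∩ B | (gapPoints S r x).Nonempty} := by
    refine Set.disjoint_left.2 ?_
    rintro x ⟨_, h⟩ ⟨_, z, hz⟩
    have : z ∈ S ∩ punctured r x := ⟨hz.1, hz.2.1⟩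
    rw [h] at this
    exact this
  have hun : {x ∈ S ∩ B | Uncovered S x r} = {x ∈ S ∩ B | S ∩ punctured r x = ∅} ∪
      {x ∈ S ∩ B | (gapPoints S r x).Nonempty} := by
    ext x
    simp only [Set.mem_ofPred_eq, Set.mem_union, uncovered_iff hS hr]
    tauto
  rw [hun, Set.encard_union_eq hdisj, ENat.toENNReal_add]
  congr 1
  have h1 : {x ∈ S ∩ B | (gapPoints S r x).Nonempty} =
      ((hS B hB).toFinset.filter fun x => (gapPoints S r x).ncard ≠ 0 : Finset Plane) := by
    ext x
    simp [Set.ncard_eq_zero (finite_gapPoints hS r x), Set.nonempty_iff_ne_empty]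
  rw [h1, Set.encard_coe_eq_coe_finsetCard, Finset.card_filter]
  refine (ENat.toENNReal_coe _).trans ?_
  rw [Nat.cast_sum]
  refine Finset.sum_congr rfl fun x _ => ?_
  by_cases h : (gapPoints S r x).ncard = 0 <;> simp [h]

/-- The first Bonferroni bound, `1(N > 0) ≤ N`. It yields the decay of the survival function at
infinity, which the alternating series does not show. -/
lemma encard_uncovered_le {B : Set Plane} (hB : Bornology.IsBounded B) {r : ℝ} (hr : 0 < r) :
    ({x ∈ S ∩ B | Uncovered S x r}.encard : ℝ≥0∞) ≤
      tupleCount S 1 {X ∈ {X | X 0 ∈ B} | S ∩ punctured r (X 0) = ∅} +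
      tupleCount S 2 {X ∈ gapTuples B r 0 | S ∩ gapDisks r X = ∅} := by
  rw [encard_uncovered_eq hS hB hr, tupleCount_isolated_eq hS, tupleCount_gap_eq_sum hS hB r]
  gcongr with x _
  split_ifs with h
  · exact zero_le
  · rw [Nat.descFactorial_one]
    exact_mod_cast Nat.one_le_iff_ne_zero.2 h

lemma hasSum_uncovered {B : Set Plane} (hB : Bornology.IsBounded B) {r : ℝ} (hr : 0 < r) :
    HasSum (fun n : ℕ => (-1 : ℝ) ^ n / (n + 1).factorial *
      (tupleCount S (n + 2) {X ∈ gapTuples B r n | S ∩ gapDisks r X = ∅}).toReal)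
      (({x ∈ S ∩ B | Uncovered S x r}.encard : ℝ≥0∞).toReal -
        (tupleCount S 1 {X ∈ {X | X 0 ∈ B} | S ∩ punctured r (X 0) = ∅}).toReal) := by
  have hfin : ({x ∈ S ∩ B | S ∩ punctured r x = ∅}.encard : ℝ≥0∞) ≠ ∞ := by
    have : {x ∈ S ∩ B | S ∩ punctured r x = ∅}.Finite := (hS B hB).subset fun x hx => hx.1
    simpa using this
  rw [encard_uncovered_eq hS hB hr, tupleCount_isolated_eq hS, ENNReal.toReal_add hfin,
    add_sub_cancel_left, ENNReal.toReal_sum]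
  · simp_rw [tupleCount_gap_eq_sum hS hB r]
    have h (n : ℕ) : (-1 : ℝ) ^ n / (n + 1).factorial *
        (∑ x ∈ (hS B hB).toFinset,
          (((gapPoints S r x).ncard.descFactorial (n + 1) : ℕ) : ℝ≥0∞)).toReal =
        ∑ x ∈ (hS B hB).toFinset, (-1 : ℝ) ^ n / (n + 1).factorial *
          ((gapPoints S r x).ncard.descFactorial (n + 1) : ℕ) := by
      rw [ENNReal.toReal_sum fun _ _ => ENNReal.natCast_ne_top _, Finset.mul_sum]
      simp only [ENNReal.toReal_natCast]
    simp_rw [h]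
    refine hasSum_sum fun x _ => ?_
    convert hasSum_inclusion_exclusion (gapPoints S r x).ncard using 1
    split_ifs <;> simp
  · intro x _
    split_ifs <;> simp
  · refine (ENNReal.sum_lt_top.2 fun x _ => ?_).ne
    split_ifs <;> simp

end counts

/-! ### Analysis of `ζ_k` and of the series -/

instance isProbabilityMeasure_simplexUniform (n : ℕ) :
    IsProbabilityMeasure (simplexUniform (n + 1)) := by
  refine ⟨?_⟩
  have h := lintegral_simplexUniform n (f := fun _ => 1) measurable_const
  rwa [lintegral_one, setLIntegral_one, factorial_mul_volume_openSimplex] at h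

lemma ae_mem_simplex (n : ℕ) :
    ∀ᵐ u ∂simplexUniform (n + 1), (∀ i, 0 ≤ u i) ∧ ∑ i, u i = 1 := by
  have hms : MeasurableSet {u : Fin (n + 1) → ℝ | (∀ i, 0 ≤ u i) ∧ ∑ i, u i = 1} := by
    have : {u : Fin (n + 1) → ℝ | (∀ i, 0 ≤ u i) ∧ ∑ i, u i = 1} =
        (⋂ i, {u | 0 ≤ u i}) ∩ {u | ∑ i, u i = 1} := by
      ext u
      simp
    rw [this]
    exact (MeasurableSet.iInter fun i =>
      measurableSet_le measurable_const (measurable_pi_apply i)).inter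
      (measurableSet_eq_fun (Finset.measurable_fun_sum _ fun i _ => measurable_pi_apply i)
        measurable_const)
  rw [simplexUniform_succ, ae_map_iff (measurable_cons_one_sub n).aemeasurable hms]
  refine Measure.ae_smul_measure ?_ _
  filter_upwards [ae_restrict_mem (measurableSet_openSimplex n)] with v hv
  refine ⟨fun i => ?_, ?_⟩
  · refine Fin.cases ?_ (fun j => ?_) i
    · simpa using hv.2.le
    · simpa using (hv.1 j).le
  · rw [Fin.sum_univ_succ]
    simp

lemma integral_F_nonneg {u : ℝ} (hu : 0 ≤ u) : 0 ≤ ∫ t in (0 : ℝ)..u, F t :=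
  intervalIntegral.integral_nonneg hu fun t _ => F_nonneg t

lemma integral_F_le {a b : ℝ} (hab : a ≤ b) : ∫ t in a..b, F t ≤ b - a := by
  have h := intervalIntegral.integral_mono_on hab (intervalIntegrable_F a b)
    (intervalIntegrable_const (c := (1 : ℝ))) fun t _ => F_le_one t
  simpa using h

/-- `F ≤ 1/2` on `[0, 1/4]` and `F ≤ 1` on the rest. Any bound below 1 would make the first
Bonferroni bound decay. -/
lemma integral_F_zero_one_le : ∫ t in (0 : ℝ)..1, F t ≤ 7 / 8 := by
  rw [← intervalIntegral.integral_add_adjacent_intervals (intervalIntegrable_F 0 (1 / 4))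
    (intervalIntegrable_F (1 / 4) 1)]
  have h1 := integral_F_le (a := 1 / 4) (b := 1) (by norm_num)
  have h2 : ∫ t in (0 : ℝ)..(1 / 4), F t ≤ 1 / 8 := by
    have h := intervalIntegral.integral_mono_on (a := 0) (b := 1 / 4) (by norm_num)
      (intervalIntegrable_F 0 (1 / 4)) (intervalIntegrable_const (c := (1 / 2 : ℝ))) fun t ht => ?_
    · refine h.trans_eq ?_
      rw [intervalIntegral.integral_const]
      norm_num
    · rw [F_eq_sin_sq ht.1, min_eq_left (by linarith [ht.2]), Real.sin_sq_eq_half_sub]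
      have : 0 ≤ Real.cos (2 * (Real.pi * t)) := Real.cos_nonneg_of_mem_Icc
        ⟨by nlinarith [Real.pi_pos, ht.1], by nlinarith [Real.pi_pos, ht.2]⟩
      linarith
  linarith

/-- The sum of the primitives of `F` at the coordinates. -/
def spacingMean {n : ℕ} (u : Fin (n + 1) → ℝ) : ℝ := ∑ i, ∫ t in (0 : ℝ)..(u i), F t

lemma measurable_spacingMean (n : ℕ) : Measurable (spacingMean (n := n)) :=
  Finset.measurable_fun_sum _ fun i _ =>
    continuous_integral_F.measurable.comp (measurable_pi_apply i)

/-- `0 ≤ F ≤ 1` and the coordinates sum to 1. Hence the bounds by `e^|c|`, uniform in `n`, behind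
all convergence statements for the series. -/
lemma spacingMean_mem {n : ℕ} {u : Fin (n + 1) → ℝ} (hu : (∀ i, 0 ≤ u i) ∧ ∑ i, u i = 1) :
    spacingMean u ∈ Set.Icc (0 : ℝ) 1 := by
  refine ⟨Finset.sum_nonneg fun i _ => integral_F_nonneg (hu.1 i), ?_⟩
  rw [← hu.2]
  exact Finset.sum_le_sum fun i _ => (integral_F_le (hu.1 i)).trans_eq (sub_zero _)

lemma prod_F_mem {n : ℕ} (u : Fin n → ℝ) : ∏ i, F (u i) ∈ Set.Icc (0 : ℝ) 1 :=
  ⟨Finset.prod_nonneg fun _ _ => F_nonneg _,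
    Finset.prod_le_one (fun _ _ => F_nonneg _) fun _ _ => F_le_one _⟩

lemma spacingWeight_nonneg (c : ℝ) {n : ℕ} (u : Fin (n + 1) → ℝ) : 0 ≤ spacingWeight c u :=
  mul_nonneg (prod_F_mem u).1 (Real.exp_pos _).le

lemma spacingWeight_le {c C : ℝ} (hc : |c| ≤ C) {n : ℕ} {u : Fin (n + 1) → ℝ}
    (hu : (∀ i, 0 ≤ u i) ∧ ∑ i, u i = 1) : spacingWeight c u ≤ Real.exp C := by
  refine (mul_le_of_le_one_left (Real.exp_pos _).le (prod_F_mem u).2).trans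
    (Real.exp_le_exp.2 ?_)
  have h := spacingMean_mem hu
  change c * spacingMean u ≤ C
  calc c * spacingMean u ≤ |c| * spacingMean u := mul_le_mul_of_nonneg_right (le_abs_self c) h.1
    _ ≤ |c| * 1 := mul_le_mul_of_nonneg_left h.2 (abs_nonneg c)
    _ ≤ C := by linarith

lemma integrable_spacingWeight (c : ℝ) (n : ℕ) :
    Integrable (spacingWeight c (n := n)) (simplexUniform (n + 1)) := by
  refine Integrable.of_bound (measurable_spacingWeight c n).aestronglyMeasurable (Real.exp |c|) ?_
  filter_upwards [ae_mem_simplex n] with u hu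
  rw [Real.norm_of_nonneg (spacingWeight_nonneg c u)]
  exact spacingWeight_le le_rfl hu

/-- `ζ_{n+1}` as a function of the parameter `c = 4πλr²`. -/
def spacingZeta (n : ℕ) (c : ℝ) : ℝ := ∫ u, spacingWeight c u ∂simplexUniform (n + 1)

/-- The derivative of `spacingZeta`. -/
def spacingZetaDeriv (n : ℕ) (c : ℝ) : ℝ :=
  ∫ u, spacingMean u * spacingWeight c u ∂simplexUniform (n + 1)

lemma spacingMean_mul_spacingWeight_mem {c C : ℝ} (hc : |c| ≤ C) {n : ℕ} {u : Fin (n + 1) → ℝ}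
    (hu : (∀ i, 0 ≤ u i) ∧ ∑ i, u i = 1) :
    spacingMean u * spacingWeight c u ∈ Set.Icc 0 (Real.exp C) := by
  have h := spacingMean_mem hu
  exact ⟨mul_nonneg h.1 (spacingWeight_nonneg c u),
    (mul_le_of_le_one_left (spacingWeight_nonneg c u) h.2).trans (spacingWeight_le hc hu)⟩

lemma hasDerivAt_spacingZeta (n : ℕ) (c : ℝ) :
    HasDerivAt (spacingZeta n) (spacingZetaDeriv n c) c := by
  refine (hasDerivAt_integral_of_dominated_loc_of_deriv_le (μ := simplexUniform (n + 1))
    (F := fun c u => spacingWeight c u) (F' := fun c u => spacingMean u * spacingWeight c u)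
    (bound := fun _ => Real.exp (|c| + 1)) (Metric.ball_mem_nhds c one_pos)
    (Filter.Eventually.of_forall fun c => (measurable_spacingWeight c n).aestronglyMeasurable)
    (integrable_spacingWeight c n)
    ((measurable_spacingMean n).mul (measurable_spacingWeight c n)).aestronglyMeasurable ?_
    (integrable_const _) ?_).2
  · filter_upwards [ae_mem_simplex n] with u hu d hd
    have hd' : |d| ≤ |c| + 1 := by
      rw [Metric.mem_ball, Real.dist_eq] at hd
      have := abs_add_le (d - c) c
      rw [sub_add_cancel] at this
      linarith
    have h := spacingMean_mul_spacingWeight_mem hd' hu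
    rw [Real.norm_of_nonneg h.1]
    exact h.2
  · refine Filter.Eventually.of_forall fun u d _ => ?_
    have h1 : HasDerivAt (fun c : ℝ => c * spacingMean u) (spacingMean u) d := by
      simpa using (hasDerivAt_id d).mul_const (spacingMean u)
    have h2 := h1.exp.const_mul (∏ i, F (u i))
    refine h2.congr_deriv ?_
    rw [spacingWeight, spacingMean]
    ring

lemma spacingZeta_mem {c C : ℝ} (hc : |c| ≤ C) (n : ℕ) :
    spacingZeta n c ∈ Set.Icc 0 (Real.exp C) := by
  refine ⟨integral_nonneg fun u => spacingWeight_nonneg c u, ?_⟩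
  have h := integral_mono_ae (μ := simplexUniform (n + 1)) (integrable_spacingWeight c n)
    (integrable_const (Real.exp C)) (by
      filter_upwards [ae_mem_simplex n] with u hu using spacingWeight_le hc hu)
  simpa [spacingZeta] using h

lemma spacingZetaDeriv_mem {c C : ℝ} (hc : |c| ≤ C) (n : ℕ) :
    spacingZetaDeriv n c ∈ Set.Icc 0 (Real.exp C) := by
  refine ⟨integral_nonneg_of_ae ?_, ?_⟩
  · filter_upwards [ae_mem_simplex n] with u hu
    exact (spacingMean_mul_spacingWeight_mem hc hu).1
  have h := norm_integral_le_of_norm_le_const (μ := simplexUniform (n + 1))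
    (f := fun u => spacingMean u * spacingWeight c u) (C := Real.exp C) (by
      filter_upwards [ae_mem_simplex n] with u hu
      have h := spacingMean_mul_spacingWeight_mem hc hu
      rw [Real.norm_of_nonneg h.1]
      exact h.2)
  refine (le_abs_self _).trans (h.trans_eq ?_)
  simp

lemma ofReal_spacingZeta (n : ℕ) (c : ℝ) :
    ENNReal.ofReal (spacingZeta n c) = ∫⁻ σ : Fin (n + 1) → UnitAddCircle, gapWeight c σ := by
  rw [lintegral_gapWeight, spacingZeta, ofReal_integral_eq_lintegral_ofReal
    (integrable_spacingWeight c n) (Filter.Eventually.of_forall fun u => spacingWeight_nonneg c u)]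

lemma spacingZeta_zero_le {c : ℝ} (hc : 0 ≤ c) : spacingZeta 0 c ≤ Real.exp (7 / 8 * c) := by
  have h := integral_mono_ae (μ := simplexUniform 1) (integrable_spacingWeight c 0)
    (integrable_const (Real.exp (7 / 8 * c))) (by
      filter_upwards [ae_mem_simplex 0] with u hu
      refine (mul_le_of_le_one_left (Real.exp_pos _).le (prod_F_mem u).2).trans
        (Real.exp_le_exp.2 ?_)
      have h0 : u 0 = 1 := by simpa using hu.2
      simp only [Fin.sum_univ_succ, Finset.univ_eq_empty, Finset.sum_empty, add_zero, h0]
      rw [mul_comm]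
      exact mul_le_mul_of_nonneg_right integral_F_zero_one_le hc)
  simpa [spacingZeta] using h

/-- The `n`-th term of the inclusion-exclusion series, up to the factor `e^{-c}`. -/
def coverTerm (n : ℕ) (c : ℝ) : ℝ := (-c) ^ (n + 1) / (n + 1).factorial * spacingZeta n c

/-- The derivative of `coverTerm`. -/
def coverTermDeriv (n : ℕ) (c : ℝ) : ℝ :=
  (-c) ^ (n + 1) / (n + 1).factorial * spacingZetaDeriv n c -
    (-c) ^ n / n.factorial * spacingZeta n c

lemma hasDerivAt_coverTerm (n : ℕ) (c : ℝ) :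
    HasDerivAt (coverTerm n) (coverTermDeriv n c) c := by
  have h := (((hasDerivAt_id c).neg.pow (n + 1)).div_const ((n + 1).factorial : ℝ)).mul
    (hasDerivAt_spacingZeta n c)
  refine h.congr_deriv ?_
  simp only [coverTermDeriv, id, Nat.factorial_succ, Nat.cast_mul, Nat.add_sub_cancel, Pi.neg_apply,
    Pi.pow_apply]
  have h1 : ((n + 1 : ℕ) : ℝ) ≠ 0 := by positivity
  have h2 : (n.factorial : ℝ) ≠ 0 := by positivity
  field_simp
  ring

lemma abs_neg_pow_div_le {c C : ℝ} (hc : |c| ≤ C) (n : ℕ) :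
    |(-c) ^ n / n.factorial| ≤ C ^ n / n.factorial := by
  rw [abs_div, abs_pow, abs_neg, Nat.abs_cast]
  gcongr

lemma abs_coverTerm_le {c C : ℝ} (hc : |c| ≤ C) (n : ℕ) :
    |coverTerm n c| ≤ C ^ (n + 1) / (n + 1).factorial * Real.exp C := by
  have h := spacingZeta_mem hc n
  rw [coverTerm, abs_mul, abs_of_nonneg h.1]
  exact mul_le_mul (abs_neg_pow_div_le hc _) h.2 h.1
    (div_nonneg (pow_nonneg ((abs_nonneg c).trans hc) _) (Nat.cast_nonneg _))

lemma abs_coverTermDeriv_le {c C : ℝ} (hc : |c| ≤ C) (n : ℕ) :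
    |coverTermDeriv n c| ≤
      C ^ (n + 1) / (n + 1).factorial * Real.exp C + C ^ n / n.factorial * Real.exp C := by
  have h := spacingZeta_mem hc n
  have h' := spacingZetaDeriv_mem hc n
  have hC := (abs_nonneg c).trans hc
  refine (abs_sub _ _).trans (add_le_add ?_ ?_)
  · rw [abs_mul, abs_of_nonneg h'.1]
    exact mul_le_mul (abs_neg_pow_div_le hc _) h'.2 h'.1 (by positivity)
  · rw [abs_mul, abs_of_nonneg h.1]
    exact mul_le_mul (abs_neg_pow_div_le hc _) h.2 h.1 (by positivity)

lemma summable_pow_succ_div_mul_exp (C : ℝ) :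
    Summable fun n : ℕ => C ^ (n + 1) / (n + 1).factorial * Real.exp C :=
  ((summable_nat_add_iff 1).2 (Real.summable_pow_div_factorial C)).mul_right _

lemma summable_coverTermDeriv_bound (C : ℝ) : Summable fun n : ℕ =>
    C ^ (n + 1) / (n + 1).factorial * Real.exp C + C ^ n / n.factorial * Real.exp C :=
  (summable_pow_succ_div_mul_exp C).add ((Real.summable_pow_div_factorial C).mul_right _)

lemma summable_coverTerm (c : ℝ) : Summable fun n => coverTerm n c :=
  .of_norm_bounded (summable_pow_succ_div_mul_exp |c|) fun n => abs_coverTerm_le le_rfl n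

lemma summable_coverTermDeriv (c : ℝ) : Summable fun n => coverTermDeriv n c :=
  .of_norm_bounded (summable_coverTermDeriv_bound |c|) fun n => abs_coverTermDeriv_le le_rfl n

lemma hasDerivAt_tsum_coverTerm (c : ℝ) :
    HasDerivAt (fun c => ∑' n, coverTerm n c) (∑' n, coverTermDeriv n c) c := by
  have hmem (d : ℝ) (hd : d ∈ Metric.ball (0 : ℝ) (|c| + 1)) : |d| ≤ |c| + 1 := by
    rw [Metric.mem_ball, dist_zero_right, Real.norm_eq_abs] at hd
    exact hd.le
  -- The bound is uniform on the ball about 0 of radius `|c| + 1`, which contains both `c` and the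
  -- point 0, where the series converges.
  exact hasDerivAt_tsum_of_isPreconnected (summable_coverTermDeriv_bound (|c| + 1))
    Metric.isOpen_ball (convex_ball (0 : ℝ) (|c| + 1)).isPreconnected
    (fun n d _ => hasDerivAt_coverTerm n d)
    (fun n d hd => abs_coverTermDeriv_le (hmem d hd) n) (Metric.mem_ball_self (by positivity))
    (summable_coverTerm 0) (by simp)

/-- The probability that the circle of radius `r` around the nucleus of the typical cell is not
covered, as a function of `c = 4πλr²`. -/
def uncoveredProb (c : ℝ) : ℝ := Real.exp (-c) * (1 - ∑' n, coverTerm n c)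

lemma hasDerivAt_uncoveredProb (c : ℝ) : HasDerivAt uncoveredProb
    (-(Real.exp (-c) * (1 + ∑' n, (coverTermDeriv n c - coverTerm n c)))) c := by
  have h := ((hasDerivAt_id c).neg.exp).mul ((hasDerivAt_tsum_coverTerm c).const_sub 1)
  refine h.congr_deriv ?_
  rw [(summable_coverTermDeriv c).tsum_sub (summable_coverTerm c)]
  simp only [id, Pi.neg_apply]
  ring

lemma uncoveredProb_zero : uncoveredProb 0 = 1 := by
  simp [uncoveredProb, coverTerm]

lemma zeta_succ (lam : ℝ) (n : ℕ) (r : ℝ) :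
    zeta lam (n + 1) r = spacingZeta n (4 * Real.pi * lam * r ^ 2) := rfl

lemma hasDerivAt_area (lam r : ℝ) :
    HasDerivAt (fun r : ℝ => 4 * Real.pi * lam * r ^ 2) (8 * Real.pi * lam * r) r := by
  have h := (hasDerivAt_pow 2 r).const_mul (4 * Real.pi * lam)
  refine h.congr_deriv ?_
  push_cast
  ring

lemma hasDerivAt_zeta (lam : ℝ) (n : ℕ) (r : ℝ) : HasDerivAt (zeta lam (n + 1))
    (spacingZetaDeriv n (4 * Real.pi * lam * r ^ 2) * (8 * Real.pi * lam * r)) r :=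
  HasDerivAt.comp r (h₂ := spacingZeta n) (hasDerivAt_spacingZeta n (4 * Real.pi * lam * r ^ 2))
    (hasDerivAt_area lam r)

lemma integrable_zetaIntegrand (lam : ℝ) (n : ℕ) (r : ℝ) :
    Integrable (zetaIntegrand lam (n + 1) r) (simplexUniform (n + 1)) :=
  integrable_spacingWeight (4 * Real.pi * lam * r ^ 2) n

section

variable {lam : ℝ} (hlam : 0 < lam)
include hlam

/-- By the chain rule `ψ_k / (8πλr)` is the derivative of `ζ_k` with respect to `c = 4πλr²`; this
explains the shape of the density. -/
lemma densityTerm_succ {r : ℝ} (hr : r ≠ 0) (n : ℕ) : densityTerm lam r (n + 1) =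
    coverTermDeriv n (4 * Real.pi * lam * r ^ 2) - coverTerm n (4 * Real.pi * lam * r ^ 2) := by
  have h : psi lam (n + 1) r / (8 * Real.pi * lam * r) =
      spacingZetaDeriv n (4 * Real.pi * lam * r ^ 2) := by
    rw [psi, (hasDerivAt_zeta lam n r).deriv, mul_div_assoc, div_self, mul_one]
    have := Real.pi_pos
    positivity
  rw [densityTerm, h, zeta_succ, coverTermDeriv, coverTerm, Nat.add_sub_cancel]
  ring

lemma summable_densityTerm {r : ℝ} (hr : r ≠ 0) :
    Summable fun n : ℕ => densityTerm lam r (n + 1) := by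
  simp_rw [densityTerm_succ hlam hr]
  exact (summable_coverTermDeriv _).sub (summable_coverTerm _)

lemma hasDerivAt_survival (r : ℝ) : HasDerivAt
    (fun r => uncoveredProb (4 * Real.pi * lam * r ^ 2)) (-density lam r) r := by
  refine ((hasDerivAt_uncoveredProb (4 * Real.pi * lam * r ^ 2)).comp r
    (hasDerivAt_area lam r)).congr_deriv ?_
  rcases eq_or_ne r 0 with rfl | hr
  -- At `r = 0` the outer factor `r` makes both sides vanish, whatever the divisions by zero in the
  -- series give.
  · simp [density]
  · simp_rw [density, densityTerm_succ hlam hr]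
    ring

lemma measurable_density : Measurable (density lam) := by
  have h : density lam =
      fun r => -deriv (fun r => uncoveredProb (4 * Real.pi * lam * r ^ 2)) r := by
    funext r
    rw [(hasDerivAt_survival hlam r).deriv, neg_neg]
  rw [h]
  exact (measurable_deriv _).neg

lemma continuous_survival :
    Continuous fun r => uncoveredProb (4 * Real.pi * lam * r ^ 2) :=
  continuous_iff_continuousAt.2 fun r => (hasDerivAt_survival hlam r).continuousAt

lemma tendsto_survival (h0 : ∀ r, 0 < r → 0 ≤ uncoveredProb (4 * Real.pi * lam * r ^ 2))
    (h1 : ∀ r, 0 < r → uncoveredProb (4 * Real.pi * lam * r ^ 2) ≤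
      Real.exp (-(4 * Real.pi * lam * r ^ 2)) + 4 * Real.pi * lam * r ^ 2 *
        Real.exp (-(4 * Real.pi * lam * r ^ 2)) * spacingZeta 0 (4 * Real.pi * lam * r ^ 2)) :
    Filter.Tendsto (fun r => uncoveredProb (4 * Real.pi * lam * r ^ 2)) Filter.atTop (nhds 0) := by
  have ha : Filter.Tendsto (fun r : ℝ => 4 * Real.pi * lam * r ^ 2) Filter.atTop Filter.atTop :=
    (Filter.tendsto_pow_atTop two_ne_zero).const_mul_atTop
      (by have := Real.pi_pos; positivity)
  -- This is the Bonferroni bound after `ζ_1 ≤ e^{7c/8}`, with `c e^{-c/8}` written in the form `8 x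
  -- e^{-x}`.
  have hb : Filter.Tendsto (fun c : ℝ => Real.exp (-c) + 8 * (c / 8 * Real.exp (-(c / 8))))
      Filter.atTop (nhds 0) := by
    have hd : Filter.Tendsto (fun c : ℝ => c / 8) Filter.atTop Filter.atTop :=
      Filter.tendsto_id.atTop_div_const (by norm_num)
    have h2 := (Real.tendsto_pow_mul_exp_neg_atTop_nhds_zero 1).comp hd
    have h3 := (Real.tendsto_exp_neg_atTop_nhds_zero).add (h2.const_mul 8)
    simpa using h3
  refine tendsto_of_tendsto_of_tendsto_of_le_of_le' tendsto_const_nhds (hb.comp ha) ?_ ?_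
  · filter_upwards [Filter.eventually_gt_atTop 0] with r hr using h0 r hr
  · filter_upwards [Filter.eventually_gt_atTop 0] with r hr
    refine (h1 r hr).trans ?_
    have hc : 0 ≤ 4 * Real.pi * lam * r ^ 2 := by have := Real.pi_pos; positivity
    simp only [Function.comp]
    generalize 4 * Real.pi * lam * r ^ 2 = c at *
    refine add_le_add le_rfl ?_
    calc c * Real.exp (-c) * spacingZeta 0 c ≤ c * Real.exp (-c) * Real.exp (7 / 8 * c) :=
          mul_le_mul_of_nonneg_left (spacingZeta_zero_le hc) (by positivity)
      _ = 8 * (c / 8 * Real.exp (-(c / 8))) := by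
          rw [mul_assoc, ← Real.exp_add]
          ring_nf

end

/-! ### The survival function -/

section

variable {Ω : Type*} [MeasurableSpace Ω] {μ : Measure Ω} {lam : ℝ} {Φ : Ω → Set Plane}
  {B : Set Plane} {r : ℝ}

/-- The count is a pointwise limit of the partial sums of inclusion–exclusion, whose terms are
measurable tuple counts. -/
lemma measurable_encard_uncovered (hΦ : IsPoissonProcess μ lam Φ) (hB : MeasurableSet B)
    (hBb : Bornology.IsBounded B) (hr : 0 < r) :
    Measurable fun ω => ({x ∈ Φ ω ∩ B | Uncovered (Φ ω) x r}.encard : ℝ≥0∞) := by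
  have h1 : Measurable fun ω => ({x ∈ Φ ω ∩ B | Uncovered (Φ ω) x r}.encard : ℝ≥0∞).toReal -
      (tupleCount (Φ ω) 1 {X ∈ {X | X 0 ∈ B} | Φ ω ∩ punctured r (X 0) = ∅}).toReal := by
    refine measurable_of_tendsto_metrizable (f := fun N ω => ∑ n ∈ Finset.range N,
      (-1 : ℝ) ^ n / (n + 1).factorial *
      (tupleCount (Φ ω) (n + 2) {X ∈ gapTuples B r n | Φ ω ∩ gapDisks r X = ∅}).toReal)
      (fun N => Finset.measurable_fun_sum _ fun n _ =>
        (measurable_tupleCount_gap hΦ hB hBb r n).ennreal_toReal.const_mul _)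
      (tendsto_pi_nhds.2 fun ω =>
        (hasSum_uncovered (hΦ.locallyFinite ω) hBb hr).tendsto_sum_nat)
  have h2 := h1.add (measurable_tupleCount_isolated hΦ hB hBb r).ennreal_toReal
  have h3 (ω : Ω) : ({x ∈ Φ ω ∩ B | Uncovered (Φ ω) x r}.encard : ℝ≥0∞) =
      ENNReal.ofReal ((({x ∈ Φ ω ∩ B | Uncovered (Φ ω) x r}.encard : ℝ≥0∞).toReal -
      (tupleCount (Φ ω) 1 {X ∈ {X | X 0 ∈ B} | Φ ω ∩ punctured r (X 0) = ∅}).toReal) +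
      (tupleCount (Φ ω) 1 {X ∈ {X | X 0 ∈ B} | Φ ω ∩ punctured r (X 0) = ∅}).toReal) := by
    rw [sub_add_cancel, ENNReal.ofReal_toReal]
    have : {x ∈ Φ ω ∩ B | Uncovered (Φ ω) x r}.Finite :=
      (hΦ.locallyFinite ω B hBb).subset fun x hx => hx.1
    simpa using this
  rw [funext h3]
  exact h2.ennreal_ofReal

variable [IsProbabilityMeasure μ]

lemma lintegral_encard_uncovered_ne_top (hlam : 0 < lam) (hΦ : IsPoissonProcess μ lam Φ)
    (hB : MeasurableSet B) (hBb : Bornology.IsBounded B) (r : ℝ) :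
    ∫⁻ ω, ({x ∈ Φ ω ∩ B | Uncovered (Φ ω) x r}.encard : ℝ≥0∞) ∂μ ≠ ∞ := by
  refine ne_top_of_le_ne_top ?_ (lintegral_mono fun ω => ENat.toENNReal_le.2
    (Set.encard_le_encard (Set.sep_subset (Φ ω ∩ B) _)))
  rw [lintegral_encard hlam hΦ hB hBb.measure_lt_top.ne]
  exact ENNReal.mul_ne_top ENNReal.ofReal_ne_top hBb.measure_lt_top.ne

/-- Expectations are taken in `hasSum_uncovered`. The terms have mean absolute values `K *
|coverTerm|`, a summable sequence, so sum and expectation may be exchanged. -/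
theorem integral_encard_uncovered (hlam : 0 < lam) (hΦ : IsPoissonProcess μ lam Φ)
    (hB : MeasurableSet B) (hBb : Bornology.IsBounded B) (hr : 0 < r) :
    ∫ ω, ({x ∈ Φ ω ∩ B | Uncovered (Φ ω) x r}.encard : ℝ≥0∞).toReal ∂μ =
      lam * (volume B).toReal * uncoveredProb (4 * Real.pi * lam * r ^ 2) := by
  have ha : 0 ≤ 4 * Real.pi * lam * r ^ 2 := by have := Real.pi_pos; positivity
  set I : Ω → ℝ≥0∞ := fun ω =>
    tupleCount (Φ ω) 1 {X ∈ {X | X 0 ∈ B} | Φ ω ∩ punctured r (X 0) = ∅} with hI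
  set T : ℕ → Ω → ℝ≥0∞ := fun n ω =>
    tupleCount (Φ ω) (n + 2) {X ∈ gapTuples B r n | Φ ω ∩ gapDisks r X = ∅} with hT
  have hvol : volume B ≠ ∞ := hBb.measure_lt_top.ne
  have hIm : Measurable I := measurable_tupleCount_isolated hΦ hB hBb r
  have hTm (n : ℕ) : Measurable (T n) := measurable_tupleCount_gap hΦ hB hBb r n
  have hIl := lintegral_tupleCount_isolated hlam hΦ hB hBb hr
  have hTl := lintegral_tupleCount_gap hlam hΦ hB hBb hr
  change ∫⁻ ω, I ω ∂μ = _ at hIl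
  change ∀ n, ∫⁻ ω, T n ω ∂μ = _ at hTl
  simp_rw [← ofReal_spacingZeta] at hTl
  have hItop : ∫⁻ ω, I ω ∂μ ≠ ∞ := by
    rw [hIl]
    exact ENNReal.mul_ne_top (ENNReal.mul_ne_top ENNReal.ofReal_ne_top hvol) ENNReal.ofReal_ne_top
  have hTtop (n : ℕ) : ∫⁻ ω, T n ω ∂μ ≠ ∞ := by
    rw [hTl]
    exact ENNReal.mul_ne_top (ENNReal.mul_ne_top ENNReal.ofReal_ne_top hvol)
      (ENNReal.mul_ne_top ENNReal.ofReal_ne_top ENNReal.ofReal_ne_top)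
  have hIi := integrable_toReal_of_lintegral_ne_top hIm.aemeasurable hItop
  have hTi (n : ℕ) := integrable_toReal_of_lintegral_ne_top (hTm n).aemeasurable (hTtop n)
  have hNi := integrable_toReal_of_lintegral_ne_top
    (measurable_encard_uncovered hΦ hB hBb hr).aemeasurable
    (lintegral_encard_uncovered_ne_top hlam hΦ hB hBb r)
  have hIint : ∫ ω, (I ω).toReal ∂μ =
      lam * (volume B).toReal * Real.exp (-(4 * Real.pi * lam * r ^ 2)) := by
    rw [integral_toReal hIm.aemeasurable (ae_lt_top hIm hItop), hIl, ENNReal.toReal_mul,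
      ENNReal.toReal_mul, ENNReal.toReal_ofReal hlam.le, ENNReal.toReal_ofReal (Real.exp_pos _).le]
  have hTint (n : ℕ) : ∫ ω, (T n ω).toReal ∂μ = lam * (volume B).toReal *
      ((4 * Real.pi * lam * r ^ 2) ^ (n + 1) * Real.exp (-(4 * Real.pi * lam * r ^ 2)) *
        spacingZeta n (4 * Real.pi * lam * r ^ 2)) := by
    rw [integral_toReal (hTm n).aemeasurable (ae_lt_top (hTm n) (hTtop n)), hTl,
      ENNReal.toReal_mul, ENNReal.toReal_mul, ENNReal.toReal_mul, ENNReal.toReal_ofReal hlam.le,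
      ENNReal.toReal_ofReal (by positivity), ENNReal.toReal_ofReal (spacingZeta_mem le_rfl n).1]
  set K : ℝ := lam * (volume B).toReal * Real.exp (-(4 * Real.pi * lam * r ^ 2)) with hK
  -- The signs match through `(-1)^n c^(n+1) = -(-c)^(n+1)`.
  have hterm (n : ℕ) : ∫ ω, (-1 : ℝ) ^ n / (n + 1).factorial * (T n ω).toReal ∂μ =
      -(K * coverTerm n (4 * Real.pi * lam * r ^ 2)) := by
    rw [integral_const_mul, hTint, coverTerm, neg_pow (4 * Real.pi * lam * r ^ 2), hK]
    ring
  have hsum : Summable fun n => ∫ ω, ‖(-1 : ℝ) ^ n / (n + 1).factorial * (T n ω).toReal‖ ∂μ := by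
    have h (n : ℕ) : ∫ ω, ‖(-1 : ℝ) ^ n / (n + 1).factorial * (T n ω).toReal‖ ∂μ =
        K * |coverTerm n (4 * Real.pi * lam * r ^ 2)| := by
      simp_rw [norm_mul, Real.norm_of_nonneg ENNReal.toReal_nonneg]
      rw [integral_const_mul, hTint, coverTerm, abs_mul, abs_of_nonneg (spacingZeta_mem le_rfl n).1,
        abs_div, abs_pow, abs_neg, abs_of_nonneg ha, Nat.abs_cast, norm_div, norm_pow, norm_neg,
        norm_one, one_pow, RCLike.norm_natCast, hK]
      ring
    simp_rw [h]
    exact (summable_coverTerm _).abs.mul_left K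
  have h := hasSum_integral_of_summable_integral_norm (fun n => (hTi n).const_mul _) hsum
  simp_rw [hterm] at h
  have h' := h.unique (((summable_coverTerm (4 * Real.pi * lam * r ^ 2)).hasSum.mul_left K).neg)
  have h'' : ∫ ω, ∑' n : ℕ, (-1 : ℝ) ^ n / (n + 1).factorial * (T n ω).toReal ∂μ =
      ∫ ω, (({x ∈ Φ ω ∩ B | Uncovered (Φ ω) x r}.encard : ℝ≥0∞).toReal - (I ω).toReal) ∂μ :=
    integral_congr_ae (Filter.Eventually.of_forall fun ω =>
      (hasSum_uncovered (hΦ.locallyFinite ω) hBb hr).tsum_eq)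
  rw [h'', integral_sub hNi hIi, hIint] at h'
  rw [uncoveredProb, ← mul_assoc, ← hK]
  linarith

theorem lintegral_encard_uncovered (hlam : 0 < lam) (hΦ : IsPoissonProcess μ lam Φ)
    (hB : MeasurableSet B) (hBb : Bornology.IsBounded B) (hr : 0 < r) :
    ∫⁻ ω, ({x ∈ Φ ω ∩ B | Uncovered (Φ ω) x r}.encard : ℝ≥0∞) ∂μ =
      ENNReal.ofReal lam * volume B *
        ENNReal.ofReal (uncoveredProb (4 * Real.pi * lam * r ^ 2)) := by
  have hm := measurable_encard_uncovered hΦ hB hBb hr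
  have htop := lintegral_encard_uncovered_ne_top hlam hΦ hB hBb r
  have h := integral_encard_uncovered hlam hΦ hB hBb hr
  rw [integral_toReal hm.aemeasurable (ae_lt_top hm htop)] at h
  rw [← ENNReal.ofReal_toReal htop, h, ENNReal.ofReal_mul (by positivity),
    ENNReal.ofReal_mul hlam.le, ENNReal.ofReal_toReal hBb.measure_lt_top.ne]

lemma lam_mul_volume_ball_pos (hlam : 0 < lam) :
    0 < lam * (volume (Metric.ball (0 : Plane) 1)).toReal :=
  mul_pos hlam (ENNReal.toReal_pos (Metric.measure_ball_pos _ _ one_pos).ne'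
    measure_ball_lt_top.ne)

lemma survival_nonneg (hlam : 0 < lam) (hΦ : IsPoissonProcess μ lam Φ) (hr : 0 < r) :
    0 ≤ uncoveredProb (4 * Real.pi * lam * r ^ 2) := by
  have h := integral_encard_uncovered hlam hΦ (B := Metric.ball 0 1) Metric.isOpen_ball.measurableSet
    Metric.isBounded_ball hr
  have h0 : 0 ≤ ∫ ω, ({x ∈ Φ ω ∩ Metric.ball 0 1 | Uncovered (Φ ω) x r}.encard : ℝ≥0∞).toReal ∂μ :=
    integral_nonneg fun _ => ENNReal.toReal_nonneg
  rw [h] at h0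
  exact nonneg_of_mul_nonneg_right h0 (lam_mul_volume_ball_pos hlam)

/-- Monotonicity is not visible in the series; it is read off from the expected counts and gives the
sign of the density. -/
lemma antitoneOn_survival (hlam : 0 < lam) (hΦ : IsPoissonProcess μ lam Φ) :
    AntitoneOn (fun r => uncoveredProb (4 * Real.pi * lam * r ^ 2)) (Set.Ioi 0) := by
  intro r hr s hs hrs
  have hle : ∫⁻ ω, ({x ∈ Φ ω ∩ Metric.ball 0 1 | Uncovered (Φ ω) x s}.encard : ℝ≥0∞) ∂μ ≤
      ∫⁻ ω, ({x ∈ Φ ω ∩ Metric.ball 0 1 | Uncovered (Φ ω) x r}.encard : ℝ≥0∞) ∂μ :=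
    lintegral_mono fun ω => ENat.toENNReal_le.2
      (Set.encard_le_encard fun x hx => ⟨hx.1, hx.2.anti hr hrs⟩)
  rw [lintegral_encard_uncovered hlam hΦ Metric.isOpen_ball.measurableSet Metric.isBounded_ball hr,
    lintegral_encard_uncovered hlam hΦ Metric.isOpen_ball.measurableSet Metric.isBounded_ball hs,
    ENNReal.mul_le_mul_iff_right _ _] at hle
  · exact (ENNReal.ofReal_le_ofReal_iff (survival_nonneg hlam hΦ hr)).1 hle
  · exact mul_ne_zero (ENNReal.ofReal_pos.2 hlam).ne' (Metric.measure_ball_pos _ _ one_pos).ne'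
  · exact ENNReal.mul_ne_top ENNReal.ofReal_ne_top measure_ball_lt_top.ne

lemma density_nonneg (hlam : 0 < lam) (hΦ : IsPoissonProcess μ lam Φ) (hr : 0 < r) :
    0 ≤ density lam r := by
  have h := (antitoneOn_survival hlam hΦ).derivWithin_nonpos (x := r)
  rw [derivWithin_of_isOpen isOpen_Ioi hr, (hasDerivAt_survival hlam r).deriv] at h
  linarith

lemma survival_le (hlam : 0 < lam) (hΦ : IsPoissonProcess μ lam Φ) (hr : 0 < r) :
    uncoveredProb (4 * Real.pi * lam * r ^ 2) ≤
      Real.exp (-(4 * Real.pi * lam * r ^ 2)) + 4 * Real.pi * lam * r ^ 2 *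
        Real.exp (-(4 * Real.pi * lam * r ^ 2)) * spacingZeta 0 (4 * Real.pi * lam * r ^ 2) := by
  have hz := (spacingZeta_mem (le_refl |4 * Real.pi * lam * r ^ 2|) 0).1
  have ha : 0 ≤ 4 * Real.pi * lam * r ^ 2 := by have := Real.pi_pos; positivity
  have hBm : MeasurableSet (Metric.ball (0 : Plane) 1) := Metric.isOpen_ball.measurableSet
  have hBb : Bornology.IsBounded (Metric.ball (0 : Plane) 1) := Metric.isBounded_ball
  have hle := lintegral_mono (μ := μ) fun ω =>
    encard_uncovered_le (hΦ.locallyFinite ω) hBb hr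
  rw [lintegral_add_left (measurable_tupleCount_isolated hΦ hBm hBb r),
    lintegral_encard_uncovered hlam hΦ hBm hBb hr, lintegral_tupleCount_isolated hlam hΦ hBm hBb hr,
    lintegral_tupleCount_gap hlam hΦ hBm hBb hr, ← ofReal_spacingZeta, ← mul_add,
    ENNReal.mul_le_mul_iff_right, zero_add, pow_one, ← ENNReal.ofReal_mul (by positivity),
    ← ENNReal.ofReal_add (by positivity) (by positivity)] at hle
  · exact (ENNReal.ofReal_le_ofReal_iff (by positivity)).1 hle
  · exact mul_ne_zero (ENNReal.ofReal_pos.2 hlam).ne' (Metric.measure_ball_pos _ _ one_pos).ne'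
  · exact ENNReal.mul_ne_top ENNReal.ofReal_ne_top measure_ball_lt_top.ne

/-- The fundamental theorem of calculus on a half-line: for a derivative of constant sign, the limit
at infinity already gives integrability. -/
lemma lintegral_Ioi_density (hlam : 0 < lam) (hΦ : IsPoissonProcess μ lam Φ) (hr : 0 ≤ r) :
    ∫⁻ s in Set.Ioi r, ENNReal.ofReal (density lam s) =
      ENNReal.ofReal (uncoveredProb (4 * Real.pi * lam * r ^ 2)) := by
  have hlim := tendsto_survival hlam (fun r hr => survival_nonneg hlam hΦ hr)
    fun r hr => survival_le hlam hΦ hr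
  have hneg (s : ℝ) (hs : s ∈ Set.Ioi r) : -density lam s ≤ 0 :=
    neg_nonpos.2 (density_nonneg hlam hΦ (hr.trans_lt hs))
  have hint := integrableOn_Ioi_deriv_of_nonpos' (fun s (_ : s ∈ Set.Ici r) =>
    hasDerivAt_survival hlam s) hneg hlim
  have h := integral_Ioi_of_hasDerivAt_of_nonpos' (fun s (_ : s ∈ Set.Ici r) =>
    hasDerivAt_survival hlam s) hneg hlim
  rw [← ofReal_integral_eq_lintegral_ofReal (integrable_neg_iff.1 hint) ?_]
  · rw [integral_neg] at h
    congr 1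
    linarith
  · filter_upwards [ae_restrict_mem measurableSet_Ioi] with s hs
    exact density_nonneg hlam hΦ (hr.trans_lt hs)

end

/-! ### The law of the circumradius -/

/-- The counting measure of the circumradii of the cells with nucleus in `B`. -/
def circumradiusCount (S B : Set Plane) : Measure ℝ≥0∞ :=
  Measure.sum fun x : ↥(S ∩ B) => Measure.dirac (circumradius S x)

lemma circumradiusCount_apply (S B : Set Plane) {A : Set ℝ≥0∞} (hA : MeasurableSet A) :
    circumradiusCount S B A = ({x ∈ S ∩ B | circumradius S x ∈ A}.encard : ℝ≥0∞) := by
  rw [circumradiusCount, Measure.sum_apply _ hA, ← ENNReal.tsum_set_one,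
    tsum_subtype {x ∈ S ∩ B | circumradius S x ∈ A} fun _ => (1 : ℝ≥0∞)]
  simp_rw [Measure.dirac_apply' _ hA]
  rw [tsum_subtype (S ∩ B) fun x => A.indicator (1 : ℝ≥0∞ → ℝ≥0∞) (circumradius S x)]
  refine tsum_congr fun x => ?_
  by_cases h : x ∈ S ∩ B <;> by_cases h' : circumradius S x ∈ A <;>
    simp [Set.indicator, h, h']

lemma encard_lt_circumradius {S : Set Plane} (hS : S.Countable) (B : Set Plane) {r : ℝ}
    (hr : 0 ≤ r) : ({x ∈ S ∩ B | ENNReal.ofReal r < circumradius S x}.encard : ℝ≥0∞) =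
      ⨆ n : ℕ, ({x ∈ S ∩ B | Uncovered S x (r + 1 / ((n : ℝ) + 1))}.encard : ℝ≥0∞) := by
  have hc (p : Plane → Prop) : ({x ∈ S ∩ B | p x}.encard : ℝ≥0∞) =
      Measure.count {x ∈ S ∩ B | p x} :=
    (Measure.count_apply (hS.mono fun x hx => hx.1.1).measurableSet).symm
  have hmono : Monotone fun n : ℕ => {x ∈ S ∩ B | Uncovered S x (r + 1 / ((n : ℝ) + 1))} := by
    intro m n hmn x hx
    refine ⟨hx.1, hx.2.anti (by positivity) ?_⟩
    gcongr
  simp_rw [hc]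
  rw [← hmono.measure_iUnion]
  congr 1
  ext x
  simp only [Set.mem_ofPred_eq, Set.mem_iUnion, lt_circumradius_iff_exists_nat hr,
    exists_and_left]

section

variable {Ω : Type*} [MeasurableSpace Ω] {μ : Measure Ω} {lam : ℝ} {Φ : Ω → Set Plane}
  {B : Set Plane}

lemma measurable_encard_lt_circumradius (hΦ : IsPoissonProcess μ lam Φ) (hB : MeasurableSet B)
    (hBb : Bornology.IsBounded B) {r : ℝ} (hr : 0 ≤ r) : Measurable fun ω =>
      ({x ∈ Φ ω ∩ B | ENNReal.ofReal r < circumradius (Φ ω) x}.encard : ℝ≥0∞) := by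
  simp_rw [fun ω => encard_lt_circumradius (hΦ.countable ω) B hr]
  exact Measurable.iSup fun n => measurable_encard_uncovered hΦ hB hBb (by positivity)

lemma measurable_circumradiusCount (hΦ : IsPoissonProcess μ lam Φ) (hB : MeasurableSet B)
    (hBb : Bornology.IsBounded B) : Measurable fun ω => circumradiusCount (Φ ω) B := by
  have huniv (ω : Ω) : circumradiusCount (Φ ω) B Set.univ = ((Φ ω ∩ B).encard : ℝ≥0∞) := by
    simp [circumradiusCount_apply _ _ MeasurableSet.univ]
  have (ω : Ω) : IsFiniteMeasure (circumradiusCount (Φ ω) B) := by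
    refine ⟨?_⟩
    rw [huniv]
    simpa using hΦ.locallyFinite ω B hBb
  refine Measurable.measure_of_isPiSystem
    (BorelSpace.measurable_eq.trans (borel_eq_generateFrom_Ioi ℝ≥0∞)) isPiSystem_Ioi ?_ ?_
  · rintro _ ⟨a, rfl⟩
    rcases eq_or_ne a ∞ with rfl | ha
    · simp
    · rw [← ENNReal.ofReal_toReal ha]
      simp_rw [circumradiusCount_apply _ _ measurableSet_Ioi]
      exact measurable_encard_lt_circumradius hΦ hB hBb ENNReal.toReal_nonneg
  · simp_rw [huniv]
    exact hΦ.measurable_encard hB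

variable [IsProbabilityMeasure μ]

/-- Monotone convergence along the radii `r + 1/(n+1)`, followed by continuity of the survival
function at `r`. -/
lemma lintegral_encard_lt_circumradius (hlam : 0 < lam) (hΦ : IsPoissonProcess μ lam Φ)
    (hB : MeasurableSet B) (hBb : Bornology.IsBounded B) {r : ℝ} (hr : 0 ≤ r) :
    ∫⁻ ω, ({x ∈ Φ ω ∩ B | ENNReal.ofReal r < circumradius (Φ ω) x}.encard : ℝ≥0∞) ∂μ =
      ENNReal.ofReal lam * volume B *
        ENNReal.ofReal (uncoveredProb (4 * Real.pi * lam * r ^ 2)) := by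
  have hpos (n : ℕ) : 0 < r + 1 / ((n : ℝ) + 1) := by positivity
  have hanti {m n : ℕ} (hmn : m ≤ n) : r + 1 / ((n : ℝ) + 1) ≤ r + 1 / ((m : ℝ) + 1) := by
    gcongr
  have hmono : Monotone fun (n : ℕ) ω =>
      ({x ∈ Φ ω ∩ B | Uncovered (Φ ω) x (r + 1 / ((n : ℝ) + 1))}.encard : ℝ≥0∞) :=
    fun m n hmn ω => ENat.toENNReal_le.2
      (Set.encard_le_encard fun x hx => ⟨hx.1, hx.2.anti (hpos n) (hanti hmn)⟩)
  simp_rw [fun ω => encard_lt_circumradius (hΦ.countable ω) B hr]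
  rw [lintegral_iSup (fun n => measurable_encard_uncovered hΦ hB hBb (hpos n)) hmono]
  simp_rw [fun n => lintegral_encard_uncovered hlam hΦ hB hBb (hpos n)]
  rw [← ENNReal.mul_iSup]
  congr 1
  refine iSup_eq_of_tendsto (fun m n hmn => ENNReal.ofReal_le_ofReal
    (antitoneOn_survival hlam hΦ (hpos n) (hpos m) (hanti hmn))) ?_
  have hlim : Filter.Tendsto (fun n : ℕ => r + 1 / ((n : ℝ) + 1)) Filter.atTop (nhds r) := by
    simpa using tendsto_one_div_add_atTop_nhds_zero_nat.const_add r
  exact ENNReal.tendsto_ofReal (((continuous_survival hlam).tendsto r).comp hlim)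

/-- The distribution on `[0, ∞]` with the given density on `(0, ∞)`. -/
def circumradiusLaw (lam : ℝ) : Measure ℝ≥0∞ :=
  ((volume.restrict (Set.Ioi 0)).withDensity fun r => ENNReal.ofReal (density lam r)).map
    ENNReal.ofReal

lemma circumradiusLaw_apply (lam : ℝ) {A : Set ℝ≥0∞} (hA : MeasurableSet A) :
    circumradiusLaw lam A = ∫⁻ r in {r : ℝ | 0 < r ∧ ENNReal.ofReal r ∈ A},
      ENNReal.ofReal (density lam r) := by
  have hA' := ENNReal.measurable_ofReal hA
  rw [circumradiusLaw, Measure.map_apply ENNReal.measurable_ofReal hA, withDensity_apply _ hA',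
    Measure.restrict_restrict hA', Set.inter_comm]
  rfl

lemma circumradiusLaw_Ioi (hlam : 0 < lam) (hΦ : IsPoissonProcess μ lam Φ) {r : ℝ} (hr : 0 ≤ r) :
    circumradiusLaw lam (Set.Ioi (ENNReal.ofReal r)) =
      ENNReal.ofReal (uncoveredProb (4 * Real.pi * lam * r ^ 2)) := by
  rw [circumradiusLaw_apply lam measurableSet_Ioi, ← lintegral_Ioi_density hlam hΦ hr]
  congr 2
  ext s
  simp only [Set.mem_ofPred_eq, Set.mem_Ioi]
  constructor
  · rintro ⟨h0, h⟩
    exact (ENNReal.ofReal_lt_ofReal_iff h0).1 h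
  · intro h
    exact ⟨hr.trans_lt h, (ENNReal.ofReal_lt_ofReal_iff (hr.trans_lt h)).2 h⟩

/-- The survival function is 1 at `r = 0`. As this law gives no mass to 0 and `∞`, total mass 1 is
what excludes these values for the typical cell. -/
lemma circumradiusLaw_univ (hlam : 0 < lam) (hΦ : IsPoissonProcess μ lam Φ) :
    circumradiusLaw lam Set.univ = 1 := by
  have h := circumradiusLaw_Ioi hlam hΦ le_rfl
  rw [zero_pow two_ne_zero, mul_zero, uncoveredProb_zero, ENNReal.ofReal_one] at h
  rw [← h, circumradiusLaw_apply lam MeasurableSet.univ,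
    circumradiusLaw_apply lam measurableSet_Ioi]
  congr 2
  ext s
  simp

/-- Both sides are finite measures in `A` that agree on the rays `(a, ∞]` and in total mass. -/
theorem lintegral_circumradiusCount (hlam : 0 < lam) (hΦ : IsPoissonProcess μ lam Φ)
    (hB : MeasurableSet B) (hBb : Bornology.IsBounded B) {A : Set ℝ≥0∞} (hA : MeasurableSet A) :
    ∫⁻ ω, circumradiusCount (Φ ω) B A ∂μ =
      ENNReal.ofReal lam * volume B * circumradiusLaw lam A := by
  have hm := measurable_circumradiusCount hΦ hB hBb
  have happ {A : Set ℝ≥0∞} (hA : MeasurableSet A) : μ.bind (fun ω => circumradiusCount (Φ ω) B) A =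
      ∫⁻ ω, ({x ∈ Φ ω ∩ B | circumradius (Φ ω) x ∈ A}.encard : ℝ≥0∞) ∂μ := by
    rw [Measure.bind_apply hA hm.aemeasurable]
    simp_rw [circumradiusCount_apply _ _ hA]
  have huniv : μ.bind (fun ω => circumradiusCount (Φ ω) B) Set.univ =
      ENNReal.ofReal lam * volume B := by
    rw [happ MeasurableSet.univ, ← lintegral_encard hlam hΦ hB hBb.measure_lt_top.ne]
    simp
  have : IsFiniteMeasure (μ.bind fun ω => circumradiusCount (Φ ω) B) := by
    refine ⟨?_⟩
    rw [huniv]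
    exact ENNReal.mul_lt_top ENNReal.ofReal_lt_top hBb.measure_lt_top
  have heq : μ.bind (fun ω => circumradiusCount (Φ ω) B) =
      (ENNReal.ofReal lam * volume B) • circumradiusLaw lam := by
    refine ext_of_generate_finite (Set.range Set.Ioi)
      (BorelSpace.measurable_eq.trans (borel_eq_generateFrom_Ioi ℝ≥0∞)) isPiSystem_Ioi ?_ ?_
    · rintro _ ⟨a, rfl⟩
      rcases eq_or_ne a ∞ with rfl | ha
      · simp
      · rw [← ENNReal.ofReal_toReal ha, happ measurableSet_Ioi, Measure.smul_apply, smul_eq_mul,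
          circumradiusLaw_Ioi hlam hΦ ENNReal.toReal_nonneg]
        exact lintegral_encard_lt_circumradius hlam hΦ hB hBb ENNReal.toReal_nonneg
    · rw [huniv, Measure.smul_apply, circumradiusLaw_univ hlam hΦ, smul_eq_mul, mul_one]
  rw [← Measure.bind_apply hA hm.aemeasurable, heq, Measure.smul_apply, smul_eq_mul]

/-- The Campbell formula for the circumradii of the cells with nucleus in a general window. -/
theorem lintegral_encard_circumradius (hlam : 0 < lam) (hΦ : IsPoissonProcess μ lam Φ)
    (hB : MeasurableSet B) {A : Set ℝ≥0∞} (hA : MeasurableSet A) :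
    ∫⁻ ω, ({x ∈ Φ ω ∩ B | circumradius (Φ ω) x ∈ A}.encard : ℝ≥0∞) ∂μ =
      ENNReal.ofReal lam * volume B * circumradiusLaw lam A := by
  -- A window of finite area may be unbounded, so it is cut into bounded annular pieces.
  set D : ℕ → Set Plane := fun n => B ∩ {x | ⌊‖x‖⌋₊ = n} with hD
  have hDm (n : ℕ) : MeasurableSet (D n) :=
    hB.inter ((Nat.measurable_floor.comp measurable_norm) (measurableSet_singleton n))
  have hDb (n : ℕ) : Bornology.IsBounded (D n) := by
    refine (Metric.isBounded_ball (x := (0 : Plane)) (r := n + 1)).subset fun x hx => ?_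
    rw [mem_ball_zero_iff]
    have h : ⌊‖x‖⌋₊ = n := hx.2
    rw [← h]
    exact Nat.lt_floor_add_one _
  have hdisj : Pairwise fun m n => Disjoint (D m) (D n) := fun m n hmn =>
    Set.disjoint_left.2 fun x hx hx' => hmn (hx.2.symm.trans hx'.2)
  have hunion : ⋃ n, D n = B := by
    ext x
    simp [hD]
  have hcount (ω : Ω) : ({x ∈ Φ ω ∩ B | circumradius (Φ ω) x ∈ A}.encard : ℝ≥0∞) =
      ∑' n, circumradiusCount (Φ ω) (D n) A := by
    simp_rw [circumradiusCount_apply _ _ hA]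
    have hc (E : Set Plane) : MeasurableSet {x ∈ Φ ω ∩ E | circumradius (Φ ω) x ∈ A} :=
      ((hΦ.countable ω).mono fun x hx => hx.1.1).measurableSet
    simp_rw [← fun E => Measure.count_apply (hc E)]
    rw [← measure_iUnion _ fun n => hc (D n)]
    · congr 1
      ext x
      simp only [hD, Set.mem_ofPred_eq, Set.mem_inter_iff, Set.mem_iUnion]
      exact ⟨fun h => ⟨_, ⟨h.1.1, h.1.2, rfl⟩, h.2⟩, fun ⟨_, h1, h2⟩ => ⟨⟨h1.1, h1.2.1⟩, h2⟩⟩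
    · exact fun m n hmn => (hdisj hmn).mono (fun x hx => hx.1.2) fun x hx => hx.1.2
  simp_rw [hcount]
  have hmeas (n : ℕ) : Measurable fun ω => circumradiusCount (Φ ω) (D n) A :=
    (Measure.measurable_coe hA).comp (measurable_circumradiusCount hΦ (hDm n) (hDb n))
  rw [lintegral_tsum fun n => (hmeas n).aemeasurable]
  simp_rw [fun n => lintegral_circumradiusCount hlam hΦ (hDm n) (hDb n) hA]
  rw [ENNReal.tsum_mul_right, ENNReal.tsum_mul_left, ← measure_iUnion hdisj hDm, hunion]

end

end PoissonVoronoi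

end

theorem proposition2 {Ω : Type*} [MeasurableSpace Ω] (μ : Measure Ω) [IsProbabilityMeasure μ]
    (lam : ℝ) (hlam : 0 < lam) (Φ : Ω → Set PoissonVoronoi.Plane)
    (hΦ : PoissonVoronoi.IsPoissonProcess μ lam Φ) :
    -- the integrals `ζ_k(r)`, their derivatives `ψ_k(r)` and the series make sense for `r > 0`
    (∀ k : ℕ, 1 ≤ k → ∀ r : ℝ, 0 < r →
      Integrable (PoissonVoronoi.zetaIntegrand lam k r) (PoissonVoronoi.simplexUniform k) ∧
      DifferentiableAt ℝ (PoissonVoronoi.zeta lam k) r) ∧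
    (∀ r : ℝ, 0 < r → Summable fun n : ℕ => PoissonVoronoi.densityTerm lam r (n + 1)) ∧
    -- the formula defines a nonnegative measurable function on `(0, ∞)`
    (∀ r : ℝ, 0 < r → 0 ≤ PoissonVoronoi.density lam r) ∧
    AEMeasurable (PoissonVoronoi.density lam) (volume.restrict (Set.Ioi 0)) ∧
    -- it is the density of the circumradius of the typical cell
    (∀ B : Set PoissonVoronoi.Plane, MeasurableSet B → volume B ≠ 0 → volume B ≠ ∞ →
      ∀ A : Set ℝ≥0∞, MeasurableSet A →
        PoissonVoronoi.typicalCircumradiusProb μ Φ B A =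
          ∫⁻ r in {r : ℝ | 0 < r ∧ ENNReal.ofReal r ∈ A},
            ENNReal.ofReal (PoissonVoronoi.density lam r)) := by
  refine ⟨fun k hk r _ => ?_, fun r hr => PoissonVoronoi.summable_densityTerm hlam hr.ne',
    fun r hr => PoissonVoronoi.density_nonneg hlam hΦ hr,
    (PoissonVoronoi.measurable_density hlam).aemeasurable, fun B hB h0 htop A hA => ?_⟩
  · obtain ⟨n, rfl⟩ := Nat.exists_eq_add_of_le' hk
    exact ⟨PoissonVoronoi.integrable_zetaIntegrand lam n r,
      (PoissonVoronoi.hasDerivAt_zeta lam n r).differentiableAt⟩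
  · have hlam' : ENNReal.ofReal lam ≠ 0 := (ENNReal.ofReal_pos.2 hlam).ne'
    rw [PoissonVoronoi.typicalCircumradiusProb,
      PoissonVoronoi.lintegral_encard_circumradius hlam hΦ hB hA,
      PoissonVoronoi.lintegral_encard hlam hΦ hB htop,
      ← PoissonVoronoi.circumradiusLaw_apply lam hA, mul_comm, ENNReal.mul_div_cancel_right
        (mul_ne_zero hlam' h0) (ENNReal.mul_ne_top ENNReal.ofReal_ne_top htop)]
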